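/- All manifolds are smooth, connected, Hausdorff and second countable, and carry a smooth Riemannian metric (smooth up to the boundary, if there is one); $\mathrm{int}\,M = M\setminus\partial M$, and integrals are with respect to the Riemannian volume. A function $u$ on $M$ is called superharmonic, $\Delta u\le 0$ in $\mathrm{int}\,M$, if $u\in C^0(M)\cap W^{1,2}_{loc}(\mathrm{int}\,M)$ and $$-\int_{\mathrm{int}\,M}\langle\nabla u,\nabla\rho\rangle\le 0\qquad\text{for all } 0\le\rho\in C_c^\infty(\mathrm{int}\,M).$$ A manifold $M$ with $\partial M\neq\emptyset$ is called $\mathcal D$-$L^1$-Liouville if every nonnegative superharmonic function $u\in L^1(M)$ with $u=0$ on $\partial M$ vanishes identically. A manifold $M$ with $\partial M=\emptyset$ is called $L^1$-Liouville if every nonnegative superharmonic function $u\in L^1(M)$ is constant. (a) Let $M_1,M_2$ be Riemannian manifolds with nonempty boundaries, and let $K_1\subset\mathrm{int}\,M_1$ and $K_2\subset\mathrm{int}\,M_2$ be compact sets such that there is a Riemannian isometry (a smooth diffeomorphism preserving the metrics) from $M_1\setminus K_1$ onto $M_2\setminus K_2$. Then $M_1$ is $\mathcal D$-$L^1$-Liouville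 if and only if $M_2$ is. (b) Let $M_1,M_2$ be complete Riemannian manifolds without boundary, and let $K_1\subset M_1$ and $K_2\subset M_2$ be compact sets such that there is a Riemannian isometry from $M_1\setminus K_1$ onto $M_2\setminus K_2$. Then $M_1$ is $L^1$-Liouville if and only if $M_2$ is. -/

import Mathlib

open Set MeasureTheory Filter
open scoped Manifold ContDiff Topology ENNReal Bundle

namespace L1Liouville

/-- A smooth Riemannian metric on a manifold `M` with model `I` (smooth up to the boundary). -/
abbrev Metric {n : ℕ} {H : Type*} [TopologicalSpace H]
    (I : ModelWithCorners ℝ (EuclideanSpace ℝ (Fin n)) H)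
    (M : Type*) [TopologicalSpace M] [ChartedSpace H M] [IsManifold I ∞ M] :=
  Bundle.ContMDiffRiemannianMetric I ∞ (EuclideanSpace ℝ (Fin n)) (fun p : M => TangentSpace I p)

section

variable {n : ℕ} {H : Type*} [TopologicalSpace H]
  {I : ModelWithCorners ℝ (EuclideanSpace ℝ (Fin n)) H}
  {M : Type*} [TopologicalSpace M] [ChartedSpace H M]

/-- In the chart around `x`, the tangent vector to `M` with constant coordinates `v`, at the point
with coordinates `y`: the image of `v` under the differential of the inverse chart. -/
noncomputable def coordVector (I : ModelWithCorners ℝ (EuclideanSpace ℝ (Fin n)) H)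
    (x : M) (v y : EuclideanSpace ℝ (Fin n)) : TangentSpace I ((extChartAt I x).symm y) :=
  mfderivWithin 𝓘(ℝ, EuclideanSpace ℝ (Fin n)) I (extChartAt I x).symm (range I) y v

variable [IsManifold I ∞ M]

/-- The matrix `g_ij` of the metric in the chart around `x`, at the point with coordinates `y`. -/
noncomputable def gramMatrix (g : Metric I M) (x : M) (y : EuclideanSpace ℝ (Fin n)) :
    Matrix (Fin n) (Fin n) ℝ :=
  Matrix.of fun i j => g.inner ((extChartAt I x).symm y)
    (coordVector I x (EuclideanSpace.single i 1) y) (coordVector I x (EuclideanSpace.single j 1) y)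

/-- The measure `√(det g_ij) dy` of the chart around `x`, carried to `M`; it lives on the domain of
that chart. -/
noncomputable def chartVolume [MeasurableSpace M] (g : Metric I M) (x : M) : Measure M :=
  ((volume.restrict (extChartAt I x).target).withDensity
    fun y => ENNReal.ofReal (Real.sqrt (gramMatrix g x y).det)).map (extChartAt I x).symm

/-- The Riemannian volume measure: the smallest measure that dominates the volume measures of all
charts. These agree on the overlaps of charts, so that (on a second countable manifold) it is the
measure which restricts to `√(det g_ij) dy` in each chart. -/
noncomputable def volumeMeasure [MeasurableSpace M] (g : Metric I M) : Measure M :=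
  ⨆ x : M, chartVolume g x

/-- The vector field `X` is the weak gradient of `u` on the interior of `M`, and it is locally
square integrable there: in each chart, for each direction `v`, the function `⟨X, ∂_v⟩` is
in `L²_loc` and is the weak derivative of `u` in the direction `v`. For continuous `u`,
the existence of such an `X` says that `u` belongs to `W^{1,2}_loc` of the interior of `M`. -/
def IsWeakGradient (g : Metric I M) (u : M → ℝ) (X : ∀ p : M, TangentSpace I p) : Prop :=
  ∀ (x : M) (v : EuclideanSpace ℝ (Fin n)),
    (∀ K : Set (EuclideanSpace ℝ (Fin n)), IsCompact K → K ⊆ interior (extChartAt I x).target →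
      MemLp (fun y => g.inner ((extChartAt I x).symm y) (X ((extChartAt I x).symm y))
        (coordVector I x v y)) 2 (volume.restrict K)) ∧
    ∀ ψ : EuclideanSpace ℝ (Fin n) → ℝ, ContDiff ℝ ∞ ψ → HasCompactSupport ψ →
      tsupport ψ ⊆ interior (extChartAt I x).target →
      ∫ y, u ((extChartAt I x).symm y) * fderiv ℝ ψ y v =
        -∫ y, g.inner ((extChartAt I x).symm y) (X ((extChartAt I x).symm y))
          (coordVector I x v y) * ψ y

/-- `u ∈ C⁰(M) ∩ W^{1,2}_loc(int M)` satisfies `Δu ≤ 0` weakly in the interior of `M`, that is,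
`-∫ ⟨∇u, ∇ρ⟩ ≤ 0` for every test function `0 ≤ ρ ∈ C_c^∞(int M)`. Here `⟨∇u, ∇ρ⟩` is written as
the differential of `ρ` applied to `∇u`. -/
def IsSuperharmonic [MeasurableSpace M] (g : Metric I M) (u : M → ℝ) : Prop :=
  Continuous u ∧ ∃ X : ∀ p : M, TangentSpace I p, IsWeakGradient g u X ∧
    ∀ ρ : M → ℝ, ContMDiff I 𝓘(ℝ, ℝ) ∞ ρ → HasCompactSupport ρ → tsupport ρ ⊆ I.interior M →
      (∀ p, 0 ≤ ρ p) → -∫ p, (mfderiv I 𝓘(ℝ, ℝ) ρ p (X p) : ℝ) ∂(volumeMeasure g) ≤ 0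

/-- The `L¹`-Liouville property, for manifolds without boundary. -/
def IsL1Liouville [MeasurableSpace M] (g : Metric I M) : Prop :=
  ∀ u : M → ℝ, IsSuperharmonic g u → (∀ p, 0 ≤ u p) → Integrable u (volumeMeasure g) →
    ∃ c : ℝ, ∀ p, u p = c

/-- The Dirichlet `L¹`-Liouville property, for manifolds with nonempty boundary. -/
def IsDirichletL1Liouville [MeasurableSpace M] (g : Metric I M) : Prop :=
  ∀ u : M → ℝ, IsSuperharmonic g u → (∀ p ∈ I.boundary M, u p = 0) → (∀ p, 0 ≤ u p) →
    Integrable u (volumeMeasure g) → ∀ p, u p = 0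

/-- The Riemannian distance: the infimum of the lengths of `C¹` paths. -/
noncomputable def riemannianDist (g : Metric I M) (p q : M) : ℝ≥0∞ :=
  letI : Bundle.RiemannianBundle (fun p : M => TangentSpace I p) := ⟨g.toRiemannianMetric⟩
  Manifold.riemannianEDist I p q

/-- Completeness of `M` for the Riemannian distance: every Cauchy sequence converges. -/
def IsCompleteMetric (g : Metric I M) : Prop :=
  ∀ x : ℕ → M, (∀ ε : ℝ≥0∞, 0 < ε → ∃ N, ∀ i ≥ N, ∀ j ≥ N, riemannianDist g (x i) (x j) < ε) →
    ∃ p, Tendsto x atTop (𝓝 p)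

end

/-- There is a Riemannian isometry from `M₁ ∖ K₁` onto `M₂ ∖ K₂`: a smooth diffeomorphism that
preserves the metrics. -/
def AreIsometricOutside {n₁ n₂ : ℕ} {H₁ H₂ : Type*} [TopologicalSpace H₁] [TopologicalSpace H₂]
    {I₁ : ModelWithCorners ℝ (EuclideanSpace ℝ (Fin n₁)) H₁}
    {I₂ : ModelWithCorners ℝ (EuclideanSpace ℝ (Fin n₂)) H₂}
    {M₁ M₂ : Type*} [TopologicalSpace M₁] [ChartedSpace H₁ M₁] [IsManifold I₁ ∞ M₁]
    [TopologicalSpace M₂] [ChartedSpace H₂ M₂] [IsManifold I₂ ∞ M₂]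
    (g₁ : Metric I₁ M₁) (g₂ : Metric I₂ M₂) (K₁ : Set M₁) (K₂ : Set M₂) : Prop :=
  ∃ φ : OpenPartialHomeomorph M₁ M₂, φ.source = K₁ᶜ ∧ φ.target = K₂ᶜ ∧
    ContMDiffOn I₁ I₂ ∞ φ K₁ᶜ ∧ ContMDiffOn I₂ I₁ ∞ φ.symm K₂ᶜ ∧
    ∀ p ∈ K₁ᶜ, ∀ v w : TangentSpace I₁ p,
      g₂.inner (φ p) (mfderiv I₁ I₂ φ p v) (mfderiv I₁ I₂ φ p w) = g₁.inner p v w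

end L1Liouville

set_option linter.unusedSectionVars false

namespace L1Liouville

section Mollification

open ContinuousLinearMap
open scoped Convolution

variable {E F : Type*} [NormedAddCommGroup E] [NormedSpace ℝ E] [FiniteDimensional ℝ E]
  [MeasureSpace E] [BorelSpace E] [(volume : Measure E).IsAddHaarMeasure]
  [NormedAddCommGroup F] [NormedSpace ℝ F] [CompleteSpace F]

/-- Convolution with a probability density does not increase the `L²` norm. -/
theorem eLpNorm_two_convolution_le {φ : E → ℝ} (hφ : Continuous φ) (hφ0 : ∀ x, 0 ≤ φ x)
    (hφi : Integrable φ) (hφ1 : ∫ x, φ x = 1) {b : E → F} (hb : AEStronglyMeasurable b volume) :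
    eLpNorm (φ ⋆[lsmul ℝ ℝ, volume] b) 2 volume ≤ eLpNorm b 2 volume := by
  have hcongr : (φ ⋆[lsmul ℝ ℝ, volume] b) = (φ ⋆[lsmul ℝ ℝ, volume] hb.mk b) :=
    convolution_congr _ (ae_eq_refl φ) hb.ae_eq_mk
  rw [hcongr, eLpNorm_congr_ae hb.ae_eq_mk]
  set c := hb.mk b with hc
  have hcm : StronglyMeasurable c := hb.stronglyMeasurable_mk
  have key : ∀ h : E → F, eLpNorm h 2 volume = (∫⁻ x, ‖h x‖ₑ ^ (2 : ℝ)) ^ (1 / (2 : ℝ)) := by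
    intro h
    rw [eLpNorm_eq_lintegral_rpow_enorm_toReal (by norm_num) (by norm_num)]
    norm_num
  rw [key, key]
  gcongr ?_ ^ _
  have hφm : Measurable fun t => ENNReal.ofReal (φ t) := hφ.measurable.ennreal_ofReal
  set ν : Measure E := volume.withDensity fun t => ENNReal.ofReal (φ t) with hν
  have hprob : IsProbabilityMeasure ν := by
    constructor
    rw [hν, withDensity_apply _ MeasurableSet.univ, setLIntegral_univ,
      ← ofReal_integral_eq_lintegral_ofReal hφi (Eventually.of_forall hφ0), hφ1]
    simp
  have hshift : ∀ x, Measurable fun t => ‖c (x - t)‖ₑ := fun x =>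
    (hcm.comp_measurable (measurable_const.sub measurable_id)).enorm
  have hpt : ∀ x, ‖(φ ⋆[lsmul ℝ ℝ, volume] c) x‖ₑ ^ (2 : ℝ) ≤
      ∫⁻ t, ENNReal.ofReal (φ t) * ‖c (x - t)‖ₑ ^ (2 : ℝ) := by
    intro x
    have h1 : ‖(φ ⋆[lsmul ℝ ℝ, volume] c) x‖ₑ ≤ ∫⁻ t, ‖c (x - t)‖ₑ ∂ν := by
      rw [convolution_def, hν, lintegral_withDensity_eq_lintegral_mul _ hφm (hshift x)]
      refine (enorm_integral_le_lintegral_enorm _).trans (le_of_eq ?_)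
      refine lintegral_congr fun t => ?_
      simp [enorm_smul, Real.enorm_of_nonneg (hφ0 t)]
    have h2 : (∫⁻ t, ‖c (x - t)‖ₑ ∂ν) ≤ (∫⁻ t, ‖c (x - t)‖ₑ ^ (2 : ℝ) ∂ν) ^ (1 / (2 : ℝ)) := by
      have := ENNReal.lintegral_mul_le_Lp_mul_Lq ν (Real.HolderConjugate.two_two)
        (hshift x).aemeasurable (aemeasurable_const (b := (1 : ℝ≥0∞)))
      simpa using this
    calc ‖(φ ⋆[lsmul ℝ ℝ, volume] c) x‖ₑ ^ (2 : ℝ)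
        ≤ ((∫⁻ t, ‖c (x - t)‖ₑ ^ (2 : ℝ) ∂ν) ^ (1 / (2 : ℝ))) ^ (2 : ℝ) := by
          gcongr; exact h1.trans h2
      _ = ∫⁻ t, ‖c (x - t)‖ₑ ^ (2 : ℝ) ∂ν := by
          rw [← ENNReal.rpow_mul]; norm_num
      _ = _ := by
          rw [hν, lintegral_withDensity_eq_lintegral_mul _ hφm ((hshift x).pow_const _)]
          rfl
  calc ∫⁻ x, ‖(φ ⋆[lsmul ℝ ℝ, volume] c) x‖ₑ ^ (2 : ℝ)
      ≤ ∫⁻ x, ∫⁻ t, ENNReal.ofReal (φ t) * ‖c (x - t)‖ₑ ^ (2 : ℝ) := lintegral_mono hpt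
    _ = ∫⁻ t, ∫⁻ x, ENNReal.ofReal (φ t) * ‖c (x - t)‖ₑ ^ (2 : ℝ) := by
        refine lintegral_lintegral_swap ?_
        refine Measurable.aemeasurable ?_
        refine (hφm.comp measurable_snd).mul (Measurable.pow_const ?_ _)
        exact (hcm.comp_measurable (measurable_fst.sub measurable_snd)).enorm
    _ = ∫⁻ t, ENNReal.ofReal (φ t) * ∫⁻ x, ‖c x‖ₑ ^ (2 : ℝ) := by
        refine lintegral_congr fun t => ?_
        rw [lintegral_const_mul' _ _ ENNReal.ofReal_ne_top,
          lintegral_sub_right_eq_self (fun x => ‖c x‖ₑ ^ (2 : ℝ)) t]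
    _ = ∫⁻ x, ‖c x‖ₑ ^ (2 : ℝ) := by
        rw [lintegral_mul_const _ hφm,
          ← ofReal_integral_eq_lintegral_ofReal hφi (Eventually.of_forall hφ0), hφ1]
        simp

variable (E) in
/-- Bump functions at the origin with radii tending to zero. -/
theorem exists_bump_seq : ∃ φ : ℕ → ContDiffBump (0 : E),
    Tendsto (fun k => (φ k).rOut) atTop (𝓝 0) := by
  refine ⟨fun k => ⟨(1 / ((k : ℝ) + 1)) / 2, 1 / ((k : ℝ) + 1), by positivity, ?_⟩, ?_⟩
  · exact half_lt_self (by positivity)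
  · exact tendsto_one_div_add_atTop_nhds_zero_nat

theorem tendstoUniformly_mollify {φ : ℕ → ContDiffBump (0 : E)}
    (hφ : Tendsto (fun k => (φ k).rOut) atTop (𝓝 0)) {c : E → F} (hc : Continuous c)
    (hcs : HasCompactSupport c) :
    TendstoUniformly (fun k => ((φ k).normed volume ⋆[lsmul ℝ ℝ, volume] c)) c atTop := by
  rw [Metric.tendstoUniformly_iff]
  intro ε hε
  have huc := hcs.uniformContinuous_of_continuous hc
  obtain ⟨δ, hδ, h⟩ := Metric.uniformContinuous_iff.1 huc (ε / 2) (half_pos hε)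
  filter_upwards [hφ.eventually (gt_mem_nhds hδ)] with k hk x
  rw [dist_comm]
  refine (ContDiffBump.dist_normed_convolution_le hc.aestronglyMeasurable
    fun y hy => ?_).trans_lt (half_lt_self hε)
  exact (h ((Metric.mem_ball.1 hy).trans hk)).le

theorem support_mollify_subset (φ : ContDiffBump (0 : E)) {r : ℝ} (hr : φ.rOut ≤ r)
    {c : E → F} {K : Set E} (hK : Function.support c ⊆ K) :
    Function.support (φ.normed volume ⋆[lsmul ℝ ℝ, volume] c) ⊆ Metric.cthickening r K := by
  refine (support_convolution_subset_swap (L := lsmul ℝ ℝ)).trans ?_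
  rintro _ ⟨x, hx, y, hy, rfl⟩
  rw [φ.support_normed_eq, mem_ball_zero_iff] at hy
  refine Metric.mem_cthickening_of_dist_le _ x r K (hK hx) ?_
  simpa [dist_eq_norm] using hy.le.trans hr

/-- Mollifications converge in `L²`. -/
theorem tendsto_eLpNorm_mollify {φ : ℕ → ContDiffBump (0 : E)}
    (hφ : Tendsto (fun k => (φ k).rOut) atTop (𝓝 0)) {b : E → F} (hb : MemLp b 2 volume) :
    Tendsto (fun k => eLpNorm ((φ k).normed volume ⋆[lsmul ℝ ℝ, volume] b - b) 2 volume)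
      atTop (𝓝 0) := by
  rw [ENNReal.tendsto_nhds_zero]
  intro ε hε
  obtain ⟨ε', hε', hε'3⟩ : ∃ ε' : ℝ≥0∞, 0 < ε' ∧ ε' + ε' + ε' ≤ ε := by
    refine ⟨ε / 3, ENNReal.div_pos hε.ne' (by norm_num), le_of_eq (ENNReal.add_thirds ε)⟩
  obtain ⟨c, hcs, hbc, hcc, hcL⟩ := hb.exists_hasCompactSupport_eLpNorm_sub_le
    (by norm_num : (2 : ℝ≥0∞) ≠ ⊤) hε'.ne'
  have hconv : Tendsto (fun k => eLpNorm ((φ k).normed volume ⋆[lsmul ℝ ℝ, volume] c - c) 2 volume)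
      atTop (𝓝 0) := by
    rw [ENNReal.tendsto_nhds_zero]
    intro η hη
    set K := Metric.cthickening 1 (tsupport c)
    have hKc : IsCompact K := hcs.isCompact.cthickening
    have hKm : MeasurableSet K := hKc.isClosed.measurableSet
    obtain ⟨d, hd, hdη⟩ : ∃ d : ℝ, 0 < d ∧ volume K ^ (1 / (2 : ℝ)) * ENNReal.ofReal d ≤ η := by
      rcases eq_or_ne η ⊤ with rfl | hηt
      · exact ⟨1, one_pos, le_top⟩
      set m := (volume K ^ (1 / (2 : ℝ))).toReal
      have hm : volume K ^ (1 / (2 : ℝ)) = ENNReal.ofReal m :=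
        (ENNReal.ofReal_toReal (ENNReal.rpow_ne_top_of_nonneg (by norm_num)
          hKc.measure_lt_top.ne)).symm
      have hm0 : 0 ≤ m := ENNReal.toReal_nonneg
      have hη' : 0 < η.toReal := ENNReal.toReal_pos hη.ne' hηt
      refine ⟨η.toReal / (m + 1), by positivity, ?_⟩
      rw [hm, ← ENNReal.ofReal_mul hm0]
      refine ENNReal.ofReal_le_of_le_toReal ?_
      rw [mul_div_assoc', div_le_iff₀ (by positivity)]
      nlinarith
    have h1 := Metric.tendstoUniformly_iff.1 (tendstoUniformly_mollify hφ hcc hcs) d hd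
    filter_upwards [h1, hφ.eventually (gt_mem_nhds one_pos)] with k hk hk1
    refine le_trans ?_ hdη
    have hsupp : Function.support ((φ k).normed volume ⋆[lsmul ℝ ℝ, volume] c - c) ⊆ K := by
      refine (Function.support_sub _ _).trans (union_subset ?_ ?_)
      · exact support_mollify_subset (φ k) hk1.le subset_closure
      · exact subset_closure.trans (Metric.self_subset_cthickening _)
    rw [← eLpNorm_restrict_eq_of_support_subset hsupp]
    refine (eLpNorm_le_of_ae_bound (C := d) (Eventually.of_forall fun x => ?_)).trans ?_
    · have := (hk x).le
      rwa [dist_comm, dist_eq_norm] at this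
    · simp
  filter_upwards [ENNReal.tendsto_nhds_zero.1 hconv ε' hε'] with k hk
  have hφc : Continuous ((φ k).normed volume) := (φ k).continuous_normed
  have hφs : HasCompactSupport ((φ k).normed volume) := (φ k).hasCompactSupport_normed
  have hφi := hφc.integrable_of_hasCompactSupport hφs (μ := volume)
  have hbl : LocallyIntegrable b volume := hb.locallyIntegrable (by norm_num)
  have hcl : LocallyIntegrable c volume := hcc.locallyIntegrable
  have ex1 := hφs.convolutionExists_left (lsmul ℝ ℝ) hφc (hbl.sub hcl) (𝕜 := ℝ) (μ := volume)
  have ex2 := hφs.convolutionExists_left (lsmul ℝ ℝ) hφc hcl (𝕜 := ℝ) (μ := volume)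
  have hdecomp : ((φ k).normed volume ⋆[lsmul ℝ ℝ, volume] b - b) =
      ((φ k).normed volume ⋆[lsmul ℝ ℝ, volume] (b - c)) +
        ((φ k).normed volume ⋆[lsmul ℝ ℝ, volume] c - c) + (c - b) := by
    have := ConvolutionExists.distrib_add ex1 ex2
    rw [sub_add_cancel] at this
    rw [this]; abel
  have hbm := hb.1.sub hcL.1
  have hmb : AEStronglyMeasurable ((φ k).normed volume ⋆[lsmul ℝ ℝ, volume] (b - c)) volume :=
    (hφs.continuous_convolution_left _ hφc (hbl.sub hcl)).aestronglyMeasurable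
  have hmc : AEStronglyMeasurable ((φ k).normed volume ⋆[lsmul ℝ ℝ, volume] c) volume :=
    (hφs.continuous_convolution_left _ hφc hcl).aestronglyMeasurable
  rw [hdecomp]
  refine le_trans ?_ hε'3
  refine (eLpNorm_add_le (hmb.add (hmc.sub hcL.1)) (hcL.1.sub hb.1) (by norm_num)).trans ?_
  refine add_le_add ((eLpNorm_add_le hmb (hmc.sub hcL.1) (by norm_num)).trans
    (add_le_add ?_ hk)) ?_
  · exact (eLpNorm_two_convolution_le hφc (φ k).nonneg_normed hφi (φ k).integral_normed hbm).trans
      hbc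
  · rw [eLpNorm_sub_comm]; exact hbc

/-- The derivative of a mollification is the mollification of the weak derivative. -/
theorem hasFDerivAt_mollify (φ : ContDiffBump (0 : E)) {f : E → ℝ} {a : E → E →L[ℝ] ℝ}
    (hf : Continuous f) (ha : LocallyIntegrable a volume)
    (hfa : ∀ (v : E) (ψ : E → ℝ), ContDiff ℝ ∞ ψ → HasCompactSupport ψ →
      ∫ y, f y * fderiv ℝ ψ y v = -∫ y, a y v * ψ y) (x : E) :
    HasFDerivAt (φ.normed volume ⋆[lsmul ℝ ℝ, volume] f)
      ((φ.normed volume ⋆[lsmul ℝ ℝ, volume] a) x) x := by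
  have hφ1 : ContDiff ℝ ∞ (φ.normed volume) := φ.contDiff_normed
  have hφs : HasCompactSupport (φ.normed volume) := φ.hasCompactSupport_normed
  have h := hφs.hasFDerivAt_convolution_left (lsmul ℝ ℝ) (hφ1.of_le (by simp))
    hf.locallyIntegrable x (μ := volume)
  suffices heq : (φ.normed volume ⋆[lsmul ℝ ℝ, volume] a) x =
      (fderiv ℝ (φ.normed volume) ⋆[(lsmul ℝ ℝ).precompL E, volume] f) x by rw [heq]; exact h
  ext v
  rw [convolution_eq_swap, convolution_eq_swap]
  have hi1 : Integrable (fun t => (lsmul ℝ ℝ) (φ.normed volume (x - t)) (a t)) := by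
    have := (hφs.convolutionExists_left (lsmul ℝ ℝ) hφ1.continuous ha x).integrable_swap (𝕜 := ℝ)
    simpa using this
  have hi2 : Integrable (fun t => ((lsmul ℝ ℝ : ℝ →L[ℝ] ℝ →L[ℝ] ℝ).precompL E)
      (fderiv ℝ (φ.normed volume) (x - t)) (f t)) := by
    have hc : Continuous (fderiv ℝ (φ.normed volume)) := hφ1.continuous_fderiv (by simp)
    exact ((hφs.fderiv ℝ).convolutionExists_left _ hc hf.locallyIntegrable x).integrable_swap
      (𝕜 := ℝ)
  rw [ContinuousLinearMap.integral_apply hi1, ContinuousLinearMap.integral_apply hi2]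
  have hψ : ContDiff ℝ ∞ (fun t => φ.normed volume (x - t)) :=
    hφ1.comp (contDiff_const.sub contDiff_id)
  have hψs : HasCompactSupport (fun t => φ.normed volume (x - t)) :=
    hφs.comp_homeomorph (Homeomorph.subLeft x)
  have := hfa v _ hψ hψs
  have hder : ∀ t, fderiv ℝ (fun t => φ.normed volume (x - t)) t v =
      - fderiv ℝ (φ.normed volume) (x - t) v := by
    intro t
    have h1 : HasFDerivAt (fun t => φ.normed volume (x - t))
        ((fderiv ℝ (φ.normed volume) (x - t)).comp (-(ContinuousLinearMap.id ℝ E))) t := by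
      refine HasFDerivAt.comp t ((hφ1.differentiable (by simp)) _).hasFDerivAt ?_
      simpa using (hasFDerivAt_id t).const_sub x
    rw [h1.fderiv]; simp
  simp only [hder, mul_neg, integral_neg, neg_inj] at this
  simp only [lsmul_apply, _root_.smul_apply, smul_eq_mul,
    ContinuousLinearMap.precompL_apply]
  calc ∫ t, φ.normed volume (x - t) * a t v = ∫ t, a t v * φ.normed volume (x - t) := by
        congr 1; ext t; ring
    _ = ∫ t, f t * fderiv ℝ (φ.normed volume) (x - t) v := this.symm
    _ = _ := by congr 1; ext t; ring

end Mollification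

section Cutoff

variable {E : Type*} [NormedAddCommGroup E] [NormedSpace ℝ E] [FiniteDimensional ℝ E]
  {H : Type*} [TopologicalSpace H] (I : ModelWithCorners ℝ E H)
  {M : Type*} [TopologicalSpace M] [ChartedSpace H M] [IsManifold I ∞ M]
  [T2Space M] [SigmaCompactSpace M]

theorem exists_cutoff {K U : Set M} (hK : IsCompact K) (hU : IsOpen U) (hKU : K ⊆ U) :
    ∃ χ : M → ℝ, ContMDiff I 𝓘(ℝ, ℝ) ∞ χ ∧ HasCompactSupport χ ∧ tsupport χ ⊆ U ∧
      (∀ᶠ p in 𝓝ˢ K, χ p = 1) ∧ ∀ p, χ p ∈ Icc (0 : ℝ) 1 := by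
  have : LocallyCompactSpace M := Manifold.locallyCompact_of_finiteDimensional I
  obtain ⟨L, hL, hKL, hLU⟩ := exists_compact_between hK hU hKU
  obtain ⟨f, h1, h0, h01⟩ := exists_contMDiffMap_one_nhds_of_subset_interior I (n := ⊤)
    hK.isClosed hKL
  have hsupp : tsupport f ⊆ L := by
    refine closure_minimal (fun p hp => ?_) hL.isClosed
    by_contra hpL
    exact hp (h0 p hpL)
  exact ⟨f, f.contMDiff, HasCompactSupport.intro hL h0, hsupp.trans hLU, h1, h01⟩

/-- A finite smooth partition of unity near a compact set, subordinate to given neighborhoods. -/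
theorem exists_finite_partition {K : Set M} (hK : IsCompact K) {N : M → Set M}
    (hN : ∀ p ∈ K, N p ∈ 𝓝 p) :
    ∃ (s : Finset M) (χ : s → M → ℝ), (∀ i : s, (i : M) ∈ K) ∧
      (∀ i, ContMDiff I 𝓘(ℝ, ℝ) ∞ (χ i)) ∧ (∀ i p, 0 ≤ χ i p) ∧
      (∀ i : s, tsupport (χ i) ⊆ N i) ∧ ∀ p ∈ K, ∑ i, χ i p = 1 := by
  obtain ⟨s, hsK, hs⟩ := hK.elim_nhds_subcover (fun p => interior (N p))
    (fun p hp => interior_mem_nhds.2 (hN p hp))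
  obtain ⟨f, hf⟩ := SmoothPartitionOfUnity.exists_isSubordinate I hK.isClosed
    (fun i : s => interior (N i)) (fun i => isOpen_interior)
    (fun p hp => by
      obtain ⟨i, hi, hpi⟩ := mem_iUnion₂.1 (hs hp)
      exact mem_iUnion.2 ⟨⟨i, hi⟩, hpi⟩)
  refine ⟨s, fun i => f i, fun i => hsK i i.2, fun i => (f i).contMDiff, f.nonneg,
    fun i => (hf i).trans interior_subset, fun p hp => ?_⟩
  rw [← finsum_eq_sum_of_fintype]
  exact f.sum_eq_one hp

end Cutoff

section WeakDerivative

variable {E : Type*} [NormedAddCommGroup E] [NormedSpace ℝ E] [FiniteDimensional ℝ E]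
  [MeasureSpace E] [BorelSpace E] [(volume : Measure E).IsAddHaarMeasure]

theorem exists_contDiff_cutoff {K U : Set E} (hK : IsCompact K) (hU : IsOpen U) (hKU : K ⊆ U) :
    ∃ χ : E → ℝ, ContDiff ℝ ∞ χ ∧ HasCompactSupport χ ∧ tsupport χ ⊆ U ∧
      (∀ᶠ p in 𝓝ˢ K, χ p = 1) ∧ ∀ p, χ p ∈ Icc (0 : ℝ) 1 := by
  simpa only [contMDiff_iff_contDiff] using exists_cutoff 𝓘(ℝ, E) hK hU hKU

/-- The continuous function `f` has the weak derivative `a ∈ L²_loc` on the open set `T`. -/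
structure IsWeakDiffOn (T : Set E) (f : E → ℝ) (a : E → E →L[ℝ] ℝ) : Prop where
  continuousOn : ContinuousOn f T
  memLp : ∀ K, IsCompact K → K ⊆ T → MemLp a 2 (volume.restrict K)
  integral_eq : ∀ (v : E) (ψ : E → ℝ), ContDiff ℝ ∞ ψ → HasCompactSupport ψ → tsupport ψ ⊆ T →
    ∫ y, f y * fderiv ℝ ψ y v = -∫ y, a y v * ψ y

theorem memLp_sum_smul {α ι F : Type*} [Fintype ι] [NormedAddCommGroup F] [NormedSpace ℝ F]
    [MeasurableSpace α] {μ : Measure α} {p : ℝ≥0∞} {c : ι → α → ℝ} (w : ι → F)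
    (h : ∀ i, MemLp (c i) p μ) : MemLp (fun y => ∑ i, c i y • w i) p μ := by
  refine memLp_finsetSum Finset.univ (f := fun i y => c i y • w i) fun i _ => ?_
  refine MemLp.of_le_mul (c := ‖w i‖) (h i) ((h i).1.smul_const _)
    (Eventually.of_forall fun y => ?_)
  rw [norm_smul, mul_comm]

theorem memLp_of_forall_apply {α : Type*} [MeasurableSpace α] {μ : Measure α} {p : ℝ≥0∞}
    {a : α → E →L[ℝ] ℝ} (h : ∀ v, MemLp (fun y => a y v) p μ) : MemLp a p μ := by
  let b := Module.finBasis ℝ E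
  have hsum : a = fun y => ∑ i, a y (b i) • (LinearMap.toContinuousLinearMap (b.coord i)) := by
    funext y
    ext v
    have hv : a y v = a y (∑ i, b.repr v i • b i) := by rw [b.sum_repr v]
    rw [hv, map_sum, sum_apply]
    exact Finset.sum_congr rfl fun i _ => by simp [mul_comm]
  rw [hsum]
  exact memLp_sum_smul _ fun i => h (b i)

theorem memLp_two_integrable_apply {α : Type*} [MeasurableSpace α] {μ : Measure α}
    {b : α → E →L[ℝ] ℝ} {ζ : α → E} (hb : MemLp b 2 μ) (hζ : MemLp ζ 2 μ) :
    Integrable (fun y => b y (ζ y)) μ := by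
  have := MemLp.of_bilin (r := 1) (fun (L : E →L[ℝ] ℝ) (v : E) => L v) 1 hb hζ
      ((isBoundedBilinearMap_apply (𝕜 := ℝ) (E := E) (F := ℝ)).continuous.comp_aestronglyMeasurable
        (hb.1.prodMk hζ.1))
      (Eventually.of_forall fun y => by simpa using (b y).le_opNNNorm (ζ y))
  exact memLp_one_iff_integrable.1 this

theorem tendsto_integral_apply {α : Type*} [MeasurableSpace α] {μ : Measure α}
    {G : ℕ → α → E →L[ℝ] ℝ} {b : α → E →L[ℝ] ℝ} {ζ : α → E} (hG : ∀ k, MemLp (G k) 2 μ)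
    (hb : MemLp b 2 μ) (hζ : MemLp ζ 2 μ)
    (h : Tendsto (fun k => eLpNorm (fun y => G k y - b y) 2 μ) atTop (𝓝 0)) :
    Tendsto (fun k => ∫ y, G k y (ζ y) ∂μ) atTop (𝓝 (∫ y, b y (ζ y) ∂μ)) := by
  refine tendsto_integral_of_L1' _ (memLp_two_integrable_apply hb hζ).aestronglyMeasurable
    (Eventually.of_forall fun k => memLp_two_integrable_apply (hG k) hζ) ?_
  have hlim : Tendsto (fun k => eLpNorm (fun y => G k y - b y) 2 μ * eLpNorm ζ 2 μ) atTop
      (𝓝 0) := by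
    simpa using ENNReal.Tendsto.mul_const h (Or.inr hζ.2.ne)
  refine tendsto_of_tendsto_of_tendsto_of_le_of_le tendsto_const_nhds hlim (fun k => zero_le)
    fun k => ?_
  have := eLpNorm_le_eLpNorm_mul_eLpNorm_of_nnnorm (p := 2) (q := 2) (r := 1)
    ((hG k).1.sub hb.1) hζ.1 (fun (L : E →L[ℝ] ℝ) (v : E) => L v) 1
    (Eventually.of_forall fun y => by simpa using ((G k - b) y).le_opNNNorm (ζ y))
  rw [ENNReal.coe_one, one_mul] at this
  exact this

theorem memLp_of_restrict {α F : Type*} [MeasurableSpace α] {μ : Measure α} [NormedAddCommGroup F]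
    {b : α → F} {K : Set α} (hK : MeasurableSet K) {p : ℝ≥0∞} (hb : MemLp b p (μ.restrict K))
    (hb0 : ∀ y ∉ K, b y = 0) : MemLp b p μ := by
  have hsub : Function.support b ⊆ K := by
    intro y hy
    by_contra hyt
    exact hy (hb0 y hyt)
  rw [← Set.indicator_eq_self.2 hsub, memLp_indicator_iff_restrict hK]
  exact hb

theorem memLp_restrict_of_continuousOn {F : Type*} [NormedAddCommGroup F] {h : E → F} {K : Set E}
    (hK : IsCompact K) (hh : ContinuousOn h K) (p : ℝ≥0∞) : MemLp h p (volume.restrict K) := by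
  obtain ⟨C, hC⟩ := hK.exists_bound_of_continuousOn hh
  have : IsFiniteMeasure (volume.restrict K) := ⟨by simpa using hK.measure_lt_top⟩
  exact MemLp.of_bound (hh.aestronglyMeasurable_of_isCompact hK hK.measurableSet) C
    (ae_restrict_of_forall_mem hK.measurableSet hC)

variable {T : Set E} {f : E → ℝ} {a : E → E →L[ℝ] ℝ}

theorem IsWeakDiffOn.mono (h : IsWeakDiffOn T f a) {S : Set E} (hS : S ⊆ T) :
    IsWeakDiffOn S f a :=
  ⟨h.continuousOn.mono hS, fun K hK hKS => h.memLp K hK (hKS.trans hS),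
    fun v ψ h1 h2 h3 => h.integral_eq v ψ h1 h2 (h3.trans hS)⟩

theorem IsWeakDiffOn.congr (h : IsWeakDiffOn T f a) {f' : E → ℝ} {a' : E → E →L[ℝ] ℝ}
    (hf : EqOn f f' T) (ha : ∀ᵐ y, y ∈ T → a y = a' y) : IsWeakDiffOn T f' a' := by
  refine ⟨h.continuousOn.congr hf.symm, fun K hK hKT => ?_, fun v ψ h1 h2 h3 => ?_⟩
  · refine (h.memLp K hK hKT).ae_eq ?_
    rw [EventuallyEq, ae_restrict_iff' hK.measurableSet]
    filter_upwards [ha] with y hy hyK using hy (hKT hyK)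
  · have e1 : ∫ y, f' y * fderiv ℝ ψ y v = ∫ y, f y * fderiv ℝ ψ y v := by
      congr 1; ext y
      by_cases hy : y ∈ tsupport ψ
      · rw [hf (h3 hy)]
      · have : fderiv ℝ ψ y = 0 := by
          by_contra hne
          exact hy (support_fderiv_subset ℝ hne)
        simp [this]
    have e2 : ∫ y, a' y v * ψ y = ∫ y, a y v * ψ y := by
      refine integral_congr_ae ?_
      filter_upwards [ha] with y hy
      by_cases hyt : y ∈ tsupport ψ
      · rw [hy (h3 hyt)]
      · simp [image_eq_zero_of_notMem_tsupport hyt]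
    rw [e1, e2, h.integral_eq v ψ h1 h2 h3]

/-- Multiplying by a cutoff function gives a function which is weakly differentiable on the whole
space. -/
theorem IsWeakDiffOn.cutoff (h : IsWeakDiffOn T f a) (hT : IsOpen T) {χ : E → ℝ}
    (hχ : ContDiff ℝ ∞ χ) (hχs : HasCompactSupport χ) (hχT : tsupport χ ⊆ T) :
    IsWeakDiffOn univ (fun y => χ y * f y) (fun y => χ y • a y + f y • fderiv ℝ χ y) ∧
      MemLp (fun y => χ y • a y + f y • fderiv ℝ χ y) 2 volume := by
  have hdχ : Continuous (fderiv ℝ χ) := hχ.continuous_fderiv (by simp)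
  have hdχ0 : ∀ y ∉ tsupport χ, fderiv ℝ χ y = 0 := fun y hy => by
    by_contra hne
    exact hy (support_fderiv_subset ℝ hne)
  have hχ0 : ∀ y ∉ tsupport χ, χ y = 0 := fun y hy => image_eq_zero_of_notMem_tsupport hy
  have hfK := memLp_restrict_of_continuousOn hχs.isCompact (h.continuousOn.mono hχT)
  have hcont : Continuous fun y => χ y * f y := by
    refine continuous_iff_continuousAt.2 fun y => ?_
    by_cases hy : y ∈ tsupport χ
    · exact hχ.continuous.continuousAt.mul (h.continuousOn.continuousAt (hT.mem_nhds (hχT hy)))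
    · have : (fun y => χ y * f y) =ᶠ[𝓝 y] fun _ => 0 := by
        filter_upwards [(isClosed_tsupport χ).isOpen_compl.mem_nhds hy] with z hz
        simp [hχ0 z hz]
      exact continuousAt_const.congr this.symm
  have hmem : MemLp (fun y => χ y • a y + f y • fderiv ℝ χ y) 2 volume := by
    refine memLp_of_restrict hχs.isCompact.measurableSet (MemLp.add ?_ ?_)
      fun y hy => by simp [hdχ0 y hy, hχ0 y hy]
    · exact MemLp.smul (p := ⊤) (h.memLp _ hχs.isCompact hχT)
        (memLp_restrict_of_continuousOn hχs.isCompact hχ.continuous.continuousOn ⊤)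
    · exact MemLp.smul (p := ⊤) (memLp_restrict_of_continuousOn hχs.isCompact hdχ.continuousOn 2)
        (hfK ⊤)
  refine ⟨⟨hcont.continuousOn, fun K _ _ => hmem.restrict K, fun v ψ hψ hψs _ => ?_⟩, hmem⟩
  have hdψ : Continuous (fderiv ℝ ψ) := hψ.continuous_fderiv (by simp)
  have key := h.integral_eq v (fun y => χ y * ψ y) (hχ.mul hψ) hχs.mul_right
    ((closure_mono (Function.support_mul_subset_left χ ψ)).trans hχT)
  have hder : ∀ y, fderiv ℝ (fun y => χ y * ψ y) y v = χ y * fderiv ℝ ψ y v + ψ y * fderiv ℝ χ y v := by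
    intro y
    rw [fderiv_fun_mul (hχ.differentiable (by simp) y) (hψ.differentiable (by simp) y)]
    simp
  have hi0 : ∀ {b : E → ℝ}, Integrable b (volume.restrict (tsupport χ)) →
      (∀ y ∉ tsupport χ, b y = 0) → Integrable b := fun hb hb0 =>
    memLp_one_iff_integrable.1 (memLp_of_restrict hχs.isCompact.measurableSet
      (memLp_one_iff_integrable.2 hb) hb0)
  have i1 : Integrable fun y => χ y * f y * fderiv ℝ ψ y v :=
    (hcont.mul (hdψ.clm_apply continuous_const)).integrable_of_hasCompactSupport
      (hχs.mul_right.mul_right)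
  have i2 : Integrable fun y => f y * (ψ y * fderiv ℝ χ y v) := by
    refine hi0 ?_ fun y hy => by simp [hdχ0 y hy]
    refine memLp_one_iff_integrable.1 (memLp_restrict_of_continuousOn hχs.isCompact ?_ 1)
    exact (h.continuousOn.mono hχT).mul
      (hψ.continuous.mul (hdχ.clm_apply continuous_const)).continuousOn
  have i3 : Integrable fun y => a y v * (χ y * ψ y) := by
    refine hi0 ?_ fun y hy => by simp [hχ0 y hy]
    have := memLp_two_integrable_apply (h.memLp _ hχs.isCompact hχT)
      (memLp_restrict_of_continuousOn (h := fun y => (χ y * ψ y) • v) hχs.isCompact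
        ((hχ.continuous.mul hψ.continuous).smul continuous_const).continuousOn 2)
    refine this.congr (Eventually.of_forall fun y => ?_)
    simp [mul_comm]
  have e1 : ∫ y, f y * fderiv ℝ (fun y => χ y * ψ y) y v =
      (∫ y, χ y * f y * fderiv ℝ ψ y v) + ∫ y, f y * (ψ y * fderiv ℝ χ y v) := by
    rw [← integral_add i1 i2]
    congr 1; ext y; rw [hder]; ring
  have e2 : ∫ y, (χ y • a y + f y • fderiv ℝ χ y) v * ψ y =
      (∫ y, a y v * (χ y * ψ y)) + ∫ y, f y * (ψ y * fderiv ℝ χ y v) := by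
    rw [← integral_add i3 i2]
    congr 1; ext y; simp; ring
  rw [e2]
  linarith

/-- Smooth approximation of a compactly supported weakly differentiable function. -/
theorem IsWeakDiffOn.exists_approx_of_support (h : IsWeakDiffOn univ f a)
    (ha : MemLp a 2 volume) {K : Set E} (hK : IsCompact K) (hf0 : ∀ y ∉ K, f y = 0) :
    ∃ F : ℕ → E → ℝ, (∀ k, ContDiff ℝ ∞ (F k)) ∧ ((∀ y, 0 ≤ f y) → ∀ k y, 0 ≤ F k y) ∧
      TendstoUniformly F f atTop ∧
      Tendsto (fun k => eLpNorm (fun y => fderiv ℝ (F k) y - a y) 2 volume) atTop (𝓝 0) ∧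
      ∀ ε > 0, ∀ᶠ k in atTop, Function.support (F k) ⊆ Metric.cthickening ε K := by
  obtain ⟨φ, hφ⟩ := exists_bump_seq E
  have hfc : Continuous f := continuousOn_univ.1 h.continuousOn
  have hfs : HasCompactSupport f := HasCompactSupport.intro hK hf0
  have hal : LocallyIntegrable a volume := ha.locallyIntegrable (by norm_num)
  refine ⟨fun k => convolution ((φ k).normed volume) f (ContinuousLinearMap.lsmul ℝ ℝ) volume,
    fun k => ?_, fun h0 k y => ?_, ?_, ?_, fun ε hε => ?_⟩
  · exact (φ k).hasCompactSupport_normed.contDiff_convolution_left _ (φ k).contDiff_normed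
      hfc.locallyIntegrable
  · simp only [convolution_def]
    exact integral_nonneg fun t => mul_nonneg ((φ k).nonneg_normed t) (h0 _)
  · exact tendstoUniformly_mollify hφ hfc hfs
  · have := tendsto_eLpNorm_mollify hφ ha
    refine this.congr fun k => ?_
    congr 1; ext1 y
    rw [(hasFDerivAt_mollify (φ k) hfc hal
      (fun v ψ h1 h2 => h.integral_eq v ψ h1 h2 (subset_univ _)) y).fderiv]
    rfl
  · filter_upwards [hφ.eventually (gt_mem_nhds hε)] with k hk
    refine support_mollify_subset (φ k) hk.le fun y hy => ?_
    by_contra hyK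
    exact hy (hf0 y hyK)

/-- Smooth approximation of a weakly differentiable function on a compact set. -/
theorem IsWeakDiffOn.exists_approx (h : IsWeakDiffOn T f a) (hT : IsOpen T) {K : Set E}
    (hK : IsCompact K) (hKT : K ⊆ T) :
    ∃ F : ℕ → E → ℝ, (∀ k, ContDiff ℝ ∞ (F k)) ∧ TendstoUniformlyOn F f atTop K ∧
      Tendsto (fun k => eLpNorm (fun y => fderiv ℝ (F k) y - a y) 2 (volume.restrict K))
        atTop (𝓝 0) := by
  obtain ⟨χ, hχ, hχs, hχT, hχ1, -⟩ := exists_contDiff_cutoff hK hT hKT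
  obtain ⟨hw, hm⟩ := h.cutoff hT hχ hχs hχT
  obtain ⟨F, hF, -, hu, hL, -⟩ := hw.exists_approx_of_support hm hχs.isCompact
    (fun y hy => by simp [image_eq_zero_of_notMem_tsupport hy])
  have h1 : ∀ y ∈ K, χ =ᶠ[𝓝 y] fun _ => 1 := fun y hy => eventually_nhdsSet_iff_forall.1 hχ1 y hy
  refine ⟨F, hF, (hu.tendstoUniformlyOn (s := K)).congr_right fun y hy => ?_, ?_⟩
  · simp [(h1 y hy).eq_of_nhds]
  · refine tendsto_of_tendsto_of_tendsto_of_le_of_le tendsto_const_nhds hL (fun k => zero_le)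
      fun k => ?_
    refine le_trans (le_of_eq ?_) (eLpNorm_mono_measure _ (Measure.restrict_le_self (s := K)))
    refine eLpNorm_congr_ae (ae_restrict_of_forall_mem hK.measurableSet fun y hy => ?_)
    simp [(h1 y hy).eq_of_nhds, (h1 y hy).fderiv_eq]

end WeakDerivative

section WeakCalculus

variable {E : Type*} [NormedAddCommGroup E] [NormedSpace ℝ E] [FiniteDimensional ℝ E]
  [MeasureSpace E] [BorelSpace E] [(volume : Measure E).IsAddHaarMeasure]
  {T : Set E} {f h : E → ℝ} {a b : E → E →L[ℝ] ℝ}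

theorem fderiv_eq_zero_of_notMem_tsupport {ψ : E → ℝ} {y : E} (hy : y ∉ tsupport ψ) :
    fderiv ℝ ψ y = 0 := by
  by_contra hne
  exact hy (support_fderiv_subset ℝ hne)

theorem integral_eq_setIntegral_of_forall_notMem {α : Type*} [MeasurableSpace α] {μ : Measure α}
    {K : Set α} {b : α → ℝ} (hb : ∀ y ∉ K, b y = 0) : ∫ y, b y ∂μ = ∫ y in K, b y ∂μ :=
  (setIntegral_eq_integral_of_forall_compl_eq_zero hb).symm

/-- A locally uniform limit of differentiable functions whose derivatives converge in `L²_loc` is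
weakly differentiable. -/
theorem IsWeakDiffOn.of_approx (hf : ContinuousOn f T)
    (happ : ∀ K, IsCompact K → K ⊆ T → AEStronglyMeasurable a (volume.restrict K) ∧
      ∃ F : ℕ → E → ℝ, (∀ k, ∃ O, IsOpen O ∧ K ⊆ O ∧ ContDiffOn ℝ 1 (F k) O) ∧
        TendstoUniformlyOn F f atTop K ∧
        Tendsto (fun k => eLpNorm (fun y => fderiv ℝ (F k) y - a y) 2 (volume.restrict K))
          atTop (𝓝 0)) :
    IsWeakDiffOn T f a := by
  have hFd : ∀ (K O : Set E) (G : E → ℝ), IsCompact K → IsOpen O → K ⊆ O → ContDiffOn ℝ 1 G O →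
      MemLp (fderiv ℝ G) 2 (volume.restrict K) := fun K O G hK hO hKO hG =>
    memLp_restrict_of_continuousOn hK
      ((hG.continuousOn_fderiv_of_isOpen hO le_rfl).mono hKO) 2
  have hmem : ∀ K, IsCompact K → K ⊆ T → MemLp a 2 (volume.restrict K) := by
    intro K hK hKT
    obtain ⟨ham, F, hF, -, hL⟩ := happ K hK hKT
    obtain ⟨k, hk⟩ := (hL.eventually (gt_mem_nhds (ENNReal.zero_lt_top))).exists
    obtain ⟨O, hO, hKO, hFO⟩ := hF k
    have h1 := hFd K O (F k) hK hO hKO hFO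
    have h2 : MemLp (fun y => fderiv ℝ (F k) y - a y) 2 (volume.restrict K) := ⟨h1.1.sub ham, hk⟩
    refine (h1.sub h2).ae_eq (Eventually.of_forall fun y => ?_)
    simp
  refine ⟨hf, hmem, fun v ψ hψ hψs hψT => ?_⟩
  set K := tsupport ψ with hKdef
  have hK : IsCompact K := hψs
  obtain ⟨ham, F, hF, hu, hL⟩ := happ K hK hψT
  have hdψ : Continuous (fderiv ℝ ψ) := hψ.continuous_fderiv (by simp)
  have hFk : ∀ k, MemLp (fderiv ℝ (F k)) 2 (volume.restrict K) := fun k => by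
    obtain ⟨O, hO, hKO, hFO⟩ := hF k
    exact hFd K O (F k) hK hO hKO hFO
  have hid : ∀ k, ∫ y in K, F k y * fderiv ℝ ψ y v = -∫ y in K, fderiv ℝ (F k) y (ψ y • v) := by
    intro k
    obtain ⟨O, hO, hKO, hFO⟩ := hF k
    have hFc : ContinuousOn (F k) K := hFO.continuousOn.mono hKO
    have hdFc : ContinuousOn (fderiv ℝ (F k)) K :=
      (hFO.continuousOn_fderiv_of_isOpen hO le_rfl).mono hKO
    have hint : ∀ {b : E → ℝ}, ContinuousOn b K → (∀ y ∉ K, b y = 0) → Integrable b :=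
      fun hb hb0 => memLp_one_iff_integrable.1 (memLp_of_restrict hK.measurableSet
        (memLp_restrict_of_continuousOn hK hb 1) hb0)
    have e1 := integral_mul_fderiv_eq_neg_fderiv_mul_of_integrable (μ := volume) (f := F k)
      (g := ψ) (v := v)
      (hint ((hdFc.clm_apply continuousOn_const).mul hψ.continuous.continuousOn)
        fun y hy => by simp [image_eq_zero_of_notMem_tsupport hy])
      (hint (hFc.mul (hdψ.clm_apply continuous_const).continuousOn)
        fun y hy => by simp [fderiv_eq_zero_of_notMem_tsupport hy])
      (hint (hFc.mul hψ.continuous.continuousOn)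
        fun y hy => by simp [image_eq_zero_of_notMem_tsupport hy])
      (fun y hy => (hFO.contDiffAt (hO.mem_nhds (hKO hy))).differentiableAt (by simp))
      (fun y _ => hψ.differentiable (by simp) y)
    rw [integral_eq_setIntegral_of_forall_notMem (K := K)
      (fun y hy => by simp [fderiv_eq_zero_of_notMem_tsupport hy])] at e1
    rw [e1, integral_eq_setIntegral_of_forall_notMem (K := K)
      (fun y hy => by simp [image_eq_zero_of_notMem_tsupport hy])]
    congr 2; ext y; simp [mul_comm]
  have lim1 : Tendsto (fun k => ∫ y in K, F k y * fderiv ℝ ψ y v) atTop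
      (𝓝 (∫ y in K, f y * fderiv ℝ ψ y v)) := by
    obtain ⟨C, hC⟩ := hK.exists_bound_of_continuousOn (hf.mono hψT)
    refine tendsto_integral_filter_of_dominated_convergence
      (fun y => (C + 1) * ‖fderiv ℝ ψ y v‖) (Eventually.of_forall fun k => ?_) ?_ ?_ ?_
    · obtain ⟨O, hO, hKO, hFO⟩ := hF k
      exact (((hFO.continuousOn.mono hKO).mul
        (hdψ.clm_apply continuous_const).continuousOn).aestronglyMeasurable_of_isCompact hK
        hK.measurableSet)
    · filter_upwards [Metric.tendstoUniformlyOn_iff.1 hu 1 one_pos] with k hk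
      refine ae_restrict_of_forall_mem hK.measurableSet fun y hy => ?_
      rw [norm_mul]
      gcongr
      have h1 := hk y hy
      rw [dist_comm, dist_eq_norm] at h1
      have h2 := norm_add_le (f y) (F k y - f y)
      rw [add_sub_cancel] at h2
      linarith [hC y hy]
    · exact memLp_one_iff_integrable.1 (memLp_restrict_of_continuousOn hK
        (continuous_const.mul (hdψ.clm_apply continuous_const).norm).continuousOn 1)
    · refine ae_restrict_of_forall_mem hK.measurableSet fun y hy => ?_
      exact (hu.tendsto_at hy).mul_const _
  have lim2 := tendsto_integral_apply hFk (hmem K hK hψT)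
    (memLp_restrict_of_continuousOn (h := fun y => ψ y • v) hK
      (hψ.continuous.smul continuous_const).continuousOn 2) hL
  have lim3 := tendsto_nhds_unique (lim1.congr hid) lim2.neg
  have e1 : ∫ y, f y * fderiv ℝ ψ y v = ∫ y in K, f y * fderiv ℝ ψ y v :=
    integral_eq_setIntegral_of_forall_notMem
      fun y hy => by simp [fderiv_eq_zero_of_notMem_tsupport hy]
  have e2 : ∫ y, a y v * ψ y = ∫ y in K, a y v * ψ y :=
    integral_eq_setIntegral_of_forall_notMem
      fun y hy => by simp [image_eq_zero_of_notMem_tsupport hy]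
  rw [e1, e2, lim3]
  congr 2; ext y; simp [mul_comm]

theorem eLpNorm_sub_self_eq_zero {α F : Type*} [MeasurableSpace α] {μ : Measure α}
    [NormedAddCommGroup F] {p : ℝ≥0∞} (b : α → F) : eLpNorm (fun y => b y - b y) p μ = 0 := by
  simp

theorem IsWeakDiffOn.of_contDiffOn (hT : IsOpen T) (hf : ContDiffOn ℝ 1 f T) :
    IsWeakDiffOn T f (fderiv ℝ f) := by
  refine IsWeakDiffOn.of_approx hf.continuousOn fun K hK hKT => ⟨?_, fun _ => f, ?_, ?_, ?_⟩
  · exact ((hf.continuousOn_fderiv_of_isOpen hT le_rfl).mono hKT).aestronglyMeasurable_of_isCompact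
      hK hK.measurableSet
  · exact fun _ => ⟨T, hT, hKT, hf⟩
  · exact fun u hu => Eventually.of_forall fun _ _ _ => refl_mem_uniformity hu
  · exact (tendsto_const_nhds (x := (0 : ℝ≥0∞))).congr fun _ => (eLpNorm_sub_self_eq_zero _).symm

theorem tendsto_eLpNorm_add {α F : Type*} [MeasurableSpace α] {μ : Measure α}
    [NormedAddCommGroup F] {A B : ℕ → α → F} (hA : ∀ k, AEStronglyMeasurable (A k) μ)
    (hB : ∀ k, AEStronglyMeasurable (B k) μ)
    (hA0 : Tendsto (fun k => eLpNorm (A k) 2 μ) atTop (𝓝 0))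
    (hB0 : Tendsto (fun k => eLpNorm (B k) 2 μ) atTop (𝓝 0)) :
    Tendsto (fun k => eLpNorm (fun y => A k y + B k y) 2 μ) atTop (𝓝 0) := by
  have hsum := hA0.add hB0
  rw [add_zero] at hsum
  exact tendsto_of_tendsto_of_tendsto_of_le_of_le tendsto_const_nhds hsum
    (fun k => zero_le) fun k => eLpNorm_add_le (hA k) (hB k) (by norm_num)

theorem tendsto_eLpNorm_smul {α F : Type*} [MeasurableSpace α] {μ : Measure α}
    [NormedAddCommGroup F] [NormedSpace ℝ F] {K : Set α} (hK : MeasurableSet K)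
    {c : ℕ → α → ℝ} {d : α → ℝ} {G : ℕ → α → F} {b : α → F} {C : ℝ}
    (hcd : TendstoUniformlyOn c d atTop K) (hC : ∀ y ∈ K, ‖d y‖ ≤ C)
    (hc : ∀ k, AEStronglyMeasurable (c k) (μ.restrict K))
    (hd : AEStronglyMeasurable d (μ.restrict K))
    (hG : ∀ k, AEStronglyMeasurable (G k) (μ.restrict K)) (hb : MemLp b 2 (μ.restrict K))
    (h : Tendsto (fun k => eLpNorm (fun y => G k y - b y) 2 (μ.restrict K)) atTop (𝓝 0)) :
    Tendsto (fun k => eLpNorm (fun y => c k y • G k y - d y • b y) 2 (μ.restrict K))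
      atTop (𝓝 0) := by
  have hev : ∀ ε : ℝ, 0 < ε → ∀ᶠ k in atTop,
      eLpNorm (fun y => c k y • G k y - d y • b y) 2 (μ.restrict K) ≤
        ENNReal.ofReal (C + 1) * eLpNorm (fun y => G k y - b y) 2 (μ.restrict K) +
          ENNReal.ofReal ε * eLpNorm b 2 (μ.restrict K) := by
    intro ε hε
    filter_upwards [Metric.tendstoUniformlyOn_iff.1 hcd 1 one_pos,
      Metric.tendstoUniformlyOn_iff.1 hcd ε hε] with k hk1 hkε
    have hdec : (fun y => c k y • G k y - d y • b y) =
        (fun y => c k y • (G k y - b y)) + fun y => (c k y - d y) • b y := by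
      ext1 y; simp [smul_sub, sub_smul]
    rw [hdec]
    refine (eLpNorm_add_le ((hc k).smul ((hG k).sub hb.1)) (((hc k).sub hd).smul hb.1)
      (by norm_num)).trans (add_le_add ?_ ?_)
    · refine eLpNorm_le_mul_eLpNorm_of_ae_le_mul
        (ae_restrict_of_forall_mem hK fun y hy => ?_) 2
      change ‖c k y • (G k y - b y)‖ ≤ _
      rw [norm_smul]
      gcongr
      have h1 := hk1 y hy
      rw [dist_comm, dist_eq_norm] at h1
      have h2 := norm_add_le (d y) (c k y - d y)
      rw [add_sub_cancel] at h2
      linarith [hC y hy]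
    · refine eLpNorm_le_mul_eLpNorm_of_ae_le_mul
        (ae_restrict_of_forall_mem hK fun y hy => ?_) 2
      change ‖(c k y - d y) • b y‖ ≤ _
      rw [norm_smul]
      gcongr
      have h1 := hkε y hy
      rw [dist_comm, dist_eq_norm] at h1
      exact h1.le
  rw [ENNReal.tendsto_nhds_zero]
  intro η hη
  obtain ⟨ε, hε, hεη⟩ : ∃ ε : ℝ, 0 < ε ∧
      ENNReal.ofReal ε * eLpNorm b 2 (μ.restrict K) ≤ η / 2 := by
    have : Tendsto (fun ε : ℝ => ENNReal.ofReal ε * eLpNorm b 2 (μ.restrict K)) (𝓝[>] 0)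
        (𝓝 0) := by
      have h1 : Tendsto (fun ε : ℝ => ENNReal.ofReal ε) (𝓝[>] 0) (𝓝 0) := by
        have := (ENNReal.continuous_ofReal.tendsto 0).mono_left
          (nhdsWithin_le_nhds (s := Ioi (0 : ℝ)))
        simpa using this
      simpa using ENNReal.Tendsto.mul_const h1 (Or.inr hb.2.ne)
    obtain ⟨ε, h1, h2⟩ := ((this.eventually (gt_mem_nhds (ENNReal.half_pos hη.ne'))).and
      self_mem_nhdsWithin).exists
    exact ⟨ε, h2, h1.le⟩
  have h2 : Tendsto (fun k => ENNReal.ofReal (C + 1) *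
      eLpNorm (fun y => G k y - b y) 2 (μ.restrict K)) atTop (𝓝 0) := by
    simpa using ENNReal.Tendsto.const_mul h (Or.inr ENNReal.ofReal_ne_top)
  filter_upwards [hev ε hε, h2.eventually (gt_mem_nhds (ENNReal.half_pos hη.ne'))] with k h3 h4
  calc _ ≤ _ := h3
    _ ≤ η / 2 + η / 2 := add_le_add h4.le hεη
    _ = η := ENNReal.add_halves η

theorem tendstoUniformlyOn_comp_of_continuous {α X Y : Type*} [PseudoMetricSpace X] [ProperSpace X]
    [PseudoMetricSpace Y] {K : Set α} {F : ℕ → α → X} {f : α → X} {g : X → Y}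
    (hg : Continuous g) (hF : TendstoUniformlyOn F f atTop K) (hf : Bornology.IsBounded (f '' K)) :
    TendstoUniformlyOn (fun k y => g (F k y)) (fun y => g (f y)) atTop K := by
  have hS : IsCompact (Metric.cthickening 1 (f '' K)) :=
    Metric.isCompact_of_isClosed_isBounded Metric.isClosed_cthickening hf.cthickening
  refine (hS.uniformContinuousOn_of_continuous hg.continuousOn).comp_tendstoUniformlyOn_eventually
    ?_ ?_ hF
  · filter_upwards [Metric.tendstoUniformlyOn_iff.1 hF 1 one_pos] with k hk y hy
    exact Metric.mem_cthickening_of_dist_le _ (f y) 1 _ (mem_image_of_mem f hy)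
      (by rw [dist_comm]; exact (hk y hy).le)
  · exact fun y hy => Metric.self_subset_cthickening _ (mem_image_of_mem f hy)

/-- The chain rule for weak derivatives. -/
theorem IsWeakDiffOn.comp₂ (hT : IsOpen T) (hf : IsWeakDiffOn T f a) (hh : IsWeakDiffOn T h b)
    {Φ : ℝ × ℝ → ℝ} (hΦ : ContDiff ℝ ∞ Φ) :
    IsWeakDiffOn T (fun y => Φ (f y, h y))
      (fun y => fderiv ℝ Φ (f y, h y) (1, 0) • a y + fderiv ℝ Φ (f y, h y) (0, 1) • b y) := by
  have hΦ' : Continuous (fderiv ℝ Φ) := hΦ.continuous_fderiv (by simp)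
  have hfh : ContinuousOn (fun y => (f y, h y)) T := hf.continuousOn.prodMk hh.continuousOn
  refine IsWeakDiffOn.of_approx (hΦ.continuous.comp_continuousOn hfh) fun K hK hKT => ?_
  obtain ⟨F, hF, hFu, hFL⟩ := hf.exists_approx hT hK hKT
  obtain ⟨G, hG, hGu, hGL⟩ := hh.exists_approx hT hK hKT
  have ha := hf.memLp K hK hKT
  have hb := hh.memLp K hK hKT
  have hcK : ∀ w : ℝ × ℝ, ContinuousOn (fun y => fderiv ℝ Φ (f y, h y) w) K := fun w =>
    (hΦ'.clm_apply continuous_const).comp_continuousOn (hfh.mono hKT)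
  have hcm : ∀ w : ℝ × ℝ, AEStronglyMeasurable (fun y => fderiv ℝ Φ (f y, h y) w)
      (volume.restrict K) := fun w => (hcK w).aestronglyMeasurable_of_isCompact hK hK.measurableSet
  have hpair : TendstoUniformlyOn (fun k y => (F k y, G k y)) (fun y => (f y, h y)) atTop K := by
    rw [Metric.tendstoUniformlyOn_iff] at hFu hGu ⊢
    intro ε hε
    filter_upwards [hFu ε hε, hGu ε hε] with k h1 h2 y hy
    exact max_lt (h1 y hy) (h2 y hy)
  have hbdd : Bornology.IsBounded ((fun y => (f y, h y)) '' K) :=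
    (hK.image_of_continuousOn (hfh.mono hKT)).isBounded
  have hpc : ∀ k, Continuous fun y => (F k y, G k y) := fun k =>
    (hF k).continuous.prodMk (hG k).continuous
  refine ⟨((hcm (1, 0)).smul ha.1).add ((hcm (0, 1)).smul hb.1),
    fun k y => Φ (F k y, G k y), fun k => ?_, ?_, ?_⟩
  · exact ⟨univ, isOpen_univ, subset_univ _,
      (((hΦ.comp ((hF k).prodMk (hG k))).of_le (by simp)).contDiffOn)⟩
  · exact tendstoUniformlyOn_comp_of_continuous hΦ.continuous hpair hbdd
  · have hder : ∀ k y, fderiv ℝ (fun y => Φ (F k y, G k y)) y =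
        fderiv ℝ Φ (F k y, G k y) (1, 0) • fderiv ℝ (F k) y +
          fderiv ℝ Φ (F k y, G k y) (0, 1) • fderiv ℝ (G k) y := by
      intro k y
      have h1 : HasFDerivAt (fun y => Φ (F k y, G k y)) ((fderiv ℝ Φ (F k y, G k y)).comp
          ((fderiv ℝ (F k) y).prod (fderiv ℝ (G k) y))) y :=
        (hΦ.differentiable (by simp) _).hasFDerivAt.comp y
          (((hF k).differentiable (by simp) y).hasFDerivAt.prodMk
            ((hG k).differentiable (by simp) y).hasFDerivAt)
      rw [h1.fderiv]
      ext v
      have : ((fderiv ℝ (F k) y v, fderiv ℝ (G k) y v) : ℝ × ℝ) =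
          (fderiv ℝ (F k) y v) • (1, 0) + (fderiv ℝ (G k) y v) • (0, 1) := by simp
      simp only [ContinuousLinearMap.comp_apply, ContinuousLinearMap.prod_apply, this, map_add,
        map_smul, add_apply, smul_apply, smul_eq_mul]
      ring
    have hterm : ∀ (w : ℝ × ℝ) (Q : ℕ → E → ℝ) (c : E → E →L[ℝ] ℝ), (∀ k, ContDiff ℝ ∞ (Q k)) →
        MemLp c 2 (volume.restrict K) →
        Tendsto (fun k => eLpNorm (fun y => fderiv ℝ (Q k) y - c y) 2 (volume.restrict K))
          atTop (𝓝 0) →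
        Tendsto (fun k => eLpNorm (fun y => fderiv ℝ Φ (F k y, G k y) w • fderiv ℝ (Q k) y -
          fderiv ℝ Φ (f y, h y) w • c y) 2 (volume.restrict K)) atTop (𝓝 0) := by
      intro w Q c hQ hc hQL
      obtain ⟨C, hC⟩ := hK.exists_bound_of_continuousOn (hcK w)
      exact tendsto_eLpNorm_smul hK.measurableSet
        (tendstoUniformlyOn_comp_of_continuous (g := fun p => fderiv ℝ Φ p w)
          (hΦ'.clm_apply continuous_const) hpair hbdd) hC
        (fun k => ((hΦ'.clm_apply continuous_const).comp (hpc k)).aestronglyMeasurable) (hcm w)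
        (fun k => ((hQ k).continuous_fderiv (by simp)).aestronglyMeasurable) hc hQL
    have h1 := hterm (1, 0) F a hF ha hFL
    have h2 := hterm (0, 1) G b hG hb hGL
    have hms : ∀ (k : ℕ) (w : ℝ × ℝ) (Q : E → ℝ) (c : E → E →L[ℝ] ℝ), ContDiff ℝ ∞ Q →
        MemLp c 2 (volume.restrict K) →
        AEStronglyMeasurable (fun y => fderiv ℝ Φ (F k y, G k y) w • fderiv ℝ Q y -
          fderiv ℝ Φ (f y, h y) w • c y) (volume.restrict K) := fun k w Q c hQ hc =>
      ((((hΦ'.clm_apply continuous_const).comp (hpc k)).smul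
        (hQ.continuous_fderiv (by simp))).aestronglyMeasurable).sub ((hcm w).smul hc.1)
    refine (tendsto_eLpNorm_add (fun k => hms k (1, 0) (F k) a (hF k) ha)
      (fun k => hms k (0, 1) (G k) b (hG k) hb) h1 h2).congr fun k => ?_
    congr 1
    ext1 y
    rw [hder k y]
    abel

end WeakCalculus

section WeakLocality

variable {E : Type*} [NormedAddCommGroup E] [NormedSpace ℝ E] [FiniteDimensional ℝ E]
  [MeasureSpace E] [BorelSpace E] [(volume : Measure E).IsAddHaarMeasure]
  {T : Set E} {f h : E → ℝ} {a b : E → E →L[ℝ] ℝ}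

theorem eLpNorm_comp_diffeo_le {S K : Set E} (hS : IsOpen S) {τ : E → E}
    (hτ : ContDiffOn ℝ 1 τ S) (hinj : InjOn τ S) (hdet : ∀ y ∈ S, (fderiv ℝ τ y).det ≠ 0)
    (hK : IsCompact K) (hKS : K ⊆ S) :
    ∃ C : ℝ≥0∞, C ≠ ⊤ ∧ ∀ g : E → ℝ≥0∞,
      ∫⁻ y in K, g (τ y) ≤ C * ∫⁻ z in τ '' K, g z := by
  have hdc : ContinuousOn (fun y => |(fderiv ℝ τ y).det|) K := by
    refine ContinuousOn.abs ?_
    exact ContinuousLinearMap.continuous_det.comp_continuousOn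
      ((hτ.continuousOn_fderiv_of_isOpen hS le_rfl).mono hKS)
  obtain ⟨c, hc0, hc⟩ : ∃ c : ℝ, 0 < c ∧ ∀ y ∈ K, c ≤ |(fderiv ℝ τ y).det| := by
    rcases K.eq_empty_or_nonempty with rfl | hne
    · exact ⟨1, one_pos, by simp⟩
    obtain ⟨y, hy, hmin⟩ := hK.exists_isMinOn hne hdc
    exact ⟨_, abs_pos.2 (hdet y (hKS hy)), fun z hz => hmin hz⟩
  have hcpos : 0 < ENNReal.ofReal c := ENNReal.ofReal_pos.2 hc0
  refine ⟨(ENNReal.ofReal c)⁻¹, ENNReal.inv_ne_top.2 hcpos.ne', fun g => ?_⟩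
  rw [lintegral_image_eq_lintegral_abs_det_fderiv_mul volume hK.measurableSet
    (fun y hy => ((hτ.contDiffAt (hS.mem_nhds (hKS hy))).differentiableAt
      (by simp)).hasFDerivAt.hasFDerivWithinAt) (hinj.mono hKS)]
  rw [← lintegral_const_mul' _ _ (ENNReal.inv_ne_top.2 hcpos.ne')]
  refine setLIntegral_mono' hK.measurableSet fun y hy => ?_
  rw [← mul_assoc]
  refine le_mul_of_one_le_left zero_le ?_
  calc (1 : ℝ≥0∞) = (ENNReal.ofReal c)⁻¹ * ENNReal.ofReal c :=
        (ENNReal.inv_mul_cancel hcpos.ne' ENNReal.ofReal_ne_top).symm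
    _ ≤ _ := by gcongr; exact hc y hy

theorem aestronglyMeasurable_comp_diffeo {F : Type*} [TopologicalSpace F]
    {S K : Set E} (hS : IsOpen S) {τ : E → E}
    (hτ : ContDiffOn ℝ 1 τ S) (hinj : InjOn τ S) (hdet : ∀ y ∈ S, (fderiv ℝ τ y).det ≠ 0)
    (hK : IsCompact K) (hKS : K ⊆ S) {b : E → F}
    (hb : AEStronglyMeasurable b (volume.restrict (τ '' K))) :
    AEStronglyMeasurable (fun y => b (τ y)) (volume.restrict K) := by
  obtain ⟨C, hC, hle⟩ := eLpNorm_comp_diffeo_le hS hτ hinj hdet hK hKS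
  have hτc : ContinuousOn τ K := hτ.continuousOn.mono hKS
  have hτm : AEMeasurable τ (volume.restrict K) := hτc.aemeasurable hK.measurableSet
  refine (hb.mono_ac ?_).comp_aemeasurable hτm
  refine Measure.AbsolutelyContinuous.mk fun B hB hB0 => ?_
  rw [Measure.map_apply_of_aemeasurable hτm hB]
  have h1 := hle (B.indicator 1)
  rw [lintegral_indicator_one hB, hB0, mul_zero, nonpos_iff_eq_zero] at h1
  rw [← lintegral_indicator_one₀ (hτm.nullMeasurable hB)]
  exact h1

/-- Weak derivatives transform like derivatives under a change of variables. -/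
theorem IsWeakDiffOn.comp_diffeo (hf : IsWeakDiffOn T f a) (hT : IsOpen T) {S : Set E}
    (hS : IsOpen S) {τ : E → E} (hτ : ContDiffOn ℝ 1 τ S) (hinj : InjOn τ S)
    (hmaps : MapsTo τ S T) (hdet : ∀ y ∈ S, (fderiv ℝ τ y).det ≠ 0) :
    IsWeakDiffOn S (fun y => f (τ y)) (fun y => (a (τ y)).comp (fderiv ℝ τ y)) := by
  refine IsWeakDiffOn.of_approx (hf.continuousOn.comp hτ.continuousOn hmaps) fun K hK hKS => ?_
  have hτK : IsCompact (τ '' K) := hK.image_of_continuousOn (hτ.continuousOn.mono hKS)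
  have hτKT : τ '' K ⊆ T := (image_mono hKS).trans hmaps.image_subset
  obtain ⟨F, hF, hFu, hFL⟩ := hf.exists_approx hT hτK hτKT
  obtain ⟨C, hC, hle⟩ := eLpNorm_comp_diffeo_le hS hτ hinj hdet hK hKS
  have hdτ : ContinuousOn (fderiv ℝ τ) K := (hτ.continuousOn_fderiv_of_isOpen hS le_rfl).mono hKS
  obtain ⟨D, hD⟩ := hK.exists_bound_of_continuousOn hdτ
  refine ⟨?_, fun k y => F k (τ y), fun k => ⟨S, hS, hKS, ?_⟩, ?_, ?_⟩
  · exact (ContinuousLinearMap.compL ℝ E E ℝ).continuous₂.comp_aestronglyMeasurable₂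
      (aestronglyMeasurable_comp_diffeo hS hτ hinj hdet hK hKS (hf.memLp _ hτK hτKT).1)
      (hdτ.aestronglyMeasurable_of_isCompact hK hK.measurableSet)
  · exact ((hF k).of_le (by simp)).comp_contDiffOn hτ
  · exact (hFu.comp τ).mono (subset_preimage_image τ K)
  · have hbound : ∀ k, eLpNorm (fun y => fderiv ℝ (fun y => F k (τ y)) y -
        (a (τ y)).comp (fderiv ℝ τ y)) 2 (volume.restrict K) ≤
        ENNReal.ofReal D * (C ^ (1 / (2 : ℝ)) *
          eLpNorm (fun z => fderiv ℝ (F k) z - a z) 2 (volume.restrict (τ '' K))) := by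
      intro k
      have h1 : eLpNorm (fun y => fderiv ℝ (fun y => F k (τ y)) y -
          (a (τ y)).comp (fderiv ℝ τ y)) 2 (volume.restrict K) ≤
          ENNReal.ofReal D *
            eLpNorm (fun y => fderiv ℝ (F k) (τ y) - a (τ y)) 2 (volume.restrict K) := by
        refine eLpNorm_le_mul_eLpNorm_of_ae_le_mul
          (ae_restrict_of_forall_mem hK.measurableSet fun y hy => ?_) 2
        have hd : HasFDerivAt (fun y => F k (τ y)) ((fderiv ℝ (F k) (τ y)).comp (fderiv ℝ τ y)) y :=
          ((hF k).differentiable (by simp) _).hasFDerivAt.comp y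
            ((hτ.contDiffAt (hS.mem_nhds (hKS hy))).differentiableAt (by simp)).hasFDerivAt
        rw [hd.fderiv, ← ContinuousLinearMap.sub_comp, mul_comm]
        refine (ContinuousLinearMap.opNorm_comp_le _ _).trans ?_
        gcongr
        exact hD y hy
      refine h1.trans ?_
      gcongr
      rw [eLpNorm_eq_lintegral_rpow_enorm_toReal (by norm_num) (by norm_num),
        eLpNorm_eq_lintegral_rpow_enorm_toReal (by norm_num) (by norm_num)]
      simp only [ENNReal.toReal_ofNat]
      rw [← ENNReal.mul_rpow_of_nonneg _ _ (by norm_num)]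
      gcongr
      exact hle fun z => ‖fderiv ℝ (F k) z - a z‖ₑ ^ (2 : ℝ)
    have hlim : Tendsto (fun k => ENNReal.ofReal D * (C ^ (1 / (2 : ℝ)) *
        eLpNorm (fun z => fderiv ℝ (F k) z - a z) 2 (volume.restrict (τ '' K)))) atTop (𝓝 0) := by
      have h1 := ENNReal.Tendsto.const_mul hFL
        (Or.inr (ENNReal.rpow_ne_top_of_nonneg (by norm_num : (0 : ℝ) ≤ 1 / 2) hC))
      have h2 := ENNReal.Tendsto.const_mul h1 (Or.inr (ENNReal.ofReal_ne_top (r := D)))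
      simpa using h2
    exact tendsto_of_tendsto_of_tendsto_of_le_of_le tendsto_const_nhds hlim
      (fun k => zero_le) hbound

theorem memLp_restrict_union {α F : Type*} [MeasurableSpace α] {μ : Measure α}
    [NormedAddCommGroup F] {c : α → F} {s t : Set α}
    (hs : MemLp c 2 (μ.restrict s)) (ht : MemLp c 2 (μ.restrict t)) :
    MemLp c 2 (μ.restrict (s ∪ t)) := by
  have hadd : MemLp c 2 (μ.restrict s + μ.restrict t) := by
    refine ⟨hs.1.add_measure ht.1, ?_⟩
    have h1 := hs.2
    have h2 := ht.2
    rw [eLpNorm_lt_top_iff_lintegral_rpow_enorm_lt_top (by norm_num) (by norm_num)] at *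
    rw [lintegral_add_measure]
    exact ENNReal.add_lt_top.2 ⟨h1, h2⟩
  exact hadd.mono_measure (Measure.restrict_union_le s t)

/-- Being a weak derivative is a local property. -/
theorem IsWeakDiffOn.of_local
    (hloc : ∀ y ∈ T, ∃ N, IsOpen N ∧ y ∈ N ∧ IsWeakDiffOn N f a) : IsWeakDiffOn T f a := by
  choose! N hNo hyN hN using hloc
  refine ⟨fun y hy => ((hN y hy).continuousOn.continuousAt
    ((hNo y hy).mem_nhds (hyN y hy))).continuousWithinAt, fun K hK hKT => ?_,
    fun v ψ hψ hψs hψT => ?_⟩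
  · refine hK.induction_on (p := fun s => MemLp a 2 (volume.restrict s)) (by simp)
      (fun s t hst ht => ht.mono_measure (Measure.restrict_mono hst le_rfl))
      (fun s t hs ht => memLp_restrict_union hs ht) fun y hy => ?_
    obtain ⟨r, hr, hrN⟩ := Metric.nhds_basis_closedBall.mem_iff.1
      ((hNo y (hKT hy)).mem_nhds (hyN y (hKT hy)))
    exact ⟨_, mem_nhdsWithin_of_mem_nhds (Metric.closedBall_mem_nhds y hr),
      (hN y (hKT hy)).memLp _ (isCompact_closedBall y r) hrN⟩
  · obtain ⟨s, χ, hsK, hχ, -, hχN, hχ1⟩ := exists_finite_partition 𝓘(ℝ, E) hψs.isCompact (N := N)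
      fun y hy => (hNo y (hψT hy)).mem_nhds (hyN y (hψT hy))
    simp only [contMDiff_iff_contDiff] at hχ
    have hsum : ψ = fun y => ∑ i, χ i y * ψ y := by
      ext y
      by_cases hy : y ∈ tsupport ψ
      · rw [← Finset.sum_mul, hχ1 y hy, one_mul]
      · simp [image_eq_zero_of_notMem_tsupport hy]
    have hψi : ∀ i, ContDiff ℝ ∞ fun y => χ i y * ψ y := fun i => (hχ i).mul hψ
    have hψis : ∀ i, HasCompactSupport fun y => χ i y * ψ y := fun i => hψs.mul_left
    have hψiN : ∀ i : s, tsupport (fun y => χ i y * ψ y) ⊆ N i := fun i =>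
      (closure_mono (Function.support_mul_subset_left _ _)).trans (hχN i)
    have hNi : ∀ i : s, IsWeakDiffOn (N i) f a := fun i => hN i (hψT (hsK i))
    have hder : ∀ y, fderiv ℝ ψ y v = ∑ i, fderiv ℝ (fun y => χ i y * ψ y) y v := by
      intro y
      conv_lhs => rw [hsum]
      rw [fderiv_fun_sum fun i _ => (hψi i).differentiable (by simp) y]
      simp
    have i1 : ∀ i : s, Integrable fun y => f y * fderiv ℝ (fun y => χ i y * ψ y) y v := by
      intro i
      refine memLp_one_iff_integrable.1 (memLp_of_restrict (hψis i).isCompact.measurableSet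
        (memLp_restrict_of_continuousOn (hψis i).isCompact (((hNi i).continuousOn.mono
          (hψiN i)).mul ((((hψi i).continuous_fderiv (by simp)).clm_apply
            continuous_const).continuousOn)) 1) fun y hy => ?_)
      simp [fderiv_eq_zero_of_notMem_tsupport hy]
    have i2 : ∀ i : s, Integrable fun y => a y v * (χ i y * ψ y) := by
      intro i
      refine memLp_one_iff_integrable.1 (memLp_of_restrict (hψis i).isCompact.measurableSet
        (memLp_one_iff_integrable.2 ?_) fun y hy => ?_)
      · have := memLp_two_integrable_apply ((hNi i).memLp _ (hψis i).isCompact (hψiN i))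
          (memLp_restrict_of_continuousOn (h := fun y => (χ i y * ψ y) • v) (hψis i).isCompact
            ((hψi i).continuous.smul continuous_const).continuousOn 2)
        refine this.congr (Eventually.of_forall fun y => ?_)
        simp [mul_comm]
      · have : χ i y * ψ y = 0 :=
          image_eq_zero_of_notMem_tsupport (f := fun y => χ i y * ψ y) hy
        rw [this, mul_zero]
    calc ∫ y, f y * fderiv ℝ ψ y v
        = ∫ y, ∑ i, f y * fderiv ℝ (fun y => χ i y * ψ y) y v := by
          congr 1; ext y; rw [hder, Finset.mul_sum]
      _ = ∑ i, -∫ y, a y v * (χ i y * ψ y) := by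
          rw [integral_finsetSum _ fun i _ => i1 i]
          exact Finset.sum_congr rfl fun i _ =>
            (hNi i).integral_eq v _ (hψi i) (hψis i) (hψiN i)
      _ = -∫ y, ∑ i, a y v * (χ i y * ψ y) := by
          rw [integral_finsetSum _ fun i _ => i2 i, Finset.sum_neg_distrib]
      _ = -∫ y, a y v * ψ y := by
          congr 2; ext y; rw [← Finset.mul_sum, ← congrFun hsum y]

/-- A differential inequality that holds for smooth test functions holds for weakly differentiable
ones. -/
theorem IsWeakDiffOn.integral_apply_nonneg (hT : IsOpen T) {ζ : E → E}
    (hζ : ∀ K, IsCompact K → K ⊆ T → MemLp ζ 2 (volume.restrict K))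
    (hpos : ∀ ψ : E → ℝ, ContDiff ℝ ∞ ψ → HasCompactSupport ψ → tsupport ψ ⊆ T → (∀ y, 0 ≤ ψ y) →
      0 ≤ ∫ y, fderiv ℝ ψ y (ζ y))
    (hf : IsWeakDiffOn T f a) (hf0 : ∀ y, 0 ≤ f y) {K : Set E} (hK : IsCompact K) (hKT : K ⊆ T)
    (hfK : ∀ y ∉ K, f y = 0) (haK : ∀ y ∉ K, a y = 0) :
    0 ≤ ∫ y, a y (ζ y) := by
  obtain ⟨χ, hχ, hχs, hχT, hχ1, -⟩ := exists_contDiff_cutoff hK hT hKT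
  obtain ⟨hw, hm⟩ := hf.cutoff hT hχ hχs hχT
  have h1 : ∀ y ∈ K, χ =ᶠ[𝓝 y] fun _ => 1 := fun y hy => eventually_nhdsSet_iff_forall.1 hχ1 y hy
  have ef : (fun y => χ y * f y) = f := by
    ext y
    by_cases hy : y ∈ K
    · simp [(h1 y hy).eq_of_nhds]
    · simp [hfK y hy]
  have ea : (fun y => χ y • a y + f y • fderiv ℝ χ y) = a := by
    ext1 y
    by_cases hy : y ∈ K
    · simp [(h1 y hy).eq_of_nhds, (h1 y hy).fderiv_eq]
    · simp [hfK y hy, haK y hy]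
  rw [ef, ea] at hw
  rw [ea] at hm
  obtain ⟨F, hF, hF0, -, hFL, hFs⟩ := hw.exists_approx_of_support hm hK hfK
  obtain ⟨ε, hε, hεT⟩ := hK.exists_cthickening_subset_open hT hKT
  set K' := Metric.cthickening ε K with hK'
  have hK'c : IsCompact K' := hK.cthickening
  have hFm : ∀ k, MemLp (fderiv ℝ (F k)) 2 (volume.restrict K') := fun k =>
    memLp_restrict_of_continuousOn hK'c ((hF k).continuous_fderiv (by simp)).continuousOn 2
  have hL' : Tendsto (fun k => eLpNorm (fun y => fderiv ℝ (F k) y - a y) 2 (volume.restrict K'))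
      atTop (𝓝 0) :=
    tendsto_of_tendsto_of_tendsto_of_le_of_le tendsto_const_nhds hFL (fun k => zero_le)
      fun k => eLpNorm_mono_measure _ Measure.restrict_le_self
  have lim := tendsto_integral_apply hFm (hm.restrict K') (hζ K' hK'c hεT) hL'
  have e1 : ∫ y, a y (ζ y) = ∫ y in K', a y (ζ y) :=
    integral_eq_setIntegral_of_forall_notMem fun y hy => by
      rw [haK y fun hyK => hy (Metric.self_subset_cthickening K hyK)]; simp
  rw [e1]
  refine ge_of_tendsto lim ?_
  filter_upwards [hFs ε hε] with k hk
  have hts : tsupport (F k) ⊆ K' := closure_minimal hk Metric.isClosed_cthickening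
  have e2 : ∫ y, fderiv ℝ (F k) y (ζ y) = ∫ y in K', fderiv ℝ (F k) y (ζ y) :=
    integral_eq_setIntegral_of_forall_notMem fun y hy => by
      rw [fderiv_eq_zero_of_notMem_tsupport fun hyt => hy (hts hyt)]; simp
  rw [← e2]
  exact hpos _ (hF k) (hK'c.of_isClosed_subset (isClosed_tsupport _) hts) (hts.trans hεT)
    (hF0 hf0 k)

end WeakLocality

section StrongMinimum

variable {E : Type*} [NormedAddCommGroup E] [InnerProductSpace ℝ E] [FiniteDimensional ℝ E]
  [MeasureSpace E] [BorelSpace E] [(volume : Measure E).IsAddHaarMeasure]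
  {T : Set E} {f : E → ℝ} {a : E → E →L[ℝ] ℝ} {A : E → (E →L[ℝ] ℝ) →L[ℝ] E}

theorem deriv_expNegInvGlue_eq_zero {t : ℝ} (ht : t < 0) : deriv expNegInvGlue t = 0 := by
  have : expNegInvGlue =ᶠ[𝓝 t] fun _ => 0 := by
    filter_upwards [gt_mem_nhds ht] with s hs using expNegInvGlue.zero_of_nonpos hs.le
  rw [this.deriv_eq, deriv_const]

theorem expNegInvGlue_monotone : Monotone expNegInvGlue := by
  intro s t hst
  rcases le_or_gt s 0 with hs | hs
  · rw [expNegInvGlue.zero_of_nonpos hs]; exact expNegInvGlue.nonneg t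
  · have ht : 0 < t := hs.trans_le hst
    simp only [expNegInvGlue, not_le.2 hs, not_le.2 ht, if_false]
    refine Real.exp_le_exp.2 (neg_le_neg ?_)
    exact inv_anti₀ hs hst

theorem memLp_clm_apply {F G : Type*} [NormedAddCommGroup F] [NormedSpace ℝ F]
    [NormedAddCommGroup G] [NormedSpace ℝ G] {B : E → F →L[ℝ] G} {c : E → F} {K : Set E}
    (hK : IsCompact K) (hB : ContinuousOn B K) (hc : MemLp c 2 (volume.restrict K)) :
    MemLp (fun y => B y (c y)) 2 (volume.restrict K) := by
  obtain ⟨C, hC⟩ := hK.exists_bound_of_continuousOn hB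
  refine MemLp.of_le_mul (c := C) hc ?_ ?_
  · exact (isBoundedBilinearMap_apply (𝕜 := ℝ) (E := F) (F := G)).continuous
      |>.comp_aestronglyMeasurable
        ((hB.aestronglyMeasurable_of_isCompact hK hK.measurableSet).prodMk hc.1)
  · refine ae_restrict_of_forall_mem hK.measurableSet fun y hy => ?_
    exact ((B y).le_opNorm _).trans (by gcongr; exact hC y hy)

/-- Weak derivatives, tested against a smooth vector field: the divergence theorem. -/
theorem exists_divergence (hT : IsOpen T) {Z : E → E} (hZ : ContDiffOn ℝ ∞ Z T) {K : Set E}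
    (hK : IsCompact K) (hKT : K ⊆ T) :
    ∃ d : E → ℝ, Continuous d ∧ ∀ (ρ w : E → ℝ) (c : E → E →L[ℝ] ℝ), IsWeakDiffOn T ρ c →
      (∀ y ∉ K, ρ y = 0) → (∀ y ∉ K, c y = 0) → ContDiff ℝ ∞ w →
      ∫ y, w y * c y (Z y) = -∫ y, ρ y * (w y * d y + fderiv ℝ w y (Z y)) := by
  obtain ⟨χ, hχ, hχs, hχT, hχ1, -⟩ := exists_contDiff_cutoff hK hT hKT
  have h1 : ∀ y ∈ K, χ y = 1 := fun y hy =>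
    (eventually_nhdsSet_iff_forall.1 hχ1 y hy).self_of_nhds
  let b := stdOrthonormalBasis ℝ E
  set P : Fin (Module.finrank ℝ E) → E → ℝ := fun i y => χ y * inner ℝ (b i) (Z y) with hP
  have hPs : ∀ i, ContDiff ℝ ∞ (P i) := by
    intro i
    refine contDiff_iff_contDiffAt.2 fun y => ?_
    by_cases hy : y ∈ tsupport χ
    · exact hχ.contDiffAt.mul (contDiffAt_const.inner ℝ (hZ.contDiffAt (hT.mem_nhds (hχT hy))))
    · have : P i =ᶠ[𝓝 y] fun _ => 0 := by
        filter_upwards [(isClosed_tsupport χ).isOpen_compl.mem_nhds hy] with z hz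
        simp [hP, image_eq_zero_of_notMem_tsupport hz]
      exact contDiffAt_const.congr_of_eventuallyEq this
  have hPc : ∀ i, HasCompactSupport (P i) := fun i => hχs.mul_right
  have hPT : ∀ i, tsupport (P i) ⊆ T := fun i =>
    (closure_mono (Function.support_mul_subset_left _ _)).trans hχT
  refine ⟨fun y => ∑ i, fderiv ℝ (P i) y (b i), ?_, fun ρ w c hρ hρ0 hc0 hw => ?_⟩
  · exact continuous_finsetSum _ fun i _ =>
      ((hPs i).continuous_fderiv (by simp)).clm_apply continuous_const
  have hZK : ∀ y ∈ K, Z y = ∑ i, P i y • b i := by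
    intro y hy
    simp only [hP, h1 y hy, one_mul]
    exact (b.sum_repr' (Z y)).symm
  have hQ : ∀ i, ContDiff ℝ ∞ fun y => w y * P i y := fun i => hw.mul (hPs i)
  have hQc : ∀ i, HasCompactSupport fun y => w y * P i y := fun i => (hPc i).mul_left
  have hQT : ∀ i, tsupport (fun y => w y * P i y) ⊆ T := fun i =>
    (closure_mono (Function.support_mul_subset_right _ _)).trans (hPT i)
  have hdQ : ∀ i y, fderiv ℝ (fun y => w y * P i y) y (b i) =
      w y * fderiv ℝ (P i) y (b i) + P i y * fderiv ℝ w y (b i) := by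
    intro i y
    rw [fderiv_fun_mul (hw.differentiable (by simp) y) ((hPs i).differentiable (by simp) y)]
    simp
  have hKi : ∀ {g : E → ℝ}, Integrable g (volume.restrict K) → (∀ y ∉ K, g y = 0) →
      Integrable g := fun hg hg0 =>
    memLp_one_iff_integrable.1 (memLp_of_restrict hK.measurableSet
      (memLp_one_iff_integrable.2 hg) hg0)
  have i1 : ∀ i, Integrable fun y => c y (b i) * (w y * P i y) := by
    intro i
    refine hKi ?_ fun y hy => by simp [hc0 y hy]
    have := memLp_two_integrable_apply (hρ.memLp K hK hKT)
      (memLp_restrict_of_continuousOn (h := fun y => (w y * P i y) • b i) hK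
        ((hQ i).continuous.smul continuous_const).continuousOn 2)
    refine this.congr (Eventually.of_forall fun y => ?_)
    simp [mul_comm]
  have i2 : ∀ i, Integrable fun y => ρ y * fderiv ℝ (fun y => w y * P i y) y (b i) := by
    intro i
    refine hKi ?_ fun y hy => by simp [hρ0 y hy]
    exact memLp_one_iff_integrable.1 (memLp_restrict_of_continuousOn hK
      ((hρ.continuousOn.mono hKT).mul (((hQ i).continuous_fderiv (by simp)).clm_apply
        continuous_const).continuousOn) 1)
  calc ∫ y, w y * c y (Z y) = ∫ y, ∑ i, c y (b i) * (w y * P i y) := by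
        congr 1; ext y
        by_cases hy : y ∈ K
        · rw [hZK y hy, map_sum, Finset.mul_sum]
          refine Finset.sum_congr rfl fun i _ => ?_
          simp; ring
        · simp [hc0 y hy]
    _ = ∑ i, -∫ y, ρ y * fderiv ℝ (fun y => w y * P i y) y (b i) := by
        rw [integral_finsetSum _ fun i _ => i1 i]
        refine Finset.sum_congr rfl fun i _ => ?_
        rw [hρ.integral_eq (b i) _ (hQ i) (hQc i) (hQT i), neg_neg]
    _ = -∫ y, ∑ i, ρ y * fderiv ℝ (fun y => w y * P i y) y (b i) := by
        rw [integral_finsetSum _ fun i _ => i2 i, Finset.sum_neg_distrib]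
    _ = _ := by
        congr 2; ext y
        by_cases hy : y ∈ K
        · rw [← Finset.mul_sum]
          congr 1
          simp only [hdQ, Finset.sum_add_distrib, ← Finset.mul_sum]
          conv_rhs => rw [hZK y hy, map_sum]
          simp
        · simp [hρ0 y hy]

set_option maxHeartbeats 1000000 in
/-- Positivity of nonnegative weak supersolutions propagates from the center of a ball to the
ball. -/
theorem pos_on_ball (hT : IsOpen T) (hA : ContDiffOn ℝ ∞ A T)
    (hApos : ∀ y ∈ T, ∀ ℓ : E →L[ℝ] ℝ, ℓ ≠ 0 → 0 < ℓ (A y ℓ))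
    (hf : IsWeakDiffOn T f a) (hf0 : ∀ y ∈ T, 0 ≤ f y)
    (hsup : ∀ ψ : E → ℝ, ContDiff ℝ ∞ ψ → HasCompactSupport ψ → tsupport ψ ⊆ T →
      (∀ y, 0 ≤ ψ y) → 0 ≤ ∫ y, fderiv ℝ ψ y (A y (a y)))
    {y₀ z : E} {R : ℝ} (hR : Metric.closedBall y₀ R ⊆ T) (hy₀ : 0 < f y₀)
    (hz : z ∈ Metric.ball y₀ R) : 0 < f z := by
  have hR0 : 0 < R := dist_nonneg.trans_lt (Metric.mem_ball.1 hz)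
  have hzT : z ∈ T := hR (Metric.ball_subset_closedBall hz)
  have hy₀T : y₀ ∈ T := hR (Metric.mem_closedBall_self hR0.le)
  -- a small ball on which `f ≥ m`
  obtain ⟨r, hr0, hrR, m, hm0, hm⟩ : ∃ r > 0, r < R ∧ ∃ m > 0, ∀ y ∈ Metric.closedBall y₀ r,
      m ≤ f y := by
    have hcont : ContinuousAt f y₀ := hf.continuousOn.continuousAt (hT.mem_nhds hy₀T)
    have hev : ∀ᶠ y in 𝓝 y₀, f y₀ / 2 < f y := hcont.eventually (lt_mem_nhds (half_lt_self hy₀))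
    obtain ⟨s, hs0, hs⟩ := Metric.nhds_basis_closedBall.mem_iff.1 hev
    refine ⟨min s (R / 2), lt_min hs0 (half_pos hR0),
      (min_le_right _ _).trans_lt (half_lt_self hR0), f y₀ / 2, half_pos hy₀, fun y hy => ?_⟩
    exact le_of_lt (hs (Metric.closedBall_subset_closedBall (min_le_left _ _) hy))
  by_contra hfz
  have hfz0 : f z = 0 := le_antisymm (not_lt.1 hfz) (hf0 z hzT)
  set Kb := Metric.closedBall y₀ R with hKb
  have hKbc : IsCompact Kb := isCompact_closedBall y₀ R
  set S : Set E := {y | y ∈ Kb ∧ r ≤ dist y y₀} with hS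
  have hSc : IsCompact S := hKbc.inter_right (isClosed_le continuous_const
    (continuous_id.dist continuous_const))
  set ℓ : E → E →L[ℝ] ℝ := fun y => innerSL ℝ (y - y₀) with hℓ
  have hℓs : ContDiff ℝ ∞ ℓ := (innerSL ℝ).contDiff.comp (contDiff_id.sub contDiff_const)
  set Z : E → E := fun y => A y (ℓ y) with hZdef
  have hZ : ContDiffOn ℝ ∞ Z T := hA.clm_apply hℓs.contDiffOn
  obtain ⟨lam, hlam0, hlam⟩ : ∃ lam > 0, ∀ y ∈ S, lam ≤ ℓ y (Z y) := by
    rcases S.eq_empty_or_nonempty with hSe | hne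
    · exact ⟨1, one_pos, by simp [hSe]⟩
    have hc : ContinuousOn (fun y => ℓ y (Z y)) S :=
      hℓs.continuous.continuousOn.clm_apply (hZ.continuousOn.mono fun y hy => hR hy.1)
    obtain ⟨y, hy, hmin⟩ := hSc.exists_isMinOn hne hc
    refine ⟨_, hApos y (hR hy.1) (ℓ y) ?_, fun w hw => hmin hw⟩
    intro h0
    have h1 : ℓ y (y - y₀) = 0 := by rw [h0]; rfl
    simp only [hℓ, innerSL_apply_apply, inner_self_eq_zero, sub_eq_zero] at h1
    have h2 := hy.2
    rw [h1, dist_self] at h2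
    linarith
  obtain ⟨d, hdc, hdiv⟩ := exists_divergence hT hZ hKbc hR
  obtain ⟨C, hC⟩ := hKbc.exists_bound_of_continuousOn hdc.continuousOn
  have hC0 : 0 ≤ C := (norm_nonneg _).trans (hC y₀ (Metric.mem_closedBall_self hR0.le))
  set α : ℝ := (C + 1) / (2 * lam) with hα
  have hα0 : 0 < α := by positivity
  have hαlam : 2 * α * lam = C + 1 := by rw [hα]; field_simp
  set v : E → ℝ := fun y => Real.exp (-α * ‖y - y₀‖ ^ 2) with hv
  have hvs : ContDiff ℝ ∞ v :=
    (contDiff_const.mul ((contDiff_id.sub contDiff_const).norm_sq ℝ)).exp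
  have hvpos : ∀ y, 0 < v y := fun y => Real.exp_pos _
  have hdv : ∀ y, fderiv ℝ v y = (-2 * α * v y) • ℓ y := by
    intro y
    have h1 : HasFDerivAt (fun y : E => ‖y - y₀‖ ^ 2) (2 • (innerSL ℝ (y - y₀))) y := by
      have := ((hasFDerivAt_id y).sub_const y₀).norm_sq
      simpa using this
    have h2 : HasFDerivAt v _ y := (h1.const_mul (-α)).exp
    rw [h2.fderiv]
    ext w
    simp [hv, hℓ]
    ring
  set vR : ℝ := Real.exp (-α * R ^ 2) with hvR
  have hvR0 : 0 < vR := Real.exp_pos _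
  set u : E → ℝ := fun y => m * (v y - vR) with hu
  have hus : ContDiff ℝ ∞ u := contDiff_const.mul (hvs.sub contDiff_const)
  have hdu : ∀ y, fderiv ℝ u y = m • fderiv ℝ v y := by
    intro y
    have : HasFDerivAt u (m • fderiv ℝ v y) y :=
      ((hvs.differentiable (by simp) y).hasFDerivAt.sub_const vR).const_mul m
    exact this.fderiv
  set D : Set E := {y | r < dist y y₀ ∧ dist y y₀ < R} with hD
  have hDo : IsOpen D := (isOpen_lt continuous_const (continuous_id.dist continuous_const)).inter
    (isOpen_lt (continuous_id.dist continuous_const) continuous_const)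
  have hDT : D ⊆ T := fun y hy => hR (Metric.mem_closedBall.2 hy.2.le)
  have hout : ∀ y ∈ T, y ∉ D → u y - f y ≤ 0 := by
    intro y hyT hyD
    rcases le_or_gt (dist y y₀) r with h1 | h1
    · have h2 : v y ≤ 1 := Real.exp_le_one_iff.2 (by nlinarith [sq_nonneg ‖y - y₀‖])
      have h3 := hm y h1
      simp only [hu]
      nlinarith
    · have h2 : R ≤ dist y y₀ := not_lt.1 fun h => hyD ⟨h1, h⟩
      have h3 : v y ≤ vR := by
        refine Real.exp_le_exp.2 ?_
        rw [dist_eq_norm] at h2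
        have : R ^ 2 ≤ ‖y - y₀‖ ^ 2 := by gcongr
        nlinarith
      have h4 := hf0 y hyT
      simp only [hu]
      nlinarith
  have hzr : r < dist z y₀ := by
    by_contra h
    have := hm z (not_lt.1 h)
    linarith
  have hzD : z ∈ D := ⟨hzr, hz⟩
  have huz : 0 < u z := by
    have : vR < v z := by
      refine Real.exp_lt_exp.2 ?_
      have h2 := Metric.mem_ball.1 hz
      rw [dist_eq_norm] at h2
      have : ‖z - y₀‖ ^ 2 < R ^ 2 := by gcongr
      nlinarith
    simp only [hu]
    exact mul_pos hm0 (by linarith)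
  set η : ℝ := u z / 2 with hη
  have hη0 : 0 < η := half_pos huz
  set β : ℝ → ℝ := fun t => expNegInvGlue (t - η) with hβ
  have hβs : ContDiff ℝ ∞ β := expNegInvGlue.contDiff.comp (contDiff_id.sub contDiff_const)
  have hβ0 : ∀ t, 0 ≤ β t := fun t => expNegInvGlue.nonneg _
  have hβz : ∀ t, t < η → β t = 0 := fun t ht =>
    expNegInvGlue.zero_of_nonpos (by linarith)
  have hβ'z : ∀ t, t < η → deriv β t = 0 := fun t ht => by
    rw [hβ, deriv_comp_sub_const]
    exact deriv_expNegInvGlue_eq_zero (by linarith)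
  have hβmono : Monotone β := fun s t hst => expNegInvGlue_monotone (by linarith)
  have hβ'0 : ∀ t, 0 ≤ deriv β t := fun t => hβmono.deriv_nonneg
  -- the test function
  classical
  set ρ : E → ℝ := fun y => if y ∈ D then β (u y - f y) else 0 with hρ
  set c : E → E →L[ℝ] ℝ := fun y =>
    if y ∈ D then deriv β (u y - f y) • (fderiv ℝ u y - a y) else 0 with hc
  have huw : IsWeakDiffOn T u (fderiv ℝ u) :=
    IsWeakDiffOn.of_contDiffOn hT (hus.of_le (by simp)).contDiffOn
  have hweak : IsWeakDiffOn T (fun y => β (u y - f y))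
      (fun y => deriv β (u y - f y) • (fderiv ℝ u y - a y)) := by
    have hΦ : ContDiff ℝ ∞ fun p : ℝ × ℝ => β (p.1 - p.2) :=
      hβs.comp (contDiff_fst.sub contDiff_snd)
    refine (huw.comp₂ hT hf hΦ).congr (fun y _ => rfl) (Eventually.of_forall fun y _ => ?_)
    have hd : HasFDerivAt (fun p : ℝ × ℝ => β (p.1 - p.2))
        (deriv β (u y - f y) • (ContinuousLinearMap.fst ℝ ℝ ℝ - ContinuousLinearMap.snd ℝ ℝ ℝ))
        (u y, f y) := by
      have h1 : HasDerivAt β (deriv β (u y - f y)) ((u y, f y).1 - (u y, f y).2 : ℝ) :=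
        (hβs.differentiable (by simp) _).hasDerivAt
      have h2 : HasFDerivAt (fun p : ℝ × ℝ => p.1 - p.2)
          (ContinuousLinearMap.fst ℝ ℝ ℝ - ContinuousLinearMap.snd ℝ ℝ ℝ) (u y, f y) :=
        hasFDerivAt_fst.sub hasFDerivAt_snd
      exact h1.comp_hasFDerivAt (u y, f y) h2
    rw [hd.fderiv]
    ext w
    simp
    ring
  have hcontT : ContinuousOn (fun y => u y - f y) T := hus.continuous.continuousOn.sub
    hf.continuousOn
  have hρw : IsWeakDiffOn T ρ c := by
    refine IsWeakDiffOn.of_local fun y hy => ?_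
    by_cases hyD : y ∈ D
    · refine ⟨D, hDo, hyD, (hweak.mono hDT).congr (fun w hw => ?_)
        (Eventually.of_forall fun w hw => ?_)⟩
      · simp [hρ, hw]
      · simp [hc, hw]
    · refine ⟨T ∩ (fun y => u y - f y) ⁻¹' Iio η, hcontT.isOpen_inter_preimage hT isOpen_Iio,
        ⟨hy, (hout y hy hyD).trans_lt hη0⟩, (hweak.mono inter_subset_left).congr (fun w hw => ?_)
        (Eventually.of_forall fun w hw => ?_)⟩
      · simp only [hρ]
        split_ifs
        · rfl
        · exact hβz _ hw.2
      · simp only [hc]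
        split_ifs
        · rfl
        · rw [hβ'z _ hw.2, zero_smul]
  set K : Set E := S ∩ (fun y => u y - f y) ⁻¹' Ici η with hK
  have hST : S ⊆ T := fun y hy => hR hy.1
  have hKc : IsCompact K := by
    obtain ⟨t, ht, hteq⟩ := (hcontT.mono hST).preimage_isClosed_of_isClosed hSc.isClosed isClosed_Ici
      |> fun h => (⟨_, h, rfl⟩ : ∃ t, IsClosed t ∧ t = S ∩ (fun y => u y - f y) ⁻¹' Ici η)
    exact hSc.of_isClosed_subset (by rw [hK, ← hteq]; exact ht) inter_subset_left
  have hKT : K ⊆ T := fun y hy => hST hy.1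
  have hKKb : K ⊆ Kb := fun y hy => hy.1.1
  have hDK : ∀ y ∈ D, y ∉ K → u y - f y < η := fun y hy hyK =>
    not_le.1 fun h => hyK ⟨⟨Metric.mem_closedBall.2 hy.2.le, hy.1.le⟩, h⟩
  have hρK : ∀ y ∉ K, ρ y = 0 := by
    intro y hy
    simp only [hρ]
    split_ifs with hyD
    · exact hβz _ (hDK y hyD hy)
    · rfl
  have hcK : ∀ y ∉ K, c y = 0 := by
    intro y hy
    simp only [hc]
    split_ifs with hyD
    · rw [hβ'z _ (hDK y hyD hy), zero_smul]
    · rfl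
  have hρ0 : ∀ y, 0 ≤ ρ y := by
    intro y
    simp only [hρ]
    split_ifs
    · exact hβ0 _
    · exact le_rfl
  have hζ : ∀ K', IsCompact K' → K' ⊆ T → MemLp (fun y => A y (a y)) 2 (volume.restrict K') :=
    fun K' hK' hK'T => memLp_clm_apply hK' (hA.continuousOn.mono hK'T) (hf.memLp K' hK' hK'T)
  have test1 : 0 ≤ ∫ y, c y (A y (a y)) :=
    IsWeakDiffOn.integral_apply_nonneg hT hζ hsup hρw hρ0 hKc hKT hρK hcK
  have hcm := hρw.memLp K hKc hKT
  have hKi : ∀ {g : E → ℝ}, Integrable g (volume.restrict K) → (∀ y ∉ K, g y = 0) →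
      Integrable g := fun hg hg0 =>
    memLp_one_iff_integrable.1 (memLp_of_restrict hKc.measurableSet
      (memLp_one_iff_integrable.2 hg) hg0)
  have int1 : Integrable fun y => c y (A y (a y)) :=
    hKi (memLp_two_integrable_apply hcm (hζ K hKc hKT)) fun y hy => by simp [hcK y hy]
  have int2 : Integrable fun y => c y (A y (fderiv ℝ u y)) := by
    refine hKi (memLp_two_integrable_apply hcm (memLp_restrict_of_continuousOn hKc ?_ 2))
      fun y hy => by simp [hcK y hy]
    exact (hA.continuousOn.mono hKT).clm_apply (hus.continuous_fderiv (by simp)).continuousOn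
  have hρc : ContinuousOn ρ K := hρw.continuousOn.mono hKT
  have hcont3 : ContinuousOn (fun y => v y * ρ y) K := hvs.continuous.continuousOn.mul hρc
  have int3 : Integrable fun y => v y * ρ y :=
    hKi (memLp_one_iff_integrable.1 (memLp_restrict_of_continuousOn hKc hcont3 1))
      fun y hy => by simp [hρK y hy]
  have test2 : ∫ y, c y (A y (fderiv ℝ u y)) ≤ -(2 * α * m) * ∫ y, v y * ρ y := by
    have e1 : ∀ y, c y (A y (fderiv ℝ u y)) = (-2 * α * m) * (v y * c y (Z y)) := by
      intro y
      rw [hdu, hdv]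
      simp [hZdef]
      ring
    have e2 := hdiv ρ v c hρw (fun y hy => hρK y fun h => hy (hKKb h))
      (fun y hy => hcK y fun h => hy (hKKb h)) hvs
    simp_rw [e1]
    rw [integral_const_mul, e2]
    have e3 : ∀ y, ρ y * (v y * d y + fderiv ℝ v y (Z y)) ≤ -(v y * ρ y) := by
      intro y
      by_cases hy : y ∈ K
      · have h1 : d y ≤ C := (le_abs_self _).trans (hC y (hKKb hy))
        have h2 := hlam y hy.1
        have h4 : fderiv ℝ v y (Z y) = -2 * α * v y * ℓ y (Z y) := by rw [hdv]; simp
        have h5 : 2 * α * lam ≤ 2 * α * ℓ y (Z y) := by gcongr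
        rw [h4]
        have h6 : v y * d y + -2 * α * v y * ℓ y (Z y) ≤ v y * (-1) := by
          have : v y * d y + -2 * α * v y * ℓ y (Z y) = v y * (d y - 2 * α * ℓ y (Z y)) := by ring
          rw [this]
          exact mul_le_mul_of_nonneg_left (by linarith) (hvpos y).le
        nlinarith [hρ0 y]
      · simp [hρK y hy]
    have int4 : Integrable fun y => ρ y * (v y * d y + fderiv ℝ v y (Z y)) := by
      refine hKi (memLp_one_iff_integrable.1 (memLp_restrict_of_continuousOn hKc ?_ 1))
        fun y hy => by simp [hρK y hy]
      exact hρc.mul ((hvs.continuous.mul hdc).continuousOn.add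
        ((hvs.continuous_fderiv (by simp)).continuousOn.clm_apply (hZ.continuousOn.mono hKT)))
    have e4 : ∫ y, ρ y * (v y * d y + fderiv ℝ v y (Z y)) ≤ -∫ y, v y * ρ y := by
      rw [← integral_neg]
      exact integral_mono int4 int3.neg e3
    have : 0 < 2 * α * m := by positivity
    nlinarith
  have hnn : 0 ≤ ∫ y, (c y (A y (fderiv ℝ u y)) - c y (A y (a y))) := by
    refine integral_nonneg fun y => ?_
    simp only [Pi.zero_apply]
    rw [← map_sub, ← map_sub]
    simp only [hc]
    split_ifs with hyD
    · rw [smul_apply, smul_eq_mul]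
      refine mul_nonneg (hβ'0 _) ?_
      rcases eq_or_ne (fderiv ℝ u y - a y) 0 with h0 | h0
      · simp [h0]
      · exact (hApos y (hDT hyD) _ h0).le
    · simp
  rw [integral_sub int2 int1] at hnn
  have hint0 : ∫ y, v y * ρ y ≤ 0 := by
    have : 0 < 2 * α * m := by positivity
    by_contra hcon
    have := mul_pos this (not_le.1 hcon)
    linarith
  have hρz : 0 < ρ z := by
    simp only [hρ, hzD, if_true, hβ, hfz0]
    exact expNegInvGlue.pos_of_pos (by rw [hη]; linarith)
  have hpos : 0 < ∫ y, v y * ρ y := by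
    have hnn : 0 ≤ fun y => v y * ρ y := fun y => mul_nonneg (hvpos y).le (hρ0 y)
    rw [integral_pos_iff_support_of_nonneg hnn int3]
    refine Measure.measure_pos_of_mem_nhds volume (x := z) ?_
    have hca : ContinuousAt (fun y => v y * ρ y) z :=
      hvs.continuous.continuousAt.mul (hρw.continuousOn.continuousAt (hT.mem_nhds hzT))
    exact hca.eventually_ne (mul_pos (hvpos z) hρz).ne'
  linarith

/-- The strong minimum principle on a connected open subset of a vector space. -/
theorem pos_of_isPreconnected (hT : IsOpen T) (hTc : IsPreconnected T) (hA : ContDiffOn ℝ ∞ A T)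
    (hApos : ∀ y ∈ T, ∀ ℓ : E →L[ℝ] ℝ, ℓ ≠ 0 → 0 < ℓ (A y ℓ))
    (hf : IsWeakDiffOn T f a) (hf0 : ∀ y ∈ T, 0 ≤ f y)
    (hsup : ∀ ψ : E → ℝ, ContDiff ℝ ∞ ψ → HasCompactSupport ψ → tsupport ψ ⊆ T →
      (∀ y, 0 ≤ ψ y) → 0 ≤ ∫ y, fderiv ℝ ψ y (A y (a y)))
    {y₀ : E} (hy₀T : y₀ ∈ T) (hy₀ : 0 < f y₀) : ∀ z ∈ T, 0 < f z := by
  set P := {y ∈ T | 0 < f y} with hP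
  have hPo : IsOpen P := hf.continuousOn.isOpen_inter_preimage hT isOpen_Ioi
  have hsub : T ⊆ P := by
    refine hTc.subset_of_closure_inter_subset hPo ⟨y₀, hy₀T, hy₀T, hy₀⟩ ?_
    rintro y ⟨hyc, hyT⟩
    obtain ⟨R, hR0, hR⟩ := Metric.nhds_basis_closedBall.mem_iff.1 (hT.mem_nhds hyT)
    obtain ⟨x, hxP, hx⟩ := Metric.mem_closure_iff.1 hyc (R / 2) (half_pos hR0)
    refine ⟨hyT, pos_on_ball hT hA hApos hf hf0 hsup (y₀ := x) (R := R / 2) ?_ hxP.2 hx⟩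
    refine (Metric.closedBall_subset_closedBall' ?_).trans hR
    rw [dist_comm]
    linarith
  exact fun z hz => (hsub hz).2

end StrongMinimum

section ChartGeometry

variable {n : ℕ} {H : Type*} [TopologicalSpace H]
  {I : ModelWithCorners ℝ (EuclideanSpace ℝ (Fin n)) H}
  {M : Type*} [TopologicalSpace M] [ChartedSpace H M]

/-- The differential of the inverse of the chart around `x`. -/
noncomputable def frame (I : ModelWithCorners ℝ (EuclideanSpace ℝ (Fin n)) H) (x : M)
    (y : EuclideanSpace ℝ (Fin n)) :
    EuclideanSpace ℝ (Fin n) →L[ℝ] TangentSpace I ((extChartAt I x).symm y) :=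
  mfderivWithin 𝓘(ℝ, EuclideanSpace ℝ (Fin n)) I (extChartAt I x).symm (range I) y

variable [IsManifold I ∞ M]

theorem frame_isInvertible {x : M} {y : EuclideanSpace ℝ (Fin n)}
    (hy : y ∈ (extChartAt I x).target) : (frame I x y).IsInvertible :=
  have : IsManifold I 1 M := IsManifold.of_le (n := ∞) (by simp)
  isInvertible_mfderivWithin_extChartAt_symm hy

theorem frame_bijective {x : M} {y : EuclideanSpace ℝ (Fin n)}
    (hy : y ∈ (extChartAt I x).target) : Function.Bijective (frame I x y) := by
  obtain ⟨e, he⟩ := frame_isInvertible hy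
  rw [← he]
  exact e.bijective

/-- The metric in the chart around `x`, as a bilinear form on the model space. -/
noncomputable def metricForm (g : Metric I M) (x : M) (y : EuclideanSpace ℝ (Fin n)) :
    EuclideanSpace ℝ (Fin n) →L[ℝ] EuclideanSpace ℝ (Fin n) →L[ℝ] ℝ :=
  (ContinuousLinearMap.precomp ℝ (frame I x y)).comp
    ((g.inner ((extChartAt I x).symm y)).comp (frame I x y))

theorem metricForm_symm (g : Metric I M) (x : M) (y v w : EuclideanSpace ℝ (Fin n)) :
    metricForm g x y v w = metricForm g x y w v := g.symm _ _ _

theorem metricForm_pos (g : Metric I M) {x : M} {y v : EuclideanSpace ℝ (Fin n)}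
    (hy : y ∈ (extChartAt I x).target) (hv : v ≠ 0) : 0 < metricForm g x y v v := by
  refine g.pos _ _ fun h => hv ?_
  exact (frame_bijective hy).1 (h.trans (map_zero (frame I x y)).symm)

theorem contMDiffOn_coordVector (x : M) (v : EuclideanSpace ℝ (Fin n)) :
    ContMDiffOn 𝓘(ℝ, EuclideanSpace ℝ (Fin n)) I.tangent ∞
      (fun y => (⟨(extChartAt I x).symm y, coordVector I x v y⟩ : TangentBundle I M))
      (extChartAt I x).target := by
  have hu : UniqueMDiffOn 𝓘(ℝ, EuclideanSpace ℝ (Fin n)) (extChartAt I x).target := by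
    rw [uniqueMDiffOn_iff_uniqueDiffOn]
    exact uniqueDiffOn_extChartAt_target x
  have h := (contMDiffOn_extChartAt_symm (I := I) (n := ∞) x).contMDiffOn_tangentMapWithin
    (m := ∞) (by simp) hu
  have hsec : ContMDiff 𝓘(ℝ, EuclideanSpace ℝ (Fin n)) 𝓘(ℝ, EuclideanSpace ℝ (Fin n)).tangent ∞
      (fun y => (⟨y, v⟩ : TangentBundle 𝓘(ℝ, EuclideanSpace ℝ (Fin n))
        (EuclideanSpace ℝ (Fin n)))) := by
    rw [contMDiff_vectorSpace_iff_contDiff (V := fun _ => v)]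
    exact contDiff_const
  have h2 := h.comp hsec.contMDiffOn (s := (extChartAt I x).target) (fun y hy => hy)
  refine h2.congr fun y hy => ?_
  simp only [Function.comp_apply, tangentMapWithin, coordVector]
  congr 2
  exact mfderivWithin_congr_set (extChartAt_target_eventuallyEq_of_mem hy).symm

theorem contDiffOn_metricForm_apply (g : Metric I M) (x : M) (v w : EuclideanSpace ℝ (Fin n)) :
    ContDiffOn ℝ ∞ (fun y => metricForm g x y v w) (extChartAt I x).target := by
  rw [← contMDiffOn_iff_contDiffOn]
  intro y hy
  have hv := contMDiffOn_coordVector (I := I) x v y hy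
  have hw := contMDiffOn_coordVector (I := I) x w y hy
  have hb := contMDiffOn_extChartAt_symm (I := I) (n := ∞) x y hy
  have : ContMDiffWithinAt 𝓘(ℝ, EuclideanSpace ℝ (Fin n)) (I.prod 𝓘(ℝ)) ∞
      (fun y => Bundle.TotalSpace.mk' ℝ (E := Bundle.Trivial M ℝ) ((extChartAt I x).symm y)
        (g.inner ((extChartAt I x).symm y) (coordVector I x v y) (coordVector I x w y)))
      (extChartAt I x).target y := by
    apply ContMDiffWithinAt.clm_bundle_apply₂ (F₁ := EuclideanSpace ℝ (Fin n))
      (F₂ := EuclideanSpace ℝ (Fin n))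
    · exact ContMDiffAt.comp_contMDiffWithinAt y g.contMDiff.contMDiffAt hb
    · exact hv
    · exact hw
  simp only [Bundle.contMDiffWithinAt_totalSpace] at this
  exact this.2

theorem contDiffOn_metricForm (g : Metric I M) (x : M) :
    ContDiffOn ℝ ∞ (metricForm g x) (extChartAt I x).target := by
  rw [contDiffOn_clm_apply]
  intro v
  rw [contDiffOn_clm_apply]
  exact fun w => contDiffOn_metricForm_apply g x v w

theorem gramMatrix_apply (g : Metric I M) (x : M) (y : EuclideanSpace ℝ (Fin n)) (i j : Fin n) :
    gramMatrix g x y i j =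
      metricForm g x y (EuclideanSpace.single i 1) (EuclideanSpace.single j 1) := rfl

theorem sum_single_eq (v : EuclideanSpace ℝ (Fin n)) :
    ∑ i, v i • EuclideanSpace.single i (1 : ℝ) = v := by
  have := (EuclideanSpace.basisFun (Fin n) ℝ).sum_repr v
  simpa using this

theorem det_gramMatrix_pos (g : Metric I M) {x : M} {y : EuclideanSpace ℝ (Fin n)}
    (hy : y ∈ (extChartAt I x).target) : 0 < (gramMatrix g x y).det := by
  refine Matrix.PosDef.det_pos (Matrix.PosDef.of_dotProduct_mulVec_pos ?_ fun c hc => ?_)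
  · ext i j
    simp [gramMatrix_apply, metricForm_symm g x y (EuclideanSpace.single i 1)]
  · set v : EuclideanSpace ℝ (Fin n) := WithLp.toLp 2 c with hv
    have hv0 : v ≠ 0 := fun h => hc (by simpa [hv] using h)
    have := metricForm_pos g hy hv0
    have hsum : metricForm g x y v v = star c ⬝ᵥ (gramMatrix g x y).mulVec c := by
      conv_lhs => rw [← sum_single_eq v]
      simp only [map_sum, map_smul, sum_apply, smul_apply, dotProduct, Matrix.mulVec,
        gramMatrix_apply, smul_eq_mul, hv, star_trivial, Finset.mul_sum]
      rw [Finset.sum_comm]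
      refine Finset.sum_congr rfl fun i _ => Finset.sum_congr rfl fun j _ => ?_
      ring
    rwa [← hsum]

/-- The density `√(det g_ij)` of the Riemannian volume in the chart around `x`. -/
noncomputable def density (g : Metric I M) (x : M) (y : EuclideanSpace ℝ (Fin n)) : ℝ :=
  Real.sqrt (gramMatrix g x y).det

theorem density_pos (g : Metric I M) {x : M} {y : EuclideanSpace ℝ (Fin n)}
    (hy : y ∈ (extChartAt I x).target) : 0 < density g x y :=
  Real.sqrt_pos.2 (det_gramMatrix_pos g hy)

theorem contDiffOn_density (g : Metric I M) (x : M) :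
    ContDiffOn ℝ ∞ (density g x) (extChartAt I x).target := by
  have : ContDiffOn ℝ ∞ (fun y => (gramMatrix g x y).det) (extChartAt I x).target := by
    simp only [Matrix.det_apply]
    refine ContDiffOn.sum fun σ _ => ContDiffOn.const_smul _ ?_
    exact contDiffOn_prod fun i _ => contDiffOn_metricForm_apply g x _ _
  exact this.sqrt fun y hy => (det_gramMatrix_pos g hy).ne'

theorem metricForm_isInvertible (g : Metric I M) {x : M} {y : EuclideanSpace ℝ (Fin n)}
    (hy : y ∈ (extChartAt I x).target) : (metricForm g x y).IsInvertible := by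
  have hinj : Function.Injective (metricForm g x y) := by
    rw [injective_iff_map_eq_zero]
    intro v hv
    by_contra hv0
    have := metricForm_pos g hy hv0
    rw [hv] at this
    simp at this
  have hfr : Module.finrank ℝ (EuclideanSpace ℝ (Fin n)) =
      Module.finrank ℝ (EuclideanSpace ℝ (Fin n) →L[ℝ] ℝ) := by
    rw [← (LinearMap.toContinuousLinearMap (𝕜 := ℝ) (E := EuclideanSpace ℝ (Fin n))
      (F' := ℝ)).finrank_eq]
    exact (Subspace.dual_finrank_eq).symm
  let e := LinearEquiv.ofInjectiveOfFinrankEq (metricForm g x y).toLinearMap hinj hfr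
  exact ⟨e.toContinuousLinearEquiv, by ext v; rfl⟩

/-- The metric on covectors in the chart around `x`. -/
noncomputable def cometric (g : Metric I M) (x : M) (y : EuclideanSpace ℝ (Fin n)) :
    (EuclideanSpace ℝ (Fin n) →L[ℝ] ℝ) →L[ℝ] EuclideanSpace ℝ (Fin n) :=
  (metricForm g x y).inverse

theorem cometric_metricForm (g : Metric I M) {x : M} {y : EuclideanSpace ℝ (Fin n)}
    (hy : y ∈ (extChartAt I x).target) (v : EuclideanSpace ℝ (Fin n)) :
    cometric g x y (metricForm g x y v) = v := by
  obtain ⟨e, he⟩ := metricForm_isInvertible g hy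
  rw [cometric, ← he, ContinuousLinearMap.inverse_equiv]
  exact e.symm_apply_apply v

theorem metricForm_cometric (g : Metric I M) {x : M} {y : EuclideanSpace ℝ (Fin n)}
    (hy : y ∈ (extChartAt I x).target) (ℓ : EuclideanSpace ℝ (Fin n) →L[ℝ] ℝ) :
    metricForm g x y (cometric g x y ℓ) = ℓ := by
  obtain ⟨e, he⟩ := metricForm_isInvertible g hy
  rw [cometric, ← he, ContinuousLinearMap.inverse_equiv]
  exact e.apply_symm_apply ℓ

theorem cometric_pos (g : Metric I M) {x : M} {y : EuclideanSpace ℝ (Fin n)}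
    (hy : y ∈ (extChartAt I x).target) {ℓ : EuclideanSpace ℝ (Fin n) →L[ℝ] ℝ} (hℓ : ℓ ≠ 0) :
    0 < ℓ (cometric g x y ℓ) := by
  set v := cometric g x y ℓ with hv
  have h1 : metricForm g x y v = ℓ := metricForm_cometric g hy ℓ
  have hv0 : v ≠ 0 := by
    intro h
    rw [h, map_zero] at h1
    exact hℓ h1.symm
  rw [← h1]
  exact metricForm_pos g hy hv0

theorem contDiffOn_cometric (g : Metric I M) (x : M) :
    ContDiffOn ℝ ∞ (cometric g x) (extChartAt I x).target := fun y hy =>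
  ((metricForm_isInvertible g hy).contDiffAt_map_inverse).comp_contDiffWithinAt y
    (contDiffOn_metricForm g x y hy)

theorem range_mem_nhds_of_mem_interior_target {x : M} {y : EuclideanSpace ℝ (Fin n)}
    (hy : y ∈ interior (extChartAt I x).target) : range I ∈ 𝓝 y :=
  mem_of_superset (mem_interior_iff_mem_nhds.1 hy) (extChartAt_target_subset_range x)

theorem hasMFDerivAt_extChartAt_symm {x : M} {y : EuclideanSpace ℝ (Fin n)}
    (hy : y ∈ interior (extChartAt I x).target) :
    HasMFDerivAt 𝓘(ℝ, EuclideanSpace ℝ (Fin n)) I (extChartAt I x).symm y (frame I x y) := by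
  have : IsManifold I 1 M := IsManifold.of_le (n := ∞) (by simp)
  have h := (mdifferentiableWithinAt_extChartAt_symm (I := I)
    (interior_subset hy)).hasMFDerivWithinAt
  exact h.hasMFDerivAt (range_mem_nhds_of_mem_interior_target hy)

theorem hasFDerivAt_comp_extChartAt_symm {x : M} {y : EuclideanSpace ℝ (Fin n)}
    (hy : y ∈ interior (extChartAt I x).target) {ρ : M → ℝ}
    (hρ : MDifferentiableAt I 𝓘(ℝ, ℝ) ρ ((extChartAt I x).symm y)) :
    HasFDerivAt (fun y => ρ ((extChartAt I x).symm y))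
      ((mfderiv I 𝓘(ℝ, ℝ) ρ ((extChartAt I x).symm y)).comp (frame I x y)) y := by
  have := hρ.hasMFDerivAt.comp y (hasMFDerivAt_extChartAt_symm hy)
  exact hasMFDerivAt_iff_hasFDerivAt.1 this

end ChartGeometry

section LocalIsometry

variable {n : ℕ} {H₁ H₂ : Type*} [TopologicalSpace H₁] [TopologicalSpace H₂]
  {I₁ : ModelWithCorners ℝ (EuclideanSpace ℝ (Fin n)) H₁}
  {I₂ : ModelWithCorners ℝ (EuclideanSpace ℝ (Fin n)) H₂}
  {M₁ M₂ : Type*} [TopologicalSpace M₁] [ChartedSpace H₁ M₁] [IsManifold I₁ ∞ M₁]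
  [TopologicalSpace M₂] [ChartedSpace H₂ M₂] [IsManifold I₂ ∞ M₂]

/-- The diffeomorphism `φ` between open subsets of two Riemannian manifolds preserves the
metrics. -/
structure IsLocalIsometry (g₁ : Metric I₁ M₁) (g₂ : Metric I₂ M₂)
    (φ : OpenPartialHomeomorph M₁ M₂) : Prop where
  contMDiffOn : ContMDiffOn I₁ I₂ ∞ φ φ.source
  contMDiffOn_symm : ContMDiffOn I₂ I₁ ∞ φ.symm φ.target
  inner_eq : ∀ p ∈ φ.source, ∀ v w : TangentSpace I₁ p,
    g₂.inner (φ p) (mfderiv I₁ I₂ φ p v) (mfderiv I₁ I₂ φ p w) = g₁.inner p v w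

variable {g₁ : Metric I₁ M₁} {g₂ : Metric I₂ M₂} {φ : OpenPartialHomeomorph M₁ M₂}

theorem IsLocalIsometry.refl (g : Metric I₁ M₁) :
    IsLocalIsometry g g (OpenPartialHomeomorph.refl M₁) where
  contMDiffOn := contMDiffOn_id
  contMDiffOn_symm := contMDiffOn_id
  inner_eq p _ v w := by
    have : mfderiv I₁ I₁ (OpenPartialHomeomorph.refl M₁) p = ContinuousLinearMap.id ℝ _ :=
      mfderiv_id
    rw [this]; rfl

theorem IsLocalIsometry.mdifferentiable (h : IsLocalIsometry g₁ g₂ φ) :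
    φ.MDifferentiable I₁ I₂ :=
  ⟨h.contMDiffOn.mdifferentiableOn (by simp), h.contMDiffOn_symm.mdifferentiableOn (by simp)⟩

theorem IsLocalIsometry.symm (h : IsLocalIsometry g₁ g₂ φ) : IsLocalIsometry g₂ g₁ φ.symm where
  contMDiffOn := h.contMDiffOn_symm
  contMDiffOn_symm := by simpa using h.contMDiffOn
  inner_eq q hq v w := by
    have h1 := h.inner_eq (φ.symm q) (φ.map_target hq) (mfderiv I₂ I₁ φ.symm q v)
      (mfderiv I₂ I₁ φ.symm q w)
    rw [← h1]
    have h2 := h.mdifferentiable.comp_symm_deriv hq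
    have e : ∀ v : TangentSpace I₂ q, mfderiv I₁ I₂ φ (φ.symm q) (mfderiv I₂ I₁ φ.symm q v) = v :=
      fun v => congrArg (fun L => L v) h2
    have key : ∀ (q' : M₂) (_ : q' = q) (v w : EuclideanSpace ℝ (Fin n)),
        g₂.inner q' v w = g₂.inner q v w := by
      rintro _ rfl v w; rfl
    rw [e, e]
    exact key _ (φ.right_inv hq) v w

theorem metricForm_mfderiv_extChartAt (g : Metric I₁ M₁) {x q : M₁}
    (hq : q ∈ (extChartAt I₁ x).source) (v w : TangentSpace I₁ q) :
    metricForm g x (extChartAt I₁ x q) (mfderiv I₁ 𝓘(ℝ, EuclideanSpace ℝ (Fin n))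
      (extChartAt I₁ x) q v) (mfderiv I₁ 𝓘(ℝ, EuclideanSpace ℝ (Fin n)) (extChartAt I₁ x) q w) =
      g.inner q v w := by
  have : IsManifold I₁ 1 M₁ := IsManifold.of_le (n := ∞) (by simp)
  have h := mfderivWithin_extChartAt_symm_comp_mfderiv_extChartAt' (I := I₁) hq
  have e : ∀ v : TangentSpace I₁ q, frame I₁ x (extChartAt I₁ x q)
      (mfderiv I₁ 𝓘(ℝ, EuclideanSpace ℝ (Fin n)) (extChartAt I₁ x) q v) = v :=
    fun v => congrArg (fun L => L v) h
  have key : ∀ (q' : M₁) (_ : q' = q) (v w : EuclideanSpace ℝ (Fin n)),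
      g.inner q' v w = g.inner q v w := by
    rintro _ rfl v w; rfl
  exact (congrArg₂ (fun a b => g.inner ((extChartAt I₁ x).symm (extChartAt I₁ x q)) a b)
    (e v) (e w)).trans (key _ ((extChartAt I₁ x).left_inv hq) v w)

/-- The coordinate expression of `φ`. -/
noncomputable def transition (I₁ : ModelWithCorners ℝ (EuclideanSpace ℝ (Fin n)) H₁)
    (I₂ : ModelWithCorners ℝ (EuclideanSpace ℝ (Fin n)) H₂)
    (φ : OpenPartialHomeomorph M₁ M₂) (x₁ : M₁) (x₂ : M₂) (y : EuclideanSpace ℝ (Fin n)) :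
    EuclideanSpace ℝ (Fin n) :=
  extChartAt I₂ x₂ (φ ((extChartAt I₁ x₁).symm y))

/-- The differential of the coordinate expression of `φ`. -/
noncomputable def transitionDeriv (I₁ : ModelWithCorners ℝ (EuclideanSpace ℝ (Fin n)) H₁)
    (I₂ : ModelWithCorners ℝ (EuclideanSpace ℝ (Fin n)) H₂)
    (φ : OpenPartialHomeomorph M₁ M₂) (x₁ : M₁) (x₂ : M₂) (y : EuclideanSpace ℝ (Fin n)) :
    EuclideanSpace ℝ (Fin n) →L[ℝ] EuclideanSpace ℝ (Fin n) :=
  (mfderiv I₂ 𝓘(ℝ, EuclideanSpace ℝ (Fin n)) (extChartAt I₂ x₂)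
    (φ ((extChartAt I₁ x₁).symm y))).comp
    ((mfderiv I₁ I₂ φ ((extChartAt I₁ x₁).symm y)).comp (frame I₁ x₁ y))

/-- The domain of the coordinate expression of `φ`. -/
def transitionDomain (I₁ : ModelWithCorners ℝ (EuclideanSpace ℝ (Fin n)) H₁)
    (I₂ : ModelWithCorners ℝ (EuclideanSpace ℝ (Fin n)) H₂)
    (φ : OpenPartialHomeomorph M₁ M₂) (x₁ : M₁) (x₂ : M₂) : Set (EuclideanSpace ℝ (Fin n)) :=
  {y | y ∈ (extChartAt I₁ x₁).target ∧ (extChartAt I₁ x₁).symm y ∈ φ.source ∧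
    φ ((extChartAt I₁ x₁).symm y) ∈ (extChartAt I₂ x₂).source}

variable {x₁ : M₁} {x₂ : M₂} {y : EuclideanSpace ℝ (Fin n)}

theorem IsLocalIsometry.hasFDerivWithinAt_transition (h : IsLocalIsometry g₁ g₂ φ)
    (hy : y ∈ transitionDomain I₁ I₂ φ x₁ x₂) :
    HasFDerivWithinAt (transition I₁ I₂ φ x₁ x₂) (transitionDeriv I₁ I₂ φ x₁ x₂ y) (range I₁) y := by
  have : IsManifold I₁ 1 M₁ := IsManifold.of_le (n := ∞) (by simp)
  have : IsManifold I₂ 1 M₂ := IsManifold.of_le (n := ∞) (by simp)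
  obtain ⟨hy1, hy2, hy3⟩ := hy
  have d1 : HasMFDerivWithinAt 𝓘(ℝ, EuclideanSpace ℝ (Fin n)) I₁ (extChartAt I₁ x₁).symm
      (range I₁) y (frame I₁ x₁ y) :=
    (mdifferentiableWithinAt_extChartAt_symm hy1).hasMFDerivWithinAt
  have d2 := (h.mdifferentiable.mdifferentiableAt hy2).hasMFDerivAt
  have d3 := (mdifferentiableAt_extChartAt (I := I₂) (x := x₂)
    (by simpa using hy3)).hasMFDerivAt
  have := (d3.comp ((extChartAt I₁ x₁).symm y) d2).comp_hasMFDerivWithinAt y d1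
  exact hasMFDerivWithinAt_iff_hasFDerivWithinAt.1 this

theorem IsLocalIsometry.metricForm_transition (h : IsLocalIsometry g₁ g₂ φ)
    (hy : y ∈ transitionDomain I₁ I₂ φ x₁ x₂) (v w : EuclideanSpace ℝ (Fin n)) :
    metricForm g₂ x₂ (transition I₁ I₂ φ x₁ x₂ y) (transitionDeriv I₁ I₂ φ x₁ x₂ y v)
      (transitionDeriv I₁ I₂ φ x₁ x₂ y w) = metricForm g₁ x₁ y v w := by
  have h1 := metricForm_mfderiv_extChartAt g₂ hy.2.2
    (mfderiv I₁ I₂ φ ((extChartAt I₁ x₁).symm y) (frame I₁ x₁ y v))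
    (mfderiv I₁ I₂ φ ((extChartAt I₁ x₁).symm y) (frame I₁ x₁ y w))
  exact h1.trans (h.inner_eq _ hy.2.1 _ _)

theorem IsLocalIsometry.density_eq (h : IsLocalIsometry g₁ g₂ φ)
    (hy : y ∈ transitionDomain I₁ I₂ φ x₁ x₂) :
    density g₁ x₁ y = |(transitionDeriv I₁ I₂ φ x₁ x₂ y).det| *
      density g₂ x₂ (transition I₁ I₂ φ x₁ x₂ y) := by
  set D := transitionDeriv I₁ I₂ φ x₁ x₂ y with hD
  set z := transition I₁ I₂ φ x₁ x₂ y with hz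
  let Q : Matrix (Fin n) (Fin n) ℝ := Matrix.of fun k i => D (EuclideanSpace.single i 1) k
  have hQdet : Q.det = D.det := by
    have : Q = LinearMap.toMatrix (EuclideanSpace.basisFun (Fin n) ℝ).toBasis
        (EuclideanSpace.basisFun (Fin n) ℝ).toBasis D.toLinearMap := by
      ext k i
      simp [Q, LinearMap.toMatrix_apply]
    rw [this, LinearMap.det_toMatrix]
  have hgram : gramMatrix g₁ x₁ y = Q.transpose * gramMatrix g₂ x₂ z * Q := by
    ext i j
    rw [gramMatrix_apply, ← h.metricForm_transition hy, ← hD, ← hz]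
    conv_lhs => rw [← sum_single_eq (D (EuclideanSpace.single i 1)),
      ← sum_single_eq (D (EuclideanSpace.single j 1))]
    simp only [map_sum, map_smul, sum_apply, smul_apply, smul_eq_mul, Matrix.mul_apply,
      Matrix.transpose_apply, gramMatrix_apply, Q, Matrix.of_apply, Finset.mul_sum, Finset.sum_mul]
    refine Finset.sum_congr rfl fun k _ => Finset.sum_congr rfl fun l _ => ?_
    ring
  have hdet : (gramMatrix g₁ x₁ y).det = D.det ^ 2 * (gramMatrix g₂ x₂ z).det := by
    rw [hgram, Matrix.det_mul, Matrix.det_mul, Matrix.det_transpose, hQdet]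
    ring
  rw [density, density, hdet, Real.sqrt_mul (sq_nonneg _), Real.sqrt_sq_eq_abs]

theorem IsLocalIsometry.det_transitionDeriv_ne_zero (h : IsLocalIsometry g₁ g₂ φ)
    (hy : y ∈ transitionDomain I₁ I₂ φ x₁ x₂) : (transitionDeriv I₁ I₂ φ x₁ x₂ y).det ≠ 0 := by
  intro h0
  have h1 := h.density_eq hy
  rw [h0, abs_zero, zero_mul] at h1
  exact (density_pos g₁ hy.1).ne' h1

theorem injOn_transition : InjOn (transition I₁ I₂ φ x₁ x₂) (transitionDomain I₁ I₂ φ x₁ x₂) := by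
  intro y hy z hz hyz
  have h1 := (extChartAt I₂ x₂).injOn hy.2.2 hz.2.2 hyz
  have h2 := φ.injOn hy.2.1 hz.2.1 h1
  exact (extChartAt I₁ x₁).symm.injOn hy.1 hz.1 h2

end LocalIsometry

section PartialEquivMeasure

variable {α β : Type*} [TopologicalSpace α] [MeasurableSpace α] [BorelSpace α]
  [TopologicalSpace β] [MeasurableSpace β] [BorelSpace β] {F : Type*} [NormedAddCommGroup F]

theorem measurableSet_inter_preimage {f : α → β} {s : Set α} (hs : MeasurableSet s)
    (hf : ContinuousOn f s) {A : Set β} (hA : MeasurableSet A) : MeasurableSet (s ∩ f ⁻¹' A) := by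
  have h1 := hs.subtype_image ((continuousOn_iff_continuous_domRestrict.1 hf).measurable hA)
  convert h1 using 1
  ext p
  simp [and_comm]

/-- A homeomorphism between two measurable sets carrying the measure `μ` to the measure `ν`. -/
structure IsMeasureIso (e : PartialEquiv α β) (μ : Measure α) (ν : Measure β) : Prop where
  source : MeasurableSet e.source
  target : MeasurableSet e.target
  continuousOn : ContinuousOn e e.source
  continuousOn_symm : ContinuousOn e.symm e.target
  measure_eq : ∀ A, MeasurableSet A → A ⊆ e.target → ν A = μ (e.source ∩ e ⁻¹' A)

variable {e : PartialEquiv α β} {μ : Measure α} {ν : Measure β}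

theorem IsMeasureIso.measurableEmbedding (h : IsMeasureIso e μ ν) :
    MeasurableEmbedding (fun p : e.source => e p) where
  injective := fun p q hpq => Subtype.ext (e.injOn p.2 q.2 hpq)
  measurable := (continuousOn_iff_continuous_domRestrict.1 h.continuousOn).measurable
  measurableSet_image' := by
    intro s hs
    have h1 := measurableSet_inter_preimage h.target h.continuousOn_symm
      (h.source.subtype_image hs)
    convert h1 using 1
    ext q
    constructor
    · rintro ⟨p, hp, rfl⟩
      exact ⟨e.map_source p.2, p, hp, (e.left_inv p.2).symm⟩
    · rintro ⟨hq, p, hp, hpq⟩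
      exact ⟨p, hp, by simp only [hpq, e.right_inv hq]⟩

theorem IsMeasureIso.map_eq (h : IsMeasureIso e μ ν) :
    (μ.comap (Subtype.val : e.source → α)).map (fun p : e.source => e p) =
      ν.restrict e.target := by
  ext A hA
  rw [h.measurableEmbedding.map_apply, Measure.restrict_apply hA,
    (MeasurableEmbedding.subtype_coe h.source).comap_apply, h.measure_eq _ (hA.inter h.target)
    inter_subset_right]
  congr 1
  ext p
  constructor
  · rintro ⟨p, hp, rfl⟩
    exact ⟨p.2, hp, e.map_source p.2⟩
  · rintro ⟨hp, hpA, -⟩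
    exact ⟨⟨p, hp⟩, hpA, rfl⟩

theorem IsMeasureIso.setIntegral_eq [NormedSpace ℝ F] (h : IsMeasureIso e μ ν) (f : β → F) :
    ∫ q in e.target, f q ∂ν = ∫ p in e.source, f (e p) ∂μ := by
  rw [← h.map_eq, h.measurableEmbedding.integral_map,
    ← integral_subtype_comap h.source (fun p => f (e p))]

theorem IsMeasureIso.integrableOn_iff (h : IsMeasureIso e μ ν) (f : β → F) :
    IntegrableOn f e.target ν ↔ IntegrableOn (fun p => f (e p)) e.source μ := by
  rw [IntegrableOn, ← h.map_eq, h.measurableEmbedding.integrable_map_iff,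
    integrableOn_iff_comap_subtypeVal h.source]
  rfl

theorem restrict_eq_of_locally [SecondCountableTopology α] {μ ν : Measure α} {U : Set α}
    (h : ∀ p ∈ U, ∃ V ∈ 𝓝 p, μ.restrict V = ν.restrict V) : μ.restrict U = ν.restrict U := by
  classical
  choose! V hV hVe using h
  obtain ⟨t, htU, htc, ht⟩ := TopologicalSpace.countable_cover_nhdsWithin
    (f := V) (s := U) fun p hp => mem_nhdsWithin_of_mem_nhds (hV p hp)
  have h1 : μ.restrict (⋃ p ∈ t, V p) = ν.restrict (⋃ p ∈ t, V p) :=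
    (Measure.restrict_biUnion_congr htc).2 fun p hp => hVe p (htU hp)
  rw [← Measure.restrict_restrict_of_subset ht, h1, Measure.restrict_restrict_of_subset ht]

end PartialEquivMeasure

section Volume

variable {n : ℕ} {H : Type*} [TopologicalSpace H]
  {I : ModelWithCorners ℝ (EuclideanSpace ℝ (Fin n)) H}
  {M : Type*} [TopologicalSpace M] [ChartedSpace H M]

theorem measurableSet_extChartAt_target (x : M) : MeasurableSet (extChartAt I x).target := by
  rw [extChartAt_target]
  exact ((chartAt H x).open_target.preimage I.continuous_symm).measurableSet.inter
    I.isClosed_range.measurableSet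

variable [IsManifold I ∞ M] [MeasurableSpace M] [BorelSpace M]

theorem aemeasurable_density (g : Metric I M) (x : M) :
    AEMeasurable (fun y => ENNReal.ofReal (density g x y))
      (volume.restrict (extChartAt I x).target) :=
  ((contDiffOn_density g x).continuousOn.aemeasurable
    (measurableSet_extChartAt_target x)).ennreal_ofReal

theorem chartVolume_apply (g : Metric I M) (x : M) {A : Set M} (hA : MeasurableSet A) :
    chartVolume g x A = ∫⁻ y in (extChartAt I x).target ∩ (extChartAt I x).symm ⁻¹' A,
      ENNReal.ofReal (density g x y) := by
  have hm := measurableSet_inter_preimage (measurableSet_extChartAt_target (I := I) x)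
    (continuousOn_extChartAt_symm x) hA
  have hT := measurableSet_extChartAt_target (I := I) x
  have hmeas : AEMeasurable (extChartAt I x).symm
      ((volume.restrict (extChartAt I x).target).withDensity
        fun y => ENNReal.ofReal (Real.sqrt (gramMatrix g x y).det)) :=
    ((continuousOn_extChartAt_symm x).aemeasurable hT).mono_ac
      (withDensity_absolutelyContinuous _ _)
  rw [chartVolume, Measure.map_apply_of_aemeasurable hmeas hA]
  have hnull : ((volume.restrict (extChartAt I x).target).withDensity
        fun y => ENNReal.ofReal (Real.sqrt (gramMatrix g x y).det))
      ((extChartAt I x).symm ⁻¹' A) = ((volume.restrict (extChartAt I x).target).withDensity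
        fun y => ENNReal.ofReal (Real.sqrt (gramMatrix g x y).det))
      ((extChartAt I x).target ∩ (extChartAt I x).symm ⁻¹' A) := by
    refine measure_congr ((withDensity_absolutelyContinuous _ _).ae_le ?_)
    filter_upwards [ae_restrict_mem hT] with y hy
    exact propext ⟨fun h => ⟨hy, h⟩, fun h => h.2⟩
  rw [hnull, withDensity_apply _ hm, Measure.restrict_restrict_of_subset inter_subset_left]
  rfl

theorem chartVolume_eq_inter_source (g : Metric I M) (x : M) {A : Set M} (hA : MeasurableSet A) :
    chartVolume g x A = chartVolume g x (A ∩ (extChartAt I x).source) := by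
  rw [chartVolume_apply g x hA,
    chartVolume_apply g x (hA.inter (isOpen_extChartAt_source x).measurableSet)]
  congr 2
  ext y
  exact ⟨fun h => ⟨h.1, h.2, (extChartAt I x).map_target h.1⟩, fun h => ⟨h.1, h.2.1⟩⟩

end Volume

section VolumeIsometry

variable {n : ℕ} {H₁ H₂ : Type*} [TopologicalSpace H₁] [TopologicalSpace H₂]
  {I₁ : ModelWithCorners ℝ (EuclideanSpace ℝ (Fin n)) H₁}
  {I₂ : ModelWithCorners ℝ (EuclideanSpace ℝ (Fin n)) H₂}
  {M₁ M₂ : Type*} [TopologicalSpace M₁] [ChartedSpace H₁ M₁] [IsManifold I₁ ∞ M₁]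
  [TopologicalSpace M₂] [ChartedSpace H₂ M₂] [IsManifold I₂ ∞ M₂]
  [MeasurableSpace M₁] [BorelSpace M₁] [MeasurableSpace M₂] [BorelSpace M₂]
  {g₁ : Metric I₁ M₁} {g₂ : Metric I₂ M₂} {φ : OpenPartialHomeomorph M₁ M₂}

theorem IsLocalIsometry.chartVolume_eq (h : IsLocalIsometry g₁ g₂ φ) (x₁ : M₁) (x₂ : M₂)
    {A : Set M₂} (hA : MeasurableSet A) (hA₁ : A ⊆ φ.target) (hA₂ : A ⊆ (extChartAt I₂ x₂).source)
    (hA₃ : φ.source ∩ φ ⁻¹' A ⊆ (extChartAt I₁ x₁).source) :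
    chartVolume g₂ x₂ A = chartVolume g₁ x₁ (φ.source ∩ φ ⁻¹' A) := by
  have hB := measurableSet_inter_preimage φ.open_source.measurableSet φ.continuousOn hA
  have hS := measurableSet_inter_preimage (measurableSet_extChartAt_target (I := I₁) x₁)
    (continuousOn_extChartAt_symm x₁) hB
  have hsub : (extChartAt I₁ x₁).target ∩ (extChartAt I₁ x₁).symm ⁻¹' (φ.source ∩ φ ⁻¹' A) ⊆
      transitionDomain I₁ I₂ φ x₁ x₂ := fun y hy => ⟨hy.1, hy.2.1, hA₂ hy.2.2⟩
  have himg : (extChartAt I₂ x₂).target ∩ (extChartAt I₂ x₂).symm ⁻¹' A =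
      transition I₁ I₂ φ x₁ x₂ ''
        ((extChartAt I₁ x₁).target ∩ (extChartAt I₁ x₁).symm ⁻¹' (φ.source ∩ φ ⁻¹' A)) := by
    ext z
    constructor
    · rintro ⟨hz1, hz2⟩
      have e1 : φ (φ.symm ((extChartAt I₂ x₂).symm z)) = (extChartAt I₂ x₂).symm z :=
        φ.right_inv (hA₁ hz2)
      have hs : φ.symm ((extChartAt I₂ x₂).symm z) ∈ φ.source ∩ φ ⁻¹' A :=
        ⟨φ.map_target (hA₁ hz2), by rw [mem_preimage, e1]; exact hz2⟩
      have e2 : (extChartAt I₁ x₁).symm (extChartAt I₁ x₁ (φ.symm ((extChartAt I₂ x₂).symm z))) =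
        φ.symm ((extChartAt I₂ x₂).symm z) := (extChartAt I₁ x₁).left_inv (hA₃ hs)
      refine ⟨extChartAt I₁ x₁ (φ.symm ((extChartAt I₂ x₂).symm z)),
        ⟨(extChartAt I₁ x₁).map_source (hA₃ hs), ?_⟩, ?_⟩
      · rw [mem_preimage, e2]; exact hs
      · rw [transition, e2, e1, (extChartAt I₂ x₂).right_inv hz1]
    · rintro ⟨y, hy, rfl⟩
      refine ⟨(extChartAt I₂ x₂).map_source (hA₂ hy.2.2), ?_⟩
      rw [mem_preimage, transition, (extChartAt I₂ x₂).left_inv (hA₂ hy.2.2)]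
      exact hy.2.2
  rw [chartVolume_apply g₂ x₂ hA, chartVolume_apply g₁ x₁ hB, himg,
    lintegral_image_eq_lintegral_abs_det_fderiv_mul volume hS
      (fun y hy => (h.hasFDerivWithinAt_transition (hsub hy)).mono fun z hz =>
        extChartAt_target_subset_range x₁ hz.1) (injOn_transition.mono hsub)]
  refine setLIntegral_congr_fun hS fun y hy => ?_
  rw [← ENNReal.ofReal_mul (abs_nonneg _), h.density_eq (hsub hy)]

end VolumeIsometry

section VolumeMeasure

variable {n : ℕ} {H : Type*} [TopologicalSpace H]
  {I : ModelWithCorners ℝ (EuclideanSpace ℝ (Fin n)) H}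
  {M : Type*} [TopologicalSpace M] [ChartedSpace H M]
  [IsManifold I ∞ M] [MeasurableSpace M] [BorelSpace M]

theorem chartVolume_eq_chartVolume (g : Metric I M) (x₁ x₂ : M) {A : Set M} (hA : MeasurableSet A)
    (h₁ : A ⊆ (extChartAt I x₁).source) (h₂ : A ⊆ (extChartAt I x₂).source) :
    chartVolume g x₁ A = chartVolume g x₂ A := by
  have := (IsLocalIsometry.refl g).chartVolume_eq x₁ x₂ hA (subset_univ _) h₂ (by simpa using h₁)
  simpa using this.symm

variable [SecondCountableTopology M]

theorem volumeMeasure_eq_chartVolume (g : Metric I M) (x : M) {A : Set M} (hA : MeasurableSet A)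
    (h : A ⊆ (extChartAt I x).source) : volumeMeasure g A = chartVolume g x A := by
  obtain ⟨t, htc, ht⟩ := TopologicalSpace.countable_cover_nhds
    (fun p : M => extChartAt_source_mem_nhds (I := I) p)
  have hne : t.Nonempty := by
    by_contra hne
    rw [not_nonempty_iff_eq_empty] at hne
    subst hne
    have : x ∈ (univ : Set M) := mem_univ x
    rw [← ht] at this
    simp at this
  obtain ⟨z, hz⟩ := htc.exists_eq_range hne
  have hcov : ⋃ k, (extChartAt I (z k)).source = univ := by
    rw [← ht, hz, biUnion_range]
  set D : ℕ → Set M := disjointed fun k => (extChartAt I (z k)).source with hD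
  have hDm : ∀ k, MeasurableSet (D k) := fun k =>
    MeasurableSet.disjointed (fun k => (isOpen_extChartAt_source (z k)).measurableSet) k
  have hDd : Pairwise (Function.onFun Disjoint D) := disjoint_disjointed _
  have hDs : ∀ k, D k ⊆ (extChartAt I (z k)).source := fun k => disjointed_subset _ k
  have hDu : ⋃ k, D k = univ := by rw [hD, iUnion_disjointed, hcov]
  set ν : Measure M := Measure.sum fun k => (chartVolume g (z k)).restrict (D k) with hν
  have key : ∀ (w : M) (B : Set M), MeasurableSet B → B ⊆ (extChartAt I w).source →
      ν B = chartVolume g w B := by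
    intro w B hB hBw
    have h1 : chartVolume g w B = ∑' k, chartVolume g w (B ∩ D k) := by
      rw [← measure_iUnion (fun i j hij => (hDd hij).mono inter_subset_right inter_subset_right)
        (fun k => hB.inter (hDm k)), ← inter_iUnion, hDu, inter_univ]
    rw [h1, hν, Measure.sum_apply _ hB]
    refine tsum_congr fun k => ?_
    rw [Measure.restrict_apply hB]
    exact chartVolume_eq_chartVolume g _ _ (hB.inter (hDm k))
      (inter_subset_right.trans (hDs k)) (inter_subset_left.trans hBw)
  have hle : volumeMeasure g ≤ ν := by
    refine iSup_le fun w => Measure.le_iff.2 fun B hB => ?_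
    have hBm := hB.inter (isOpen_extChartAt_source (I := I) w).measurableSet
    rw [chartVolume_eq_inter_source g w hB, ← key w _ hBm inter_subset_right]
    exact measure_mono inter_subset_left
  refine le_antisymm ((hle A).trans (key x A hA h).le) ?_
  exact (le_iSup (chartVolume g) x : chartVolume g x ≤ volumeMeasure g) A

/-- The measure in the chart around `x` that corresponds to the Riemannian volume. -/
noncomputable def coordMeasure (g : Metric I M) (x : M) : Measure (EuclideanSpace ℝ (Fin n)) :=
  (volume.restrict (extChartAt I x).target).withDensity fun y => ENNReal.ofReal (density g x y)

theorem isMeasureIso_chart (g : Metric I M) (x : M) :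
    IsMeasureIso (extChartAt I x).symm (coordMeasure g x) (volumeMeasure g) where
  source := measurableSet_extChartAt_target x
  target := (isOpen_extChartAt_source x).measurableSet
  continuousOn := continuousOn_extChartAt_symm x
  continuousOn_symm := by simpa using continuousOn_extChartAt x
  measure_eq A hA hAs := by
    have hm := measurableSet_inter_preimage (measurableSet_extChartAt_target (I := I) x)
      (continuousOn_extChartAt_symm x) hA
    rw [volumeMeasure_eq_chartVolume g x hA hAs, chartVolume_apply g x hA, coordMeasure]
    refine Eq.trans ?_ (withDensity_apply _ hm).symm
    rw [Measure.restrict_restrict_of_subset inter_subset_left]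

theorem setIntegral_volumeMeasure (g : Metric I M) (x : M) (f : M → ℝ) :
    ∫ p in (extChartAt I x).source, f p ∂(volumeMeasure g) =
      ∫ y in (extChartAt I x).target, density g x y * f ((extChartAt I x).symm y) := by
  have hT := measurableSet_extChartAt_target (I := I) x
  refine ((isMeasureIso_chart g x).setIntegral_eq f).trans ?_
  change ∫ y in (extChartAt I x).target, f ((extChartAt I x).symm y) ∂(coordMeasure g x) = _
  rw [coordMeasure, setIntegral_withDensity_eq_setIntegral_toReal_smul₀ _ _ _ hT,
    Measure.restrict_restrict_of_subset Subset.rfl]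
  · refine setIntegral_congr_fun hT fun y hy => ?_
    simp [ENNReal.toReal_ofReal (density_pos g hy).le]
  · rw [Measure.restrict_restrict_of_subset Subset.rfl]
    exact aemeasurable_density g x
  · exact Eventually.of_forall fun y => ENNReal.ofReal_lt_top

theorem integrableOn_volumeMeasure_iff (g : Metric I M) (x : M) (f : M → ℝ) :
    IntegrableOn f (extChartAt I x).source (volumeMeasure g) ↔
      IntegrableOn (fun y => density g x y * f ((extChartAt I x).symm y))
        (extChartAt I x).target := by
  have hT := measurableSet_extChartAt_target (I := I) x
  refine ((isMeasureIso_chart g x).integrableOn_iff f).trans ?_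
  change IntegrableOn (fun y => f ((extChartAt I x).symm y)) (extChartAt I x).target
    (coordMeasure g x) ↔ _
  rw [IntegrableOn, coordMeasure, restrict_withDensity hT,
    Measure.restrict_restrict_of_subset Subset.rfl,
    integrable_withDensity_iff_integrable_smul₀' (aemeasurable_density g x)
      (Eventually.of_forall fun y => ENNReal.ofReal_lt_top)]
  refine integrable_congr ?_
  filter_upwards [ae_restrict_mem hT] with y hy
  simp [ENNReal.toReal_ofReal (density_pos g hy).le]

theorem isLocallyFiniteMeasure_volumeMeasure [T2Space M] (g : Metric I M) :
    IsLocallyFiniteMeasure (volumeMeasure g) := by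
  refine ⟨fun x => ?_⟩
  have : LocallyCompactSpace M := Manifold.locallyCompact_of_finiteDimensional I
  obtain ⟨C, hC, hCs, hCc⟩ := local_compact_nhds (extChartAt_source_mem_nhds (I := I) x)
  refine ⟨C, hC, ?_⟩
  have hsub : (extChartAt I x).target ∩ (extChartAt I x).symm ⁻¹' C ⊆ extChartAt I x '' C :=
    fun y hy => ⟨_, hy.2, (extChartAt I x).right_inv hy.1⟩
  have hKT : extChartAt I x '' C ⊆ (extChartAt I x).target := by
    rintro _ ⟨p, hp, rfl⟩
    exact (extChartAt I x).map_source (hCs hp)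
  have hK : IsCompact (extChartAt I x '' C) :=
    hCc.image_of_continuousOn ((continuousOn_extChartAt x).mono hCs)
  have hint : IntegrableOn (density g x) (extChartAt I x '' C) :=
    ((contDiffOn_density g x).continuousOn.mono hKT).integrableOn_compact hK
  rw [volumeMeasure_eq_chartVolume g x hCc.measurableSet hCs,
    chartVolume_apply g x hCc.measurableSet]
  exact (lintegral_mono_set hsub).trans_lt hint.lintegral_lt_top

end VolumeMeasure

section VolumeIsometry

variable {n : ℕ} {H₁ H₂ : Type*} [TopologicalSpace H₁] [TopologicalSpace H₂]
  {I₁ : ModelWithCorners ℝ (EuclideanSpace ℝ (Fin n)) H₁}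
  {I₂ : ModelWithCorners ℝ (EuclideanSpace ℝ (Fin n)) H₂}
  {M₁ M₂ : Type*} [TopologicalSpace M₁] [ChartedSpace H₁ M₁] [IsManifold I₁ ∞ M₁]
  [TopologicalSpace M₂] [ChartedSpace H₂ M₂] [IsManifold I₂ ∞ M₂]
  [MeasurableSpace M₁] [BorelSpace M₁] [MeasurableSpace M₂] [BorelSpace M₂]
  [SecondCountableTopology M₁] [SecondCountableTopology M₂]
  {g₁ : Metric I₁ M₁} {g₂ : Metric I₂ M₂} {φ : OpenPartialHomeomorph M₁ M₂}

theorem IsLocalIsometry.isMeasureIso (h : IsLocalIsometry g₁ g₂ φ) :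
    IsMeasureIso φ.toPartialEquiv (volumeMeasure g₁) (volumeMeasure g₂) where
  source := φ.open_source.measurableSet
  target := φ.open_target.measurableSet
  continuousOn := φ.continuousOn
  continuousOn_symm := φ.continuousOn_symm
  measure_eq A hA hAs := by
    have hmeas : AEMeasurable φ ((volumeMeasure g₁).restrict φ.source) :=
      φ.continuousOn.aemeasurable φ.open_source.measurableSet
    set ν := ((volumeMeasure g₁).restrict φ.source).map φ with hν
    have hνA : ∀ B, MeasurableSet B → ν B = volumeMeasure g₁ (φ.source ∩ φ ⁻¹' B) := by
      intro B hB
      rw [hν, Measure.map_apply_of_aemeasurable hmeas hB,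
        Measure.restrict_apply₀' φ.open_source.measurableSet.nullMeasurableSet, inter_comm]
    have key : (volumeMeasure g₂).restrict φ.target = ν.restrict φ.target := by
      refine restrict_eq_of_locally fun q hq => ?_
      set V := (φ.target ∩ φ.symm ⁻¹' (extChartAt I₁ (φ.symm q)).source) ∩
        (extChartAt I₂ q).source with hV
      have hVo : IsOpen V := (φ.isOpen_inter_preimage_symm
        (isOpen_extChartAt_source _)).inter (isOpen_extChartAt_source _)
      refine ⟨V, hVo.mem_nhds ⟨⟨hq, mem_extChartAt_source _⟩, mem_extChartAt_source _⟩, ?_⟩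
      ext B hB
      rw [Measure.restrict_apply hB, Measure.restrict_apply hB]
      have hBV := hB.inter hVo.measurableSet
      have hs1 : B ∩ V ⊆ φ.target := fun z hz => hz.2.1.1
      have hs2 : B ∩ V ⊆ (extChartAt I₂ q).source := fun z hz => hz.2.2
      have hs3 : φ.source ∩ φ ⁻¹' (B ∩ V) ⊆ (extChartAt I₁ (φ.symm q)).source := by
        intro z hz
        have := hz.2.2.1.2
        rwa [mem_preimage, φ.left_inv hz.1] at this
      rw [hνA _ hBV, volumeMeasure_eq_chartVolume g₂ q hBV hs2,
        volumeMeasure_eq_chartVolume g₁ (φ.symm q) (measurableSet_inter_preimage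
          φ.open_source.measurableSet φ.continuousOn hBV) hs3]
      exact h.chartVolume_eq _ _ hBV hs1 hs2 hs3
    refine Eq.trans ?_ (hνA A hA)
    rw [← Measure.restrict_eq_self _ hAs, key, Measure.restrict_eq_self _ hAs]

end VolumeIsometry

section WeakDifferential

variable {n : ℕ} {H : Type*} [TopologicalSpace H]
  {I : ModelWithCorners ℝ (EuclideanSpace ℝ (Fin n)) H}
  {M : Type*} [TopologicalSpace M] [ChartedSpace H M]

/-- The coordinates, in the chart around `x`, of the interior points of `M` in `U`. -/
def chartDomain (I : ModelWithCorners ℝ (EuclideanSpace ℝ (Fin n)) H) (x : M) (U : Set M) :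
    Set (EuclideanSpace ℝ (Fin n)) :=
  interior (extChartAt I x).target ∩ (extChartAt I x).symm ⁻¹' U

theorem isOpen_chartDomain (x : M) {U : Set M} (hU : IsOpen U) : IsOpen (chartDomain I x U) :=
  ((continuousOn_extChartAt_symm x).mono interior_subset).isOpen_inter_preimage isOpen_interior hU

theorem chartDomain_univ (x : M) : chartDomain I x univ = interior (extChartAt I x).target := by
  simp [chartDomain]

/-- The covector field `θ` is the weak differential of `u` on the interior points of `U`, and it
is locally square integrable there. -/
def HasWeakDiffOn (I : ModelWithCorners ℝ (EuclideanSpace ℝ (Fin n)) H) (U : Set M) (u : M → ℝ)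
    (θ : ∀ p : M, TangentSpace I p →L[ℝ] ℝ) : Prop :=
  ∀ x : M, IsWeakDiffOn (chartDomain I x U) (fun y => u ((extChartAt I x).symm y))
    (fun y => (θ ((extChartAt I x).symm y)).comp (frame I x y))

variable {U V : Set M} {u w : M → ℝ} {θ η : ∀ p : M, TangentSpace I p →L[ℝ] ℝ}

theorem HasWeakDiffOn.mono (h : HasWeakDiffOn I U u θ) (hV : V ⊆ U) : HasWeakDiffOn I V u θ :=
  fun x => (h x).mono fun _ hy => ⟨hy.1, hV hy.2⟩

theorem HasWeakDiffOn.congr (h : HasWeakDiffOn I U u θ) (hu : EqOn u w U)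
    (hθ : ∀ p ∈ U, θ p = η p) : HasWeakDiffOn I U w η :=
  fun x => (h x).congr (fun _ hy => hu hy.2) (Eventually.of_forall fun y hy => by
    simp only [hθ _ hy.2])

theorem HasWeakDiffOn.of_local
    (h : ∀ p ∈ U, ∃ V, IsOpen V ∧ p ∈ V ∧ HasWeakDiffOn I V u θ) : HasWeakDiffOn I U u θ := by
  intro x
  refine IsWeakDiffOn.of_local fun y hy => ?_
  obtain ⟨V, hV, hpV, hw⟩ := h _ hy.2
  exact ⟨chartDomain I x V, isOpen_chartDomain x hV, ⟨hy.1, hpV⟩, hw x⟩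

theorem HasWeakDiffOn.comp₂ (hU : IsOpen U) (hu : HasWeakDiffOn I U u θ)
    (hw : HasWeakDiffOn I U w η) {Φ : ℝ × ℝ → ℝ} (hΦ : ContDiff ℝ ∞ Φ) :
    HasWeakDiffOn I U (fun p => Φ (u p, w p)) (fun p => fderiv ℝ Φ (u p, w p) (1, 0) • θ p +
      fderiv ℝ Φ (u p, w p) (0, 1) • η p) :=
  fun x => ((hu x).comp₂ (isOpen_chartDomain x hU) (hw x) hΦ).congr (fun _ _ => rfl)
    (Eventually.of_forall fun _ _ => rfl)

theorem HasWeakDiffOn.comp (hU : IsOpen U) (hu : HasWeakDiffOn I U u θ) {Φ : ℝ → ℝ}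
    (hΦ : ContDiff ℝ ∞ Φ) :
    HasWeakDiffOn I U (fun p => Φ (u p)) (fun p => deriv Φ (u p) • θ p) := by
  have h := hu.comp₂ hU hu (Φ := fun q => Φ q.1) (hΦ.comp contDiff_fst)
  refine h.congr (fun _ _ => rfl) fun p _ => ?_
  have hd : HasFDerivAt (fun q : ℝ × ℝ => Φ q.1)
      ((deriv Φ (u p)) • ContinuousLinearMap.fst ℝ ℝ ℝ) (u p, u p) :=
    ((hΦ.differentiable (by simp) (u p)).hasDerivAt.comp_hasFDerivAt (u p, u p)
      (f := Prod.fst) hasFDerivAt_fst)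
  rw [hd.fderiv]
  simp

theorem HasWeakDiffOn.mul (hU : IsOpen U) (hu : HasWeakDiffOn I U u θ)
    (hw : HasWeakDiffOn I U w η) :
    HasWeakDiffOn I U (fun p => u p * w p) (fun p => w p • θ p + u p • η p) := by
  have h := hu.comp₂ hU hw (Φ := fun q => q.1 * q.2) (contDiff_fst.mul contDiff_snd)
  refine h.congr (fun _ _ => rfl) fun p _ => ?_
  have hd : HasFDerivAt (fun q : ℝ × ℝ => q.1 * q.2)
      (u p • ContinuousLinearMap.snd ℝ ℝ ℝ + w p • ContinuousLinearMap.fst ℝ ℝ ℝ) (u p, w p) := by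
    have h1 : HasFDerivAt (Prod.fst : ℝ × ℝ → ℝ) (ContinuousLinearMap.fst ℝ ℝ ℝ) (u p, w p) :=
      hasFDerivAt_fst
    have h2 : HasFDerivAt (Prod.snd : ℝ × ℝ → ℝ) (ContinuousLinearMap.snd ℝ ℝ ℝ) (u p, w p) :=
      hasFDerivAt_snd
    exact h1.fun_mul h2
  rw [hd.fderiv]
  simp

variable [IsManifold I ∞ M]

/-- The differential of a function, as a covector field. -/
noncomputable def differential (I : ModelWithCorners ℝ (EuclideanSpace ℝ (Fin n)) H) (u : M → ℝ)
    (p : M) : TangentSpace I p →L[ℝ] ℝ :=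
  mfderiv I 𝓘(ℝ, ℝ) u p

theorem HasWeakDiffOn.of_contMDiffOn (hU : IsOpen U) (hu : ContMDiffOn I 𝓘(ℝ, ℝ) ∞ u U) :
    HasWeakDiffOn I U u (differential I u) := by
  intro x
  have hO := isOpen_chartDomain (I := I) x hU
  have hc : ContDiffOn ℝ 1 (fun y => u ((extChartAt I x).symm y)) (chartDomain I x U) := by
    rw [← contMDiffOn_iff_contDiffOn]
    exact (hu.of_le (by simp)).comp ((contMDiffOn_extChartAt_symm (n := 1) x).mono
      (inter_subset_left.trans interior_subset)) fun y hy => hy.2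
  refine (IsWeakDiffOn.of_contDiffOn hO hc).congr (fun _ _ => rfl)
    (Eventually.of_forall fun y hy => ?_)
  have hd : ∀ L : EuclideanSpace ℝ (Fin n) →L[ℝ] ℝ, HasFDerivAt (fun y =>
      u ((extChartAt I x).symm y)) L y → fderiv ℝ (fun y => u ((extChartAt I x).symm y)) y = L :=
    fun L hL => hL.fderiv
  refine hd _ (hasFDerivAt_comp_extChartAt_symm hy.1
    ((hu.contMDiffAt (hU.mem_nhds hy.2)).mdifferentiableAt (by simp)))

theorem HasWeakDiffOn.of_contMDiff (hu : ContMDiff I 𝓘(ℝ, ℝ) ∞ u) :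
    HasWeakDiffOn I U u (differential I u) :=
  (HasWeakDiffOn.of_contMDiffOn isOpen_univ hu.contMDiffOn).mono (subset_univ _)

theorem HasWeakDiffOn.const (c : ℝ) : HasWeakDiffOn I U (fun _ => c) (fun _ => 0) := by
  have h := HasWeakDiffOn.of_contMDiff (I := I) (U := U) (contMDiff_const (c := c))
  exact h.congr (fun _ _ => rfl) fun p _ => mfderiv_const

/-- The covector field dual to the vector field `X`. -/
noncomputable def flat (g : Metric I M) (X : ∀ p : M, TangentSpace I p) (p : M) : TangentSpace I p →L[ℝ] ℝ :=
  g.inner p (X p)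

theorem isWeakGradient_iff (g : Metric I M) (hu : Continuous u) (X : ∀ p : M, TangentSpace I p) :
    IsWeakGradient g u X ↔ HasWeakDiffOn I univ u (flat g X) := by
  constructor
  · intro h x
    rw [chartDomain_univ]
    refine ⟨(hu.comp_continuousOn (continuousOn_extChartAt_symm x)).mono interior_subset,
      fun K hK hKT => memLp_of_forall_apply fun v => (h x v).1 K hK hKT,
      fun v ψ h1 h2 h3 => (h x v).2 ψ h1 h2 h3⟩
  · intro h x v
    have hx := h x
    rw [chartDomain_univ] at hx
    refine ⟨fun K hK hKT => ?_, fun ψ h1 h2 h3 => hx.integral_eq v ψ h1 h2 h3⟩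
    exact (ContinuousLinearMap.apply ℝ ℝ v).comp_memLp' (hx.memLp K hK hKT)

theorem mem_interior_iff_extChartAt {x p : M} (hp : p ∈ (extChartAt I x).source) :
    p ∈ I.interior M ↔ extChartAt I x p ∈ interior (extChartAt I x).target := by
  exact I.isInteriorPoint_iff_of_mem_atlas (n := ∞) (by simp) (chart_mem_atlas H x)
    (by simpa using hp)

theorem symm_mem_interior_iff {x : M} {y : EuclideanSpace ℝ (Fin n)}
    (hy : y ∈ (extChartAt I x).target) :
    (extChartAt I x).symm y ∈ I.interior M ↔ y ∈ interior (extChartAt I x).target := by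
  rw [mem_interior_iff_extChartAt ((extChartAt I x).map_target hy), (extChartAt I x).right_inv hy]

theorem comp_frame_cometric (g : Metric I M) (X : ∀ p : M, TangentSpace I p) {x : M}
    {y : EuclideanSpace ℝ (Fin n)} (hy : y ∈ (extChartAt I x).target)
    (ℓ : TangentSpace I ((extChartAt I x).symm y) →L[ℝ] ℝ) :
    ℓ.comp (frame I x y) (cometric g x y ((flat g X ((extChartAt I x).symm y)).comp
      (frame I x y))) = ℓ (X ((extChartAt I x).symm y)) := by
  obtain ⟨v, hv⟩ := (frame_bijective hy).2 (X ((extChartAt I x).symm y))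
  have h1 : (flat g X ((extChartAt I x).symm y)).comp (frame I x y) = metricForm g x y v := by
    rw [flat, ← hv]; rfl
  rw [h1, cometric_metricForm g hy, ← hv]
  rfl

end WeakDifferential

section Pullback

variable {n : ℕ} {H₁ H₂ : Type*} [TopologicalSpace H₁] [TopologicalSpace H₂]
  {I₁ : ModelWithCorners ℝ (EuclideanSpace ℝ (Fin n)) H₁}
  {I₂ : ModelWithCorners ℝ (EuclideanSpace ℝ (Fin n)) H₂}
  {M₁ M₂ : Type*} [TopologicalSpace M₁] [ChartedSpace H₁ M₁] [IsManifold I₁ ∞ M₁]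
  [TopologicalSpace M₂] [ChartedSpace H₂ M₂] [IsManifold I₂ ∞ M₂]
  {g₁ : Metric I₁ M₁} {g₂ : Metric I₂ M₂} {φ : OpenPartialHomeomorph M₁ M₂}

theorem IsLocalIsometry.mem_interior (h : IsLocalIsometry g₁ g₂ φ) {p : M₁} (hp : p ∈ φ.source)
    (hpi : p ∈ I₁.interior M₁) : φ p ∈ I₂.interior M₂ :=
  (h.mdifferentiable.mdifferentiableAt hp).isInteriorPoint_of_surjective_mfderiv
    (h.mdifferentiable.mfderiv_surjective hp) hpi

theorem IsLocalIsometry.mem_interior_iff (h : IsLocalIsometry g₁ g₂ φ) {p : M₁}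
    (hp : p ∈ φ.source) : φ p ∈ I₂.interior M₂ ↔ p ∈ I₁.interior M₁ := by
  refine ⟨fun hq => ?_, h.mem_interior hp⟩
  have := h.symm.mem_interior (φ.map_source hp) hq
  rwa [φ.left_inv hp] at this

theorem HasWeakDiffOn.pullback (h : IsLocalIsometry g₁ g₂ φ) {U : Set M₂} (hU : IsOpen U)
    {u : M₂ → ℝ} {θ : ∀ q : M₂, TangentSpace I₂ q →L[ℝ] ℝ} (hu : HasWeakDiffOn I₂ U u θ) :
    HasWeakDiffOn I₁ (φ.source ∩ φ ⁻¹' U) (fun p => u (φ p))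
      (fun p => (θ (φ p)).comp (mfderiv I₁ I₂ φ p)) := by
  intro x₁
  refine IsWeakDiffOn.of_local fun y hy => ?_
  set x₂ := φ ((extChartAt I₁ x₁).symm y) with hx₂
  have hVo : IsOpen (φ.source ∩ φ ⁻¹' (U ∩ (extChartAt I₂ x₂).source)) :=
    φ.isOpen_inter_preimage (hU.inter (isOpen_extChartAt_source x₂))
  set N := chartDomain I₁ x₁ (φ.source ∩ φ ⁻¹' (U ∩ (extChartAt I₂ x₂).source)) with hN
  have hNo : IsOpen N := isOpen_chartDomain x₁ hVo
  have hNsub : N ⊆ transitionDomain I₁ I₂ φ x₁ x₂ := fun z hz =>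
    ⟨interior_subset hz.1, hz.2.1, hz.2.2.2⟩
  refine ⟨N, hNo, ⟨hy.1, hy.2.1, hy.2.2, mem_extChartAt_source _⟩, ?_⟩
  have hder : ∀ z ∈ N, HasFDerivAt (transition I₁ I₂ φ x₁ x₂)
      (transitionDeriv I₁ I₂ φ x₁ x₂ z) z := fun z hz =>
    (h.hasFDerivWithinAt_transition (hNsub hz)).hasFDerivAt
      (range_mem_nhds_of_mem_interior_target hz.1)
  have hcd : ContDiffOn ℝ 1 (transition I₁ I₂ φ x₁ x₂) N := by
    rw [← contMDiffOn_iff_contDiffOn]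
    refine (contMDiffOn_extChartAt (I := I₂) (n := 1) (x := x₂)).comp
      ((h.contMDiffOn.of_le (by simp)).comp ((contMDiffOn_extChartAt_symm (n := 1) x₁).mono
      (inter_subset_left.trans interior_subset)) fun z hz => hz.2.1) fun z hz => ?_
    simpa using (hNsub hz).2.2
  have hmaps : MapsTo (transition I₁ I₂ φ x₁ x₂) N (chartDomain I₂ x₂ U) := by
    intro z hz
    have h1 : (extChartAt I₁ x₁).symm z ∈ I₁.interior M₁ :=
      (symm_mem_interior_iff (interior_subset hz.1)).2 hz.1
    refine ⟨(mem_interior_iff_extChartAt hz.2.2.2).1 (h.mem_interior hz.2.1 h1), ?_⟩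
    rw [mem_preimage, transition, (extChartAt I₂ x₂).left_inv hz.2.2.2]
    exact hz.2.2.1
  refine ((hu x₂).comp_diffeo (isOpen_chartDomain x₂ hU) hNo hcd (injOn_transition.mono hNsub)
    hmaps fun z hz => ?_).congr (fun z hz => ?_) (Eventually.of_forall fun z hz => ?_)
  · rw [(hder z hz).fderiv]
    exact h.det_transitionDeriv_ne_zero (hNsub hz)
  · simp only [transition, (extChartAt I₂ x₂).left_inv hz.2.2.2]
  · rw [(hder z hz).fderiv]
    have : IsManifold I₂ 1 M₂ := IsManifold.of_le (n := ∞) (by simp)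
    have h1 := mfderivWithin_extChartAt_symm_comp_mfderiv_extChartAt' (I := I₂) hz.2.2.2
    have key : ∀ (q q' : M₂) (_ : q' = q) (v : EuclideanSpace ℝ (Fin n)), θ q' v = θ q v := by
      rintro _ _ rfl v; rfl
    ext v
    have e : ∀ v : TangentSpace I₂ (φ ((extChartAt I₁ x₁).symm z)),
        frame I₂ x₂ (extChartAt I₂ x₂ (φ ((extChartAt I₁ x₁).symm z)))
        (mfderiv I₂ 𝓘(ℝ, EuclideanSpace ℝ (Fin n)) (extChartAt I₂ x₂)
          (φ ((extChartAt I₁ x₁).symm z)) v) = v :=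
      fun v => congrArg (fun L => L v) h1
    exact (congrArg (fun b => θ ((extChartAt I₂ x₂).symm (transition I₁ I₂ φ x₁ x₂ z)) b)
      (e (mfderiv I₁ I₂ φ ((extChartAt I₁ x₁).symm z) (frame I₁ x₁ z v)))).trans
      (key _ _ ((extChartAt I₂ x₂).left_inv hz.2.2.2) _)

/-- The pullback of a vector field by a local diffeomorphism. -/
theorem IsLocalIsometry.exists_pullback (h : IsLocalIsometry g₁ g₂ φ)
    (X : ∀ q : M₂, TangentSpace I₂ q) :
    ∃ Y : ∀ p : M₁, TangentSpace I₁ p, ∀ p ∈ φ.source, mfderiv I₁ I₂ φ p (Y p) = X (φ p) ∧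
      flat g₁ Y p = (flat g₂ X (φ p)).comp (mfderiv I₁ I₂ φ p) := by
  have h1 : ∀ p, ∃ Y : TangentSpace I₁ p, p ∈ φ.source → mfderiv I₁ I₂ φ p Y = X (φ p) := by
    intro p
    by_cases hp : p ∈ φ.source
    · obtain ⟨Y, hY⟩ := h.mdifferentiable.mfderiv_surjective hp (X (φ p))
      exact ⟨Y, fun _ => hY⟩
    · exact ⟨0, fun hp' => absurd hp' hp⟩
  choose Y hY using h1
  refine ⟨Y, fun p hp => ⟨hY p hp, ?_⟩⟩
  ext w
  change g₁.inner p (Y p) w = g₂.inner (φ p) (X (φ p)) (mfderiv I₁ I₂ φ p w)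
  rw [← h.inner_eq p hp, hY p hp]

end Pullback

section Supersolution

variable {n : ℕ} {H : Type*} [TopologicalSpace H]
  {I : ModelWithCorners ℝ (EuclideanSpace ℝ (Fin n)) H}
  {M : Type*} [TopologicalSpace M] [ChartedSpace H M] [IsManifold I ∞ M]

theorem mfderiv_eq_zero_of_notMem_tsupport {ρ : M → ℝ} {p : M} (hp : p ∉ tsupport ρ) :
    mfderiv I 𝓘(ℝ, ℝ) ρ p = 0 := by
  have h : ρ =ᶠ[𝓝 p] fun _ => 0 := by
    filter_upwards [(isClosed_tsupport ρ).isOpen_compl.mem_nhds hp] with q hq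
    exact image_eq_zero_of_notMem_tsupport (f := ρ) hq
  rw [h.mfderiv_eq]
  exact mfderiv_const

theorem differential_eq_zero_of_notMem_tsupport {ρ : M → ℝ} {p : M} (hp : p ∉ tsupport ρ) :
    differential I ρ p = 0 :=
  mfderiv_eq_zero_of_notMem_tsupport hp

theorem fderiv_comp_extChartAt_symm {x : M} {y : EuclideanSpace ℝ (Fin n)}
    (hy : y ∈ interior (extChartAt I x).target) {ρ : M → ℝ}
    (hρ : MDifferentiableAt I 𝓘(ℝ, ℝ) ρ ((extChartAt I x).symm y)) :
    fderiv ℝ (fun y => ρ ((extChartAt I x).symm y)) y =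
      (mfderiv I 𝓘(ℝ, ℝ) ρ ((extChartAt I x).symm y)).comp (frame I x y) := by
  have hd : ∀ L : EuclideanSpace ℝ (Fin n) →L[ℝ] ℝ, HasFDerivAt (fun y =>
      ρ ((extChartAt I x).symm y)) L y → fderiv ℝ (fun y => ρ ((extChartAt I x).symm y)) y = L :=
    fun L hL => hL.fderiv
  exact hd _ (hasFDerivAt_comp_extChartAt_symm hy hρ)

/-- A test function in the chart around `x` extends by zero to a test function on `M`. -/
theorem exists_extend_test [T2Space M] (x : M) {ψ : EuclideanSpace ℝ (Fin n) → ℝ}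
    (hψ : ContDiff ℝ ∞ ψ) (hψc : HasCompactSupport ψ)
    (hψT : tsupport ψ ⊆ interior (extChartAt I x).target) :
    ∃ ρ : M → ℝ, ContMDiff I 𝓘(ℝ, ℝ) ∞ ρ ∧ HasCompactSupport ρ ∧ tsupport ρ ⊆ I.interior M ∧
      tsupport ρ ⊆ (extChartAt I x).source ∧ ((∀ y, 0 ≤ ψ y) → ∀ p, 0 ≤ ρ p) ∧
      ∀ y ∈ (extChartAt I x).target, (mfderiv I 𝓘(ℝ, ℝ) ρ ((extChartAt I x).symm y)).comp
        (frame I x y) = fderiv ℝ ψ y := by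
  classical
  set ρ : M → ℝ := fun p => if p ∈ (extChartAt I x).source then ψ (extChartAt I x p) else 0
    with hρdef
  set C : Set M := (extChartAt I x).symm '' tsupport ψ with hCdef
  have hψT' := hψT.trans interior_subset
  have hCc : IsCompact C :=
    hψc.isCompact.image_of_continuousOn ((continuousOn_extChartAt_symm x).mono hψT')
  have hCs : C ⊆ (extChartAt I x).source := by
    rintro _ ⟨y, hy, rfl⟩
    exact (extChartAt I x).map_target (hψT' hy)
  have hCi : C ⊆ I.interior M := by
    rintro _ ⟨y, hy, rfl⟩
    exact (symm_mem_interior_iff (hψT' hy)).2 (hψT hy)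
  have hρC : ∀ p ∉ C, ρ p = 0 := by
    intro p hp
    by_cases hps : p ∈ (extChartAt I x).source
    · simp only [hρdef, if_pos hps]
      refine image_eq_zero_of_notMem_tsupport (f := ψ) fun h => hp ⟨_, h, ?_⟩
      exact (extChartAt I x).left_inv hps
    · simp only [hρdef, if_neg hps]
  have hsupp : tsupport ρ ⊆ C :=
    closure_minimal (fun p hp => by_contra fun h => hp (hρC p h)) hCc.isClosed
  have hsmooth : ContMDiff I 𝓘(ℝ, ℝ) ∞ ρ := by
    intro p
    by_cases hps : p ∈ (extChartAt I x).source
    · have h1 : ContMDiffAt I 𝓘(ℝ, ℝ) ∞ (fun q => ψ (extChartAt I x q)) p :=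
        hψ.contMDiff.contMDiffAt.comp p (contMDiffAt_extChartAt' (by simpa using hps))
      refine h1.congr_of_eventuallyEq ?_
      filter_upwards [(isOpen_extChartAt_source x).mem_nhds hps] with q hq
      simp only [hρdef, if_pos hq]
    · refine (contMDiffAt_const (c := (0 : ℝ))).congr_of_eventuallyEq ?_
      filter_upwards [hCc.isClosed.isOpen_compl.mem_nhds fun h => hps (hCs h)] with q hq
      exact hρC q hq
  refine ⟨ρ, hsmooth, HasCompactSupport.of_support_subset_isCompact hCc
    ((subset_tsupport _).trans hsupp), hsupp.trans hCi, hsupp.trans hCs, fun h p => ?_,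
    fun y hy => ?_⟩
  · simp only [hρdef]
    split_ifs
    · exact h _
    · exact le_rfl
  · by_cases hyi : y ∈ interior (extChartAt I x).target
    · rw [← fderiv_comp_extChartAt_symm hyi (hsmooth.mdifferentiableAt (by simp))]
      refine Filter.EventuallyEq.fderiv_eq ?_
      filter_upwards [isOpen_interior.mem_nhds hyi] with z hz
      have hz' := interior_subset hz
      simp only [hρdef, if_pos ((extChartAt I x).map_target hz'), (extChartAt I x).right_inv hz']
    · rw [fderiv_eq_zero_of_notMem_tsupport fun h => hyi (hψT h),
        mfderiv_eq_zero_of_notMem_tsupport fun h => hyi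
          ((symm_mem_interior_iff hy).1 (hCi (hsupp h)))]
      exact ContinuousLinearMap.zero_comp _

variable [MeasurableSpace M] [BorelSpace M]

/-- The weak inequality `div X ≤ 0` in the interior of `M`. -/
def IsSupersolution (g : Metric I M) (X : ∀ p : M, TangentSpace I p) : Prop :=
  ∀ ρ : M → ℝ, ContMDiff I 𝓘(ℝ, ℝ) ∞ ρ → HasCompactSupport ρ → tsupport ρ ⊆ I.interior M →
    (∀ p, 0 ≤ ρ p) → 0 ≤ ∫ p, (mfderiv I 𝓘(ℝ, ℝ) ρ p (X p) : ℝ) ∂(volumeMeasure g)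

theorem isSuperharmonic_iff (g : Metric I M) (u : M → ℝ) :
    IsSuperharmonic g u ↔ Continuous u ∧ ∃ X : ∀ p : M, TangentSpace I p,
      HasWeakDiffOn I univ u (flat g X) ∧ IsSupersolution g X := by
  refine and_congr_right fun hu => exists_congr fun X => ?_
  rw [isWeakGradient_iff g hu]
  simp only [Left.neg_nonpos_iff]
  rfl

variable {g : Metric I M} {X : ∀ p : M, TangentSpace I p} {u : M → ℝ}

/-- The coordinates, in the chart around `x`, of a vector field, multiplied by the density of the
volume. -/
noncomputable def coordField (g : Metric I M) (X : ∀ p : M, TangentSpace I p) (x : M)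
    (y : EuclideanSpace ℝ (Fin n)) : EuclideanSpace ℝ (Fin n) :=
  (density g x y • cometric g x y) ((flat g X ((extChartAt I x).symm y)).comp (frame I x y))

theorem comp_frame_coordField {x : M} {y : EuclideanSpace ℝ (Fin n)}
    (hy : y ∈ (extChartAt I x).target)
    (ℓ : TangentSpace I ((extChartAt I x).symm y) →L[ℝ] ℝ) :
    ℓ.comp (frame I x y) (coordField g X x y) =
      density g x y * ℓ (X ((extChartAt I x).symm y)) := by
  rw [← comp_frame_cometric g X hy ℓ, coordField, smul_apply, map_smul, smul_eq_mul]

theorem contDiffOn_density_smul_cometric (g : Metric I M) (x : M) :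
    ContDiffOn ℝ ∞ (fun y => density g x y • cometric g x y) (extChartAt I x).target := by
  have key : ∀ {F : Type _} [NormedAddCommGroup F] [NormedSpace ℝ F]
      {B : EuclideanSpace ℝ (Fin n) → F}, ContDiffOn ℝ ∞ B (extChartAt I x).target →
      ContDiffOn ℝ ∞ (fun y => density g x y • B y) (extChartAt I x).target :=
    fun hB => (contDiffOn_density g x).smul hB
  exact key (contDiffOn_cometric g x)

theorem memLp_coordField (hu : HasWeakDiffOn I univ u (flat g X)) (x : M)
    (K : Set (EuclideanSpace ℝ (Fin n))) (hK : IsCompact K)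
    (hKT : K ⊆ interior (extChartAt I x).target) :
    MemLp (coordField g X x) 2 (volume.restrict K) := by
  have h := hu x
  rw [chartDomain_univ] at h
  exact memLp_clm_apply hK ((contDiffOn_density_smul_cometric g x).continuousOn.mono
    (hKT.trans interior_subset)) (h.memLp K hK hKT)

variable [SecondCountableTopology M]

theorem integral_apply_eq_chart (x : M) {θ : ∀ p : M, TangentSpace I p →L[ℝ] ℝ}
    (hθ : ∀ p ∉ (extChartAt I x).source, θ p = 0) :
    ∫ p, θ p (X p) ∂(volumeMeasure g) = ∫ y in (extChartAt I x).target,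
      (θ ((extChartAt I x).symm y)).comp (frame I x y) (coordField g X x y) := by
  rw [integral_eq_setIntegral_of_forall_notMem (K := (extChartAt I x).source)
    (fun p hp => by rw [hθ p hp]; rfl), setIntegral_volumeMeasure g x fun p => θ p (X p)]
  exact setIntegral_congr_fun (measurableSet_extChartAt_target x) fun y hy =>
    (comp_frame_coordField hy _).symm

theorem IsSupersolution.chart [T2Space M] (hX : IsSupersolution g X) (x : M)
    {ψ : EuclideanSpace ℝ (Fin n) → ℝ} (hψ : ContDiff ℝ ∞ ψ) (hψc : HasCompactSupport ψ)
    (hψT : tsupport ψ ⊆ interior (extChartAt I x).target) (hψ0 : ∀ y, 0 ≤ ψ y) :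
    0 ≤ ∫ y, fderiv ℝ ψ y (coordField g X x y) := by
  obtain ⟨ρ, h1, h2, h3, h4, h5, h6⟩ := exists_extend_test (I := I) x hψ hψc hψT
  have h := hX ρ h1 h2 h3 (h5 hψ0)
  have h7 := integral_apply_eq_chart (g := g) (X := X) x (θ := fun p => mfderiv I 𝓘(ℝ, ℝ) ρ p)
    fun p hp => mfderiv_eq_zero_of_notMem_tsupport fun hp' => hp (h4 hp')
  have h8 : ∫ y, fderiv ℝ ψ y (coordField g X x y) =
      ∫ y in (extChartAt I x).target, fderiv ℝ ψ y (coordField g X x y) :=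
    integral_eq_setIntegral_of_forall_notMem fun y hy => by
      rw [fderiv_eq_zero_of_notMem_tsupport fun h => hy (interior_subset (hψT h))]; rfl
  rw [h8]
  refine h.trans (h7.le.trans (Eq.le ?_))
  exact setIntegral_congr_fun (measurableSet_extChartAt_target x) fun y hy =>
    congrArg (fun L => L (coordField g X x y)) (h6 y hy)

theorem IsSupersolution.integral_nonneg_of_subset_source [T2Space M] (hX : IsSupersolution g X)
    (hu : HasWeakDiffOn I univ u (flat g X)) (x : M) {ρ : M → ℝ}
    {θ : ∀ p : M, TangentSpace I p →L[ℝ] ℝ} (hρ : HasWeakDiffOn I univ ρ θ) (hρ0 : ∀ p, 0 ≤ ρ p)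
    {C : Set M} (hC : IsCompact C) (hCi : C ⊆ I.interior M) (hCs : C ⊆ (extChartAt I x).source)
    (hρC : ∀ p ∉ C, ρ p = 0) (hθC : ∀ p ∉ C, θ p = 0) :
    Integrable (fun p => θ p (X p)) (volumeMeasure g) ∧
      0 ≤ ∫ p, θ p (X p) ∂(volumeMeasure g) := by
  classical
  set T := (extChartAt I x).target with hT
  set K := extChartAt I x '' C with hK
  have hKc : IsCompact K := hC.image_of_continuousOn ((continuousOn_extChartAt x).mono hCs)
  have hKi : K ⊆ interior T := by
    rintro _ ⟨p, hp, rfl⟩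
    exact (mem_interior_iff_extChartAt (hCs hp)).1 (hCi hp)
  have hKC : ∀ y ∈ T, y ∉ K → (extChartAt I x).symm y ∉ C := fun y hy hyK h =>
    hyK ⟨_, h, (extChartAt I x).right_inv hy⟩
  set f : EuclideanSpace ℝ (Fin n) → ℝ :=
    fun y => if y ∈ T then ρ ((extChartAt I x).symm y) else 0 with hf
  set a : EuclideanSpace ℝ (Fin n) → EuclideanSpace ℝ (Fin n) →L[ℝ] ℝ :=
    fun y => if y ∈ T then (θ ((extChartAt I x).symm y)).comp (frame I x y) else 0 with ha
  have hw : IsWeakDiffOn (interior T) f a := by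
    have h := hρ x
    rw [chartDomain_univ] at h
    refine h.congr (fun y hy => ?_) (Eventually.of_forall fun y hy => ?_)
    · exact (if_pos (interior_subset hy)).symm
    · exact (if_pos (interior_subset hy)).symm
  have haK : ∀ y ∉ K, a y = 0 := by
    intro y hy
    by_cases hyT : y ∈ T
    · simp only [ha, if_pos hyT]
      rw [hθC _ (hKC y hyT hy)]
      exact ContinuousLinearMap.zero_comp _
    · simp only [ha, if_neg hyT]
  have hfK : ∀ y ∉ K, f y = 0 := by
    intro y hy
    by_cases hyT : y ∈ T
    · simp only [hf, if_pos hyT]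
      exact hρC _ (hKC y hyT hy)
    · simp only [hf, if_neg hyT]
  have hζ := memLp_coordField hu x
  have hTm : MeasurableSet T := measurableSet_extChartAt_target x
  have heq : ∀ y ∈ T, a y (coordField g X x y) =
      density g x y * θ ((extChartAt I x).symm y) (X ((extChartAt I x).symm y)) := by
    intro y hy
    simp only [ha, if_pos hy]
    exact comp_frame_coordField hy _
  constructor
  · have h1 : IntegrableOn (fun y => a y (coordField g X x y)) K :=
      memLp_two_integrable_apply (hw.memLp K hKc hKi) (hζ K hKc hKi)
    have h2 : IntegrableOn (fun y => a y (coordField g X x y)) T :=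
      h1.of_forall_sdiff_eq_zero hTm fun y hy => by rw [haK y hy.2]; rfl
    have h3 := (integrableOn_volumeMeasure_iff g x fun p => θ p (X p)).2
      (h2.congr_fun heq hTm)
    refine (integrableOn_iff_integrable_of_support_subset fun p hp => ?_).1 h3
    by_contra hps
    refine hp ?_
    simp only
    rw [hθC p fun h => hps (hCs h)]
    rfl
  · have h1 := hw.integral_apply_nonneg isOpen_interior hζ
      (fun ψ h1 h2 h3 h4 => hX.chart x h1 h2 h3 h4) (fun y => by
        simp only [hf]
        split_ifs
        · exact hρ0 _
        · exact le_rfl) hKc hKi hfK haK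
    have h2 : ∫ y, a y (coordField g X x y) = ∫ y in T, a y (coordField g X x y) :=
      integral_eq_setIntegral_of_forall_notMem fun y hy => by
        rw [haK y fun h => hy (interior_subset (hKi h))]; rfl
    rw [integral_apply_eq_chart x fun p hp => hθC p fun h => hp (hCs h)]
    refine h1.trans (h2.le.trans (Eq.le ?_))
    exact setIntegral_congr_fun hTm fun y hy => by simp only [ha, if_pos hy]

theorem differential_add {f h : M → ℝ} {p : M} (hf : MDifferentiableAt I 𝓘(ℝ, ℝ) f p)
    (hh : MDifferentiableAt I 𝓘(ℝ, ℝ) h p) :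
    differential I (fun q => f q + h q) p = differential I f p + differential I h p :=
  (hf.hasMFDerivAt.add hh.hasMFDerivAt).mfderiv

theorem differential_sum {ι : Type*} (s : Finset ι) {f : ι → M → ℝ}
    (h : ∀ i, ContMDiff I 𝓘(ℝ, ℝ) ∞ (f i)) (p : M) :
    differential I (fun q => ∑ i ∈ s, f i q) p = ∑ i ∈ s, differential I (f i) p := by
  classical
  induction s using Finset.induction_on with
  | empty =>
    simp only [Finset.sum_empty]
    exact mfderiv_const
  | insert j s hj ih =>
    simp only [Finset.sum_insert hj]
    rw [differential_add ((h j).mdifferentiableAt (by simp))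
      ((contMDiff_finsetSum fun i _ => h i).mdifferentiableAt (by simp)), ih]

/-- A weakly differentiable compactly supported function is an admissible test function. -/
theorem IsSupersolution.integral_nonneg [T2Space M] (hX : IsSupersolution g X)
    (hu : HasWeakDiffOn I univ u (flat g X)) {ρ : M → ℝ}
    {θ : ∀ p : M, TangentSpace I p →L[ℝ] ℝ} (hρ : HasWeakDiffOn I univ ρ θ) (hρ0 : ∀ p, 0 ≤ ρ p)
    {C : Set M} (hC : IsCompact C) (hCi : C ⊆ I.interior M)
    (hρC : ∀ p ∉ C, ρ p = 0) (hθC : ∀ p ∉ C, θ p = 0) :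
    Integrable (fun p => θ p (X p)) (volumeMeasure g) ∧
      0 ≤ ∫ p, θ p (X p) ∂(volumeMeasure g) := by
  have : LocallyCompactSpace M := Manifold.locallyCompact_of_finiteDimensional I
  obtain ⟨C', hC', hCC'⟩ := exists_compact_superset hC
  obtain ⟨s, χ, -, hχs, hχ0, hχt, hχ1⟩ := exists_finite_partition I hC'
    (N := fun p => (extChartAt I p).source) fun p _ => extChartAt_source_mem_nhds p
  set θ' : s → ∀ p : M, TangentSpace I p →L[ℝ] ℝ :=
    fun i p => ρ p • differential I (χ i) p + χ i p • θ p with hθ'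
  have key : ∀ i : s, Integrable (fun p => θ' i p (X p)) (volumeMeasure g) ∧
      0 ≤ ∫ p, θ' i p (X p) ∂(volumeMeasure g) := by
    intro i
    have hd : HasWeakDiffOn I univ (fun p => χ i p * ρ p) (θ' i) :=
      (HasWeakDiffOn.of_contMDiff (hχs i)).mul isOpen_univ hρ
    refine hX.integral_nonneg_of_subset_source hu i hd (fun p => mul_nonneg (hχ0 i p) (hρ0 p))
      (C := C ∩ tsupport (χ i)) (hC.inter_right (isClosed_tsupport _))
      (inter_subset_left.trans hCi) (inter_subset_right.trans (hχt i)) (fun p hp => ?_)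
      fun p hp => ?_
    · by_cases hpC : p ∈ C
      · rw [image_eq_zero_of_notMem_tsupport (f := χ i) fun h => hp ⟨hpC, h⟩, zero_mul]
      · rw [hρC p hpC, mul_zero]
    · simp only [hθ']
      by_cases hpC : p ∈ C
      · rw [image_eq_zero_of_notMem_tsupport (f := χ i) fun h => hp ⟨hpC, h⟩,
          differential_eq_zero_of_notMem_tsupport fun h => hp ⟨hpC, h⟩, zero_smul, add_zero,
          smul_zero]
      · rw [hρC p hpC, hθC p hpC, smul_zero, zero_smul, add_zero]
  have hsum : ∀ p, ∑ i, θ' i p = θ p := by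
    intro p
    by_cases hpC : p ∈ C
    · simp only [hθ']
      rw [Finset.sum_add_distrib, ← Finset.smul_sum, ← Finset.sum_smul,
        hχ1 p (interior_subset (hCC' hpC)), one_smul]
      have h2 : (fun q => ∑ i, χ i q) =ᶠ[𝓝 p] fun _ => 1 := by
        filter_upwards [isOpen_interior.mem_nhds (hCC' hpC)] with q hq
        exact hχ1 q (interior_subset hq)
      have h4 : ∑ i, differential I (χ i) p = 0 := by
        rw [← differential_sum _ hχs p]
        exact h2.mfderiv_eq.trans mfderiv_const
      rw [h4, smul_zero, zero_add]
    · simp [hθ', hρC p hpC, hθC p hpC]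
  have hfun : (fun p => θ p (X p)) = fun p => ∑ i, θ' i p (X p) := by
    funext p
    rw [← hsum p, sum_apply]
  rw [hfun]
  refine ⟨integrable_finsetSum _ fun i _ => (key i).1, ?_⟩
  rw [integral_finsetSum _ fun i _ => (key i).1]
  exact Finset.sum_nonneg fun i _ => (key i).2

theorem exists_mem_interior_of_isOpen {V : Set M} (hV : IsOpen V) (hne : V.Nonempty) :
    (V ∩ I.interior M).Nonempty := by
  obtain ⟨z, hz⟩ := hne
  have h1 : extChartAt I z z ∈ closure (interior (extChartAt I z).target) :=
    extChartAt_target_subset_closure_interior (mem_extChartAt_target z)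
  have h2 : (extChartAt I z).symm ⁻¹' V ∈
      𝓝[interior (extChartAt I z).target] (extChartAt I z z) := by
    refine (((continuousOn_extChartAt_symm z) _ (mem_extChartAt_target z)).mono
      interior_subset).preimage_mem_nhdsWithin (hV.mem_nhds ?_)
    rwa [extChartAt_to_inv]
  have := mem_closure_iff_nhdsWithin_neBot.1 h1
  obtain ⟨y, hyV, hyi⟩ := (this.nonempty_of_mem (inter_mem h2 self_mem_nhdsWithin))
  exact ⟨_, hyV, (symm_mem_interior_iff (interior_subset hyi)).2 hyi⟩

/-- Strong minimum principle: a nonnegative superharmonic function that is positive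
somewhere is positive at all interior points. -/
theorem pos_of_isSuperharmonic [T2Space M] [ConnectedSpace M] (hu : IsSuperharmonic g u)
    (hu0 : ∀ p, 0 ≤ u p) {p₀ : M} (hup₀ : 0 < u p₀) :
    ∀ p ∈ I.interior M, 0 < u p := by
  obtain ⟨huc, X, huX, hX⟩ := (isSuperharmonic_iff g u).1 hu
  have hint : IsOpen (I.interior M) := I.isOpen_interior (n := ∞) (by simp)
  have key : ∀ x : M, ∃ W, IsOpen W ∧ x ∈ W ∧ ∀ p ∈ W ∩ I.interior M, 0 < u p →
      ∀ q ∈ W ∩ I.interior M, 0 < u q := by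
    intro x
    obtain ⟨r, hr, hrT⟩ := Metric.mem_nhdsWithin_iff.1 (extChartAt_target_mem_nhdsWithin (I := I) x)
    set T := Metric.ball (extChartAt I x x) r ∩ interior (range I) with hT
    have hTo : IsOpen T := Metric.isOpen_ball.inter isOpen_interior
    have hTt : T ⊆ (extChartAt I x).target := fun y hy => hrT ⟨hy.1, interior_subset hy.2⟩
    have hTi : T ⊆ interior (extChartAt I x).target := interior_maximal hTt hTo
    have hTc : IsPreconnected T :=
      ((convex_ball _ _).inter I.convex_range.interior).isPreconnected
    refine ⟨(extChartAt I x).source ∩ extChartAt I x ⁻¹' Metric.ball (extChartAt I x x) r,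
      isOpen_extChartAt_preimage' x Metric.isOpen_ball,
      ⟨mem_extChartAt_source x, Metric.mem_ball_self hr⟩, ?_⟩
    have hmem : ∀ p ∈ ((extChartAt I x).source ∩
        extChartAt I x ⁻¹' Metric.ball (extChartAt I x x) r) ∩ I.interior M,
        extChartAt I x p ∈ T := fun p hp => ⟨hp.1.2,
      interior_mono (extChartAt_target_subset_range x) ((mem_interior_iff_extChartAt hp.1.1).1 hp.2)⟩
    have hwd := huX x
    rw [chartDomain_univ] at hwd
    intro p hp hup q hq
    have h1 := pos_of_isPreconnected (A := fun y => density g x y • cometric g x y) hTo hTc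
      ((contDiffOn_density_smul_cometric g x).mono hTt)
      (fun y hy ℓ hℓ => by
        have := mul_pos (density_pos g (hTt hy)) (cometric_pos g (hTt hy) hℓ)
        simpa using this)
      (hwd.mono hTi) (fun y _ => hu0 _)
      (fun ψ h1 h2 h3 h4 => hX.chart x h1 h2 (h3.trans hTi) h4) (hmem p hp)
      (by simpa only [(extChartAt I x).left_inv hp.1.1] using hup) _ (hmem q hq)
    simpa only [(extChartAt I x).left_inv hq.1.1] using h1
  set S : Set M := {x | ∃ V, IsOpen V ∧ x ∈ V ∧ ∀ q ∈ V ∩ I.interior M, 0 < u q} with hS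
  have hSo : IsOpen S := by
    rw [isOpen_iff_forall_mem_open]
    rintro x ⟨V, hV, hxV, h⟩
    exact ⟨V, fun z hz => ⟨V, hV, hz, h⟩, hV, hxV⟩
  have hSc : IsClosed S := by
    refine isClosed_of_closure_subset fun x hx => ?_
    obtain ⟨W, hW, hxW, h⟩ := key x
    obtain ⟨z, hzW, V, hV, hzV, hVu⟩ := mem_closure_iff.1 hx W hW hxW
    obtain ⟨q, hq, hqi⟩ := exists_mem_interior_of_isOpen (I := I) (hW.inter hV) ⟨z, hzW, hzV⟩
    exact ⟨W, hW, hxW, h q ⟨hq.1, hqi⟩ (hVu q ⟨hq.2, hqi⟩)⟩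
  have hSn : S.Nonempty := ⟨p₀, {p | 0 < u p}, isOpen_lt continuous_const huc, hup₀,
    fun q hq => hq.1⟩
  have hSu : S = univ := IsClopen.eq_univ ⟨hSc, hSo⟩ hSn
  intro p hp
  obtain ⟨V, -, hpV, hVu⟩ : p ∈ S := hSu ▸ mem_univ p
  exact hVu p ⟨hpV, hp⟩

end Supersolution

/-- A smooth concave nondecreasing truncation of the identity of `[0, ∞)`, constant exactly on
`[d, ∞)`. -/
theorem exists_concave_truncation {d : ℝ} (hd : 0 < d) :
    ∃ (Ψ : ℝ → ℝ) (ε : ℝ), ContDiff ℝ ∞ Ψ ∧ ContDiff ℝ ∞ (deriv Ψ) ∧ 0 < ε ∧ Ψ 0 = 0 ∧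
      (∀ t, 0 ≤ t → 0 ≤ Ψ t ∧ Ψ t ≤ t) ∧ (∀ t, d ≤ t → Ψ t = ε) ∧ (∀ t < d, Ψ t < ε) ∧
      (∀ t, 0 ≤ deriv Ψ t) ∧ (∀ t, d ≤ t → deriv Ψ t = 0) ∧ (∀ t, deriv (deriv Ψ) t ≤ 0) ∧
      ∀ t, d < t → deriv (deriv Ψ) t = 0 := by
  set χ : ℝ → ℝ := fun s => expNegInvGlue (d - s) with hχ
  have hχs : ContDiff ℝ ∞ χ := expNegInvGlue.contDiff.comp (contDiff_const.sub contDiff_id)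
  have hχc : Continuous χ := hχs.continuous
  have hχ0 : ∀ t, 0 ≤ χ t := fun t => expNegInvGlue.nonneg _
  have hχ1 : ∀ t, χ t ≤ 1 := by
    intro t
    simp only [hχ, expNegInvGlue]
    split_ifs with h
    · exact zero_le_one
    · rw [Real.exp_le_one_iff]
      simp only [not_le] at h
      have := inv_pos.2 h
      linarith
  have hχa : Antitone χ := fun s t hst => expNegInvGlue_monotone (by linarith)
  have hint : ∀ a b, IntervalIntegrable χ volume a b := fun a b => hχc.intervalIntegrable a b
  set Ψ : ℝ → ℝ := fun t => ∫ s in (0 : ℝ)..t, χ s with hΨ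
  have hder : ∀ t, HasDerivAt Ψ (χ t) t := fun t => hχc.integral_hasStrictDerivAt 0 t |>.hasDerivAt
  have hderiv : deriv Ψ = χ := funext fun t => (hder t).deriv
  have hsub : ∀ s t, Ψ t - Ψ s = ∫ r in s..t, χ r := fun s t =>
    intervalIntegral.integral_interval_sub_left (hint 0 t) (hint 0 s)
  have hzero : ∀ t, d ≤ t → χ t = 0 := fun t ht => expNegInvGlue.zero_of_nonpos (by linarith)
  have hpos : ∀ t < d, Ψ t < Ψ d := by
    intro t ht
    have : 0 < ∫ r in t..d, χ r := by
      refine intervalIntegral.intervalIntegral_pos_of_pos_on (hint _ _) (fun s hs => ?_) ht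
      exact expNegInvGlue.pos_of_pos (by linarith [hs.2])
    linarith [hsub t d]
  refine ⟨Ψ, Ψ d, ?_, hderiv ▸ hχs, ?_, by simp [hΨ], fun t ht => ⟨?_, ?_⟩, fun t ht => ?_, hpos,
    fun t => hderiv ▸ hχ0 t, fun t ht => hderiv ▸ hzero t ht, fun t => ?_, fun t ht => ?_⟩
  · exact contDiff_infty_iff_deriv.2 ⟨fun t => (hder t).differentiableAt, hderiv ▸ hχs⟩
  · have := hpos 0 hd
    simpa [hΨ] using this
  · exact intervalIntegral.integral_nonneg ht fun s _ => hχ0 s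
  · have := intervalIntegral.integral_mono_on ht (hint 0 t) (intervalIntegrable_const (c := (1 : ℝ)))
      fun s _ => hχ1 s
    simpa using this
  · have h1 : ∫ r in d..t, χ r = ∫ r in d..t, (0 : ℝ) :=
      intervalIntegral.integral_congr fun s hs => by
        rw [uIcc_of_le ht] at hs
        exact hzero s hs.1
    have := hsub d t
    rw [h1, intervalIntegral.integral_zero] at this
    linarith
  · rw [hderiv]
    exact hχa.deriv_nonpos
  · have h1 : χ =ᶠ[𝓝 t] fun _ => 0 := by
      filter_upwards [Ioi_mem_nhds ht] with s hs
      exact hzero s (le_of_lt hs)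
    rw [hderiv, h1.deriv_eq, deriv_const]

section Transplant

variable {n : ℕ} {H₁ H₂ : Type*} [TopologicalSpace H₁] [TopologicalSpace H₂]
  {I₁ : ModelWithCorners ℝ (EuclideanSpace ℝ (Fin n)) H₁}
  {I₂ : ModelWithCorners ℝ (EuclideanSpace ℝ (Fin n)) H₂}
  {M₁ M₂ : Type*} [TopologicalSpace M₁] [ChartedSpace H₁ M₁] [IsManifold I₁ ∞ M₁]
  [TopologicalSpace M₂] [ChartedSpace H₂ M₂] [IsManifold I₂ ∞ M₂]
  [T2Space M₁] [T2Space M₂] [SecondCountableTopology M₁] [SecondCountableTopology M₂]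
  [MeasurableSpace M₁] [BorelSpace M₁] [MeasurableSpace M₂] [BorelSpace M₂]
  {g₁ : Metric I₁ M₁} {g₂ : Metric I₂ M₂} {φ : OpenPartialHomeomorph M₁ M₂}

/-- A weakly differentiable function on `M₁` that vanishes off a compact subset of the domain of
a local isometry, tested against the pullback of a supersolution of `M₂`. -/
theorem IsLocalIsometry.integral_pullback_nonneg (h : IsLocalIsometry g₁ g₂ φ)
    {X : ∀ q : M₂, TangentSpace I₂ q} {u : M₂ → ℝ} (hX : IsSupersolution g₂ X)
    (hu : HasWeakDiffOn I₂ univ u (flat g₂ X)) {Y : ∀ p : M₁, TangentSpace I₁ p}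
    (hY : ∀ p ∈ φ.source, mfderiv I₁ I₂ φ p (Y p) = X (φ p))
    {w : M₁ → ℝ} {θ : ∀ p : M₁, TangentSpace I₁ p →L[ℝ] ℝ} (hw : HasWeakDiffOn I₁ univ w θ)
    (hw0 : ∀ p, 0 ≤ w p) {C : Set M₁} (hC : IsCompact C) (hCs : C ⊆ φ.source)
    (hCi : C ⊆ I₁.interior M₁) (hwC : ∀ p ∉ C, w p = 0) (hθC : ∀ p ∉ C, θ p = 0) :
    Integrable (fun p => θ p (Y p)) (volumeMeasure g₁) ∧
      0 ≤ ∫ p, θ p (Y p) ∂(volumeMeasure g₁) := by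
  classical
  set C₂ : Set M₂ := φ '' C with hC₂
  have hC₂c : IsCompact C₂ := hC.image_of_continuousOn (φ.continuousOn.mono hCs)
  have hC₂i : C₂ ⊆ I₂.interior M₂ := by
    rintro _ ⟨p, hp, rfl⟩
    exact h.mem_interior (hCs hp) (hCi hp)
  have hC₂t : C₂ ⊆ φ.target := by
    rintro _ ⟨p, hp, rfl⟩
    exact φ.map_source (hCs hp)
  set w₂ : M₂ → ℝ := fun q => if q ∈ φ.target then w (φ.symm q) else 0 with hw₂
  set θ₂ : ∀ q : M₂, TangentSpace I₂ q →L[ℝ] ℝ := fun q =>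
    if q ∈ φ.target then (θ (φ.symm q)).comp (mfderiv I₂ I₁ φ.symm q) else 0 with hθ₂
  have hCsymm : ∀ q ∈ φ.target, q ∉ C₂ → φ.symm q ∉ C := fun q hq hqC hq' =>
    hqC ⟨_, hq', φ.right_inv hq⟩
  have hw₂C : ∀ q ∉ C₂, w₂ q = 0 := by
    intro q hq
    by_cases hqt : q ∈ φ.target
    · simp only [hw₂, if_pos hqt]
      exact hwC _ (hCsymm q hqt hq)
    · simp only [hw₂, if_neg hqt]
  have hθ₂C : ∀ q ∉ C₂, θ₂ q = 0 := by
    intro q hq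
    by_cases hqt : q ∈ φ.target
    · simp only [hθ₂, if_pos hqt]
      rw [hθC _ (hCsymm q hqt hq)]
      exact ContinuousLinearMap.zero_comp _
    · simp only [hθ₂, if_neg hqt]
  have hd : HasWeakDiffOn I₂ univ w₂ θ₂ := by
    refine HasWeakDiffOn.of_local fun q _ => ?_
    by_cases hqt : q ∈ φ.target
    · refine ⟨φ.target, φ.open_target, hqt, ?_⟩
      refine ((hw.pullback h.symm isOpen_univ).mono fun z hz => ⟨hz, mem_univ _⟩).congr
        (fun z hz => ?_) fun z hz => ?_
      · exact (if_pos hz).symm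
      · exact (if_pos hz).symm
    · refine ⟨C₂ᶜ, hC₂c.isClosed.isOpen_compl, fun hq => hqt (hC₂t hq), ?_⟩
      exact (HasWeakDiffOn.const (I := I₂) 0).congr (fun z hz => (hw₂C z hz).symm)
        fun z hz => (hθ₂C z hz).symm
  obtain ⟨hi, hn⟩ := hX.integral_nonneg hu hd (fun q => by
    simp only [hw₂]
    split_ifs
    · exact hw0 _
    · exact le_rfl) hC₂c hC₂i hw₂C hθ₂C
  have heq : ∀ p ∈ φ.source, θ₂ (φ p) (X (φ p)) = θ p (Y p) := by
    intro p hp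
    simp only [hθ₂, if_pos (φ.map_source hp)]
    rw [← hY p hp]
    have h1 : ∀ v : TangentSpace I₁ p, mfderiv I₂ I₁ φ.symm (φ p) (mfderiv I₁ I₂ φ p v) = v :=
      fun v => congrArg (fun L => L v) (h.mdifferentiable.symm_comp_deriv hp)
    have key : ∀ (p' : M₁) (_ : p' = p) (v : EuclideanSpace ℝ (Fin n)), θ p' v = θ p v := by
      rintro _ rfl v; rfl
    exact (congrArg (fun b => θ (φ.symm (φ p)) b) (h1 (Y p))).trans (key _ (φ.left_inv hp) _)
  have hiso := h.isMeasureIso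
  have hs : MeasurableSet φ.source := φ.open_source.measurableSet
  constructor
  · have h1 := (hiso.integrableOn_iff fun q => θ₂ q (X q)).1 hi.integrableOn
    have h2 : IntegrableOn (fun p => θ p (Y p)) φ.source (volumeMeasure g₁) :=
      h1.congr_fun heq hs
    refine (integrableOn_iff_integrable_of_support_subset fun p hp => ?_).1 h2
    by_contra hps
    refine hp ?_
    change θ p (Y p) = 0
    rw [hθC p fun h => hps (hCs h)]
    rfl
  · have h1 : ∫ q, θ₂ q (X q) ∂(volumeMeasure g₂) =
        ∫ q in φ.target, θ₂ q (X q) ∂(volumeMeasure g₂) :=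
      integral_eq_setIntegral_of_forall_notMem fun q hq => by
        rw [hθ₂C q fun h => hq (hC₂t h)]; rfl
    have h2 : ∫ p, θ p (Y p) ∂(volumeMeasure g₁) =
        ∫ p in φ.source, θ p (Y p) ∂(volumeMeasure g₁) :=
      integral_eq_setIntegral_of_forall_notMem fun p hp => by
        rw [hθC p fun h => hp (hCs h)]; rfl
    rw [h2, ← setIntegral_congr_fun hs heq]
    exact (hn.trans_eq h1).trans_eq (hiso.setIntegral_eq fun q => θ₂ q (X q))

/-- Transplantation of a positive superharmonic function across a local isometry defined off a
compact set. -/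
theorem IsLocalIsometry.exists_transplant [Nonempty M₁] (h : IsLocalIsometry g₁ g₂ φ) {K : Set M₁}
    (hK : IsCompact K) (hKi : K ⊆ I₁.interior M₁) (hsource : φ.source = Kᶜ) {u : M₂ → ℝ}
    (hu : IsSuperharmonic g₂ u) (hu0 : ∀ q, 0 ≤ u q) (hupos : ∀ q ∈ I₂.interior M₂, 0 < u q)
    (huint : Integrable u (volumeMeasure g₂)) :
    ∃ (L : Set M₁) (U : M₁ → ℝ) (d ε : ℝ), IsCompact L ∧ K ⊆ L ∧ L.Nonempty ∧
      L ⊆ I₁.interior M₁ ∧ 0 < d ∧ 0 < ε ∧ IsSuperharmonic g₁ U ∧ (∀ p, 0 ≤ U p) ∧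
      Integrable U (volumeMeasure g₁) ∧ (∀ p ∈ L, U p = ε) ∧ (∀ p ∉ L, U p ≤ u (φ p)) ∧
      ∀ p ∉ L, U p = ε → d ≤ u (φ p) := by
  classical
  obtain ⟨huc, X, huX, hX⟩ := (isSuperharmonic_iff g₂ u).1 hu
  have : LocallyCompactSpace M₁ := Manifold.locallyCompact_of_finiteDimensional I₁
  have hint : IsOpen (I₁.interior M₁) := I₁.isOpen_interior (n := ∞) (by simp)
  obtain ⟨p₀, -, hp₀⟩ := exists_mem_interior_of_isOpen (I := I₁) (M := M₁) isOpen_univ univ_nonempty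
  obtain ⟨L, hL, hKL, hLi⟩ := exists_compact_between (hK.insert p₀) hint
    (insert_subset hp₀ hKi)
  have hKL' : K ⊆ interior L := (subset_insert _ _).trans hKL
  have hLs : ∀ p ∉ L, p ∈ φ.source := fun p hp => by
    rw [hsource]
    exact fun hpK => hp (interior_subset (hKL' hpK))
  have hcont : ContinuousOn (fun p => u (φ p)) φ.source := huc.comp_continuousOn φ.continuousOn
  have hfr : frontier L ⊆ φ.source := fun p hp => by
    rw [hsource]
    exact fun hpK => hp.2 (hKL' hpK)
  obtain ⟨a, ha, hLa⟩ : ∃ a, 0 < a ∧ ∀ p ∈ frontier L, a ≤ u (φ p) :=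
    (hL.of_isClosed_subset isClosed_frontier hL.isClosed.frontier_subset).exists_forall_le'
      (hcont.mono hfr) fun p hp => hupos _ (h.mem_interior (hfr hp)
        (hLi (hL.isClosed.frontier_subset hp)))
  set d := a / 2 with hd
  have hd0 : 0 < d := half_pos ha
  obtain ⟨Ψ, ε, hΨ, hΨ', hε, hΨ0, hΨle, hΨd, hΨlt, hΨn, hΨz, hΨc, hΨcz⟩ := exists_concave_truncation hd0
  obtain ⟨Y, hY⟩ := h.exists_pullback X
  -- a neighbourhood of `L` on which the transplanted function is constant
  set O : Set M₁ := interior L ∪ (φ.source ∩ φ ⁻¹' {q | d < u q}) with hO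
  have hOo : IsOpen O :=
    isOpen_interior.union (φ.isOpen_inter_preimage (isOpen_lt continuous_const huc))
  have hLO : L ⊆ O := by
    intro p hp
    by_cases hpi : p ∈ interior L
    · exact Or.inl hpi
    · have hpf : p ∈ frontier L := ⟨subset_closure hp, hpi⟩
      refine Or.inr ⟨hfr hpf, ?_⟩
      have := hLa p hpf
      simp only [mem_preimage, mem_ofPred_eq]
      linarith
  have hOd : ∀ p ∈ O, p ∉ L → d < u (φ p) := by
    rintro p (hp | hp) hpL
    · exact absurd (interior_subset hp) hpL
    · exact hp.2
  set U : M₁ → ℝ := fun p => if p ∈ L then ε else Ψ (u (φ p)) with hU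
  set Z : ∀ p : M₁, TangentSpace I₁ p := fun p => if p ∈ L then 0 else deriv Ψ (u (φ p)) • Y p
    with hZ
  have hUO : ∀ p ∈ O, U p = ε := by
    intro p hp
    by_cases hpL : p ∈ L
    · simp only [hU, if_pos hpL]
    · simp only [hU, if_neg hpL]
      exact hΨd _ (hOd p hp hpL).le
  have hLc : IsOpen Lᶜ := hL.isClosed.isOpen_compl
  have hUc : Continuous U := by
    rw [continuous_iff_continuousAt]
    intro p
    by_cases hpL : p ∈ L
    · refine (continuousAt_const (y := ε)).congr ?_
      filter_upwards [hOo.mem_nhds (hLO hpL)] with q hq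
      exact (hUO q hq).symm
    · have h1 : ContinuousAt (fun p => Ψ (u (φ p))) p :=
        hΨ.continuous.continuousAt.comp
          (hcont.continuousAt (φ.open_source.mem_nhds (hLs p hpL)))
      refine h1.congr ?_
      filter_upwards [hLc.mem_nhds hpL] with q hq
      simp only [hU]
      rw [if_neg hq]
  -- functions of `u ∘ φ` that are locally constant near `L`
  have hcomp : ∀ F : ℝ → ℝ, ContDiff ℝ ∞ F →
      HasWeakDiffOn I₁ Lᶜ (fun p => F (u (φ p))) (fun p => deriv F (u (φ p)) • flat g₁ Y p) := by
    intro F hF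
    refine (((huX.comp isOpen_univ hF).pullback h isOpen_univ).mono fun p hp =>
      ⟨hLs p hp, mem_univ _⟩).congr (fun _ _ => rfl) fun p hp => ?_
    rw [(hY p (hLs p hp)).2]
    rfl
  have hUd : HasWeakDiffOn I₁ univ U (flat g₁ Z) := by
    refine HasWeakDiffOn.of_local fun p _ => ?_
    by_cases hpL : p ∈ L
    · refine ⟨O, hOo, hLO hpL, (HasWeakDiffOn.const (I := I₁) ε).congr
        (fun q hq => (hUO q hq).symm) fun q hq => ?_⟩
      have : Z q = 0 := by
        by_cases hqL : q ∈ L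
        · simp only [hZ, if_pos hqL]
        · simp only [hZ, if_neg hqL]
          rw [hΨz _ (hOd q hq hqL).le, zero_smul]
      rw [flat, this, map_zero]
    · refine ⟨Lᶜ, hLc, hpL, (hcomp Ψ hΨ).congr (fun q hq => ?_) fun q hq => ?_⟩
      · simp only [hU]
        rw [if_neg hq]
      · simp only [flat, hZ]
        rw [if_neg hq, map_smul]
  have hZsup : IsSupersolution g₁ Z := by
    intro ρ hρ hρc hρi hρ0
    set w : M₁ → ℝ := fun p => if p ∈ L then 0 else deriv Ψ (u (φ p)) * ρ p with hw
    set θ : ∀ p : M₁, TangentSpace I₁ p →L[ℝ] ℝ := fun p => if p ∈ L then 0 else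
      ρ p • (deriv (deriv Ψ) (u (φ p)) • flat g₁ Y p) +
        deriv Ψ (u (φ p)) • differential I₁ ρ p with hθ
    have hwO : ∀ p ∈ O, w p = 0 := by
      intro p hp
      by_cases hpL : p ∈ L
      · simp only [hw, if_pos hpL]
      · simp only [hw, if_neg hpL]
        rw [hΨz _ (hOd p hp hpL).le, zero_mul]
    have hθO : ∀ p ∈ O, θ p = 0 := by
      intro p hp
      by_cases hpL : p ∈ L
      · simp only [hθ, if_pos hpL]
      · simp only [hθ, if_neg hpL]
        rw [hΨz _ (hOd p hp hpL).le, hΨcz _ (hOd p hp hpL), zero_smul, zero_smul, smul_zero,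
          add_zero]
    have hwd : HasWeakDiffOn I₁ univ w θ := by
      refine HasWeakDiffOn.of_local fun p _ => ?_
      by_cases hpL : p ∈ L
      · exact ⟨O, hOo, hLO hpL, (HasWeakDiffOn.const (I := I₁) 0).congr
          (fun q hq => (hwO q hq).symm) fun q hq => (hθO q hq).symm⟩
      · refine ⟨Lᶜ, hLc, hpL, ((hcomp (deriv Ψ) hΨ').mul hLc
          (HasWeakDiffOn.of_contMDiff hρ)).congr (fun q hq => ?_) fun q hq => ?_⟩
        · exact (if_neg hq).symm
        · exact (if_neg hq).symm
    have hw0 : ∀ p, 0 ≤ w p := by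
      intro p
      simp only [hw]
      split_ifs
      · exact le_rfl
      · exact mul_nonneg (hΨn _) (hρ0 p)
    have hOL : ∀ p ∉ O, p ∉ L := fun p hp hpL => hp (hLO hpL)
    obtain ⟨hi, hn⟩ := h.integral_pullback_nonneg hX huX (fun p hp => (hY p hp).1) hwd hw0
      (C := tsupport ρ \ O) (hρc.isCompact.diff hOo) (fun p hp => hLs p (hOL p hp.2))
      (fun p hp => hρi hp.1)
      (fun p hp => by
        by_cases hpO : p ∈ O
        · exact hwO p hpO
        · simp only [hw, if_neg (hOL p hpO)]
          rw [image_eq_zero_of_notMem_tsupport (f := ρ) fun h => hp ⟨h, hpO⟩, mul_zero])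
      (fun p hp => by
        by_cases hpO : p ∈ O
        · exact hθO p hpO
        · simp only [hθ, if_neg (hOL p hpO)]
          rw [image_eq_zero_of_notMem_tsupport (f := ρ) fun h => hp ⟨h, hpO⟩,
            differential_eq_zero_of_notMem_tsupport fun h => hp ⟨h, hpO⟩, zero_smul, smul_zero,
            add_zero])
    have hle : ∀ p, θ p (Y p) ≤ differential I₁ ρ p (Z p) := by
      intro p
      by_cases hpL : p ∈ L
      · simp only [hθ, hZ, if_pos hpL]
        rw [map_zero]
        exact le_rfl
      · simp only [hθ, hZ, if_neg hpL]
        rw [map_smul, add_apply, smul_apply, smul_apply, smul_apply]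
        have h1 : 0 ≤ flat g₁ Y p (Y p) := by
          by_cases hY0 : Y p = 0
          · rw [hY0, map_zero]
          · exact (g₁.pos p (Y p) hY0).le
        have h2 := mul_nonpos_of_nonneg_of_nonpos (hρ0 p)
          (mul_nonpos_of_nonpos_of_nonneg (hΨc (u (φ p))) h1)
        simp only [smul_eq_mul]
        linarith
    change 0 ≤ ∫ p, differential I₁ ρ p (Z p) ∂(volumeMeasure g₁)
    by_cases hint' : Integrable (fun p => differential I₁ ρ p (Z p)) (volumeMeasure g₁)
    · exact hn.trans (integral_mono hi hint' hle)
    · rw [integral_undef hint']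
  have hU0 : ∀ p, 0 ≤ U p := by
    intro p
    simp only [hU]
    split_ifs
    · exact hε.le
    · exact (hΨle _ (hu0 _)).1
  have hUle : ∀ p ∉ L, U p ≤ u (φ p) := by
    intro p hp
    simp only [hU, if_neg hp]
    exact (hΨle _ (hu0 _)).2
  have hUint : Integrable U (volumeMeasure g₁) := by
    have := isLocallyFiniteMeasure_volumeMeasure g₁
    have h1 : IntegrableOn U L (volumeMeasure g₁) := hUc.continuousOn.integrableOn_compact hL
    have h2 : IntegrableOn (fun p => u (φ p)) φ.source (volumeMeasure g₁) :=
      (h.isMeasureIso.integrableOn_iff u).1 huint.integrableOn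
    have h3 : IntegrableOn U Lᶜ (volumeMeasure g₁) := by
      refine (h2.mono_set fun p hp => hLs p hp).mono' hUc.aestronglyMeasurable ?_
      filter_upwards [ae_restrict_mem hLc.measurableSet] with p hp
      rw [Real.norm_of_nonneg (hU0 p)]
      exact hUle p hp
    rw [← integrableOn_univ, ← union_compl_self L]
    exact h1.union h3
  refine ⟨L, U, d, ε, hL, hKL'.trans interior_subset,
    ⟨p₀, interior_subset (hKL (mem_insert _ _))⟩, hLi, hd0, hε,
    (isSuperharmonic_iff g₁ U).2 ⟨hUc, Z, hUd, hZsup⟩, hU0, hUint,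
    fun p hp => if_pos hp, hUle, fun p hp hpε => ?_⟩
  by_contra hlt
  have h1 := hΨlt _ (not_le.1 hlt)
  simp only [hU, if_neg hp] at hpε
  exact absurd hpε h1.ne

end Transplant

section Lipschitz

variable {E : Type*} [NormedAddCommGroup E] [NormedSpace ℝ E] [FiniteDimensional ℝ E]
  [MeasureSpace E] [BorelSpace E] [(volume : Measure E).IsAddHaarMeasure]

theorem memLp_two_restrict_of_bound {F : Type*} [NormedAddCommGroup F] {K : Set E}
    (hK : IsCompact K) {b : E → F} (hb : AEStronglyMeasurable b (volume.restrict K)) {C : ℝ}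
    (hC : ∀ y, ‖b y‖ ≤ C) : MemLp b 2 (volume.restrict K) := by
  have : IsFiniteMeasure (volume.restrict K) := ⟨by simpa using hK.measure_lt_top⟩
  exact MemLp.of_bound hb C (Eventually.of_forall hC)

/-- A Lipschitz function is weakly differentiable. -/
theorem IsWeakDiffOn.of_lipschitzWith {F : E → ℝ} {C : NNReal} (hF : LipschitzWith C F)
    (T : Set E) : IsWeakDiffOn T F (fderiv ℝ F) := by
  refine ⟨hF.continuous.continuousOn, fun K hK _ => ?_, fun v ψ h1 h2 _ => ?_⟩
  · exact memLp_two_restrict_of_bound hK (measurable_fderiv ℝ F).aestronglyMeasurable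
      fun y => norm_fderiv_le_of_lipschitz ℝ hF
  · obtain ⟨D, hD⟩ := h1.lipschitzWith_of_hasCompactSupport h2 (by simp)
    have h3 := hF.integral_lineDeriv_mul_eq (μ := volume) hD h2 v
    have h4 : ∫ y, lineDeriv ℝ F y v * ψ y = ∫ y, fderiv ℝ F y v * ψ y := by
      refine integral_congr_ae ?_
      filter_upwards [hF.ae_differentiableAt] with y hy
      rw [hy.lineDeriv_eq_fderiv]
    have h5 : ∫ y, lineDeriv ℝ ψ y (-v) * F y = -∫ y, F y * fderiv ℝ ψ y v := by
      rw [← integral_neg]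
      refine integral_congr_ae (Eventually.of_forall fun y => ?_)
      simp only
      rw [((h1.differentiable (by simp)) y).lineDeriv_eq_fderiv, map_neg]
      ring
    rw [h4, h5] at h3
    linarith

end Lipschitz

section HopfRinow

variable {X : Type*} [PseudoEMetricSpace X]

/-- The Hopf–Rinow theorem for complete locally compact length spaces. -/
theorem isCompact_closedEBall_of_length [CompleteSpace X] [LocallyCompactSpace X] (o : X)
    (hlen : ∀ (q : X) (a b : ℝ≥0∞), 0 < b → edist o q < a + b →
      ∃ m, edist o m ≤ a ∧ edist m q < b) {R : ℝ≥0∞} (hR : R ≠ ⊤) :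
    IsCompact (Metric.closedEBall o R) := by
  set A : Set ℝ≥0∞ := {r | IsCompact (Metric.closedEBall o r)} with hA
  have hmono : ∀ r ∈ A, ∀ r' ≤ r, r' ∈ A := fun r hr r' hr' =>
    IsCompact.of_isClosed_subset hr Metric.isClosed_closedEBall (Metric.closedEBall_subset_closedEBall hr')
  by_cases hlt : R < sSup A
  · obtain ⟨r, hr, hRr⟩ := lt_sSup_iff.1 hlt
    exact hmono r hr R hRr.le
  exfalso
  set s := sSup A with hs
  have hsfin : s ≠ ⊤ := ne_top_of_le_ne_top hR (not_lt.1 hlt)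
  have hsA : s ∈ A := by
    refine isCompact_iff_totallyBounded_isComplete.2
      ⟨?_, Metric.isClosed_closedEBall.isComplete⟩
    refine EMetric.totallyBounded_iff.2 fun ε hε => ?_
    by_cases hex : ∃ r ∈ A, s < r + ε / 2
    · obtain ⟨r, hr, hsr⟩ := hex
      obtain ⟨t, ht, hcov⟩ := EMetric.totallyBounded_iff.1 (IsCompact.totallyBounded hr) (ε / 2)
        (ENNReal.half_pos hε.ne')
      refine ⟨t, ht, fun q hq => ?_⟩
      rw [Metric.mem_closedEBall, edist_comm] at hq
      obtain ⟨m, hm, hmq⟩ := hlen q r (ε / 2) (ENNReal.half_pos hε.ne') (hq.trans_lt hsr)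
      obtain ⟨x, hx, hmx⟩ := mem_iUnion₂.1 (hcov (show m ∈ Metric.closedEBall o r by
        rwa [Metric.mem_closedEBall, edist_comm]))
      refine mem_iUnion₂.2 ⟨x, hx, ?_⟩
      rw [Metric.mem_eball] at hmx ⊢
      rw [edist_comm] at hmq
      calc edist q x ≤ edist q m + edist m x := edist_triangle _ _ _
        _ < ε / 2 + ε / 2 := ENNReal.add_lt_add hmq hmx
        _ = ε := ENNReal.add_halves ε
    · push Not at hex
      have hs0 : s = 0 := by
        by_contra hs0
        have h1 : s ≤ s - ε / 2 := sSup_le fun r hr => ENNReal.le_sub_of_add_le_right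
          (ne_top_of_le_ne_top hsfin (le_add_self.trans (hex r hr))) (hex r hr)
        exact absurd h1 (not_le.2 (ENNReal.sub_lt_self hsfin hs0 (ENNReal.half_pos hε.ne').ne'))
      refine ⟨{o}, finite_singleton o, fun q hq => ?_⟩
      rw [Metric.mem_closedEBall, hs0] at hq
      simpa using hq.trans_lt hε
  obtain ⟨N, hN, hsN⟩ := exists_compact_superset hsA
  obtain ⟨V, hV, -, hVN⟩ := lebesgue_number_of_compact_open hsA isOpen_interior hsN
  obtain ⟨ε, hε, hεV⟩ := mem_uniformity_edist.1 hV
  obtain ⟨η, hη, hηε⟩ := exists_between hε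
  have hsη : s + η ∈ A := by
    refine hN.of_isClosed_subset Metric.isClosed_closedEBall fun q hq => ?_
    rw [Metric.mem_closedEBall, edist_comm] at hq
    obtain ⟨m, hm, hmq⟩ := hlen q s ε hε
      (hq.trans_lt ((ENNReal.add_lt_add_iff_left hsfin).2 hηε))
    exact interior_subset (hVN m (by rwa [Metric.mem_closedEBall, edist_comm]) (hεV hmq))
  exact absurd (le_sSup hsη) (not_le.2 (ENNReal.lt_add_right hsfin hη.ne'))

end HopfRinow

section Distance

variable {n : ℕ} {H : Type*} [TopologicalSpace H]
  {I : ModelWithCorners ℝ (EuclideanSpace ℝ (Fin n)) H}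
  {M : Type*} [TopologicalSpace M] [ChartedSpace H M] [IsManifold I ∞ M]

theorem riemannianDist_self (g : Metric I M) (p : M) : riemannianDist g p p = 0 := by
  let _ : Bundle.RiemannianBundle (fun p : M => TangentSpace I p) := ⟨g.toRiemannianMetric⟩
  exact Manifold.riemannianEDist_self

theorem riemannianDist_comm (g : Metric I M) (p q : M) :
    riemannianDist g p q = riemannianDist g q p := by
  let _ : Bundle.RiemannianBundle (fun p : M => TangentSpace I p) := ⟨g.toRiemannianMetric⟩
  exact Manifold.riemannianEDist_comm

theorem riemannianDist_triangle (g : Metric I M) (p q r : M) :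
    riemannianDist g p r ≤ riemannianDist g p q + riemannianDist g q r := by
  let _ : Bundle.RiemannianBundle (fun p : M => TangentSpace I p) := ⟨g.toRiemannianMetric⟩
  have : IsManifold I 1 M := IsManifold.of_le (n := ∞) (by simp)
  exact Manifold.riemannianEDist_triangle

theorem eventually_riemannianDist_lt (g : Metric I M) (p : M) {c : ℝ≥0∞} (hc : 0 < c) :
    ∀ᶠ q in 𝓝 p, riemannianDist g p q < c := by
  let _ : Bundle.RiemannianBundle (fun p : M => TangentSpace I p) := ⟨g.toRiemannianMetric⟩
  have : IsManifold I 1 M := IsManifold.of_le (n := ∞) (by simp)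
  have : IsContinuousRiemannianBundle (EuclideanSpace ℝ (Fin n))
      (fun p : M => TangentSpace I p) := ⟨⟨g.inner, g.contMDiff.continuous, fun _ _ _ => rfl⟩⟩
  exact eventually_riemannianEDist_lt I p hc

/-- The norm of tangent vectors. -/
noncomputable def tangentNorm (g : Metric I M) (p : M) (v : TangentSpace I p) : ℝ :=
  Real.sqrt (g.inner p v v)

theorem exists_path_of_riemannianDist_lt (g : Metric I M) {p q : M} {r : ℝ≥0∞}
    (h : riemannianDist g p q < r) :
    ∃ γ : ℝ → M, γ 0 = p ∧ γ 1 = q ∧ ContinuousOn γ (Icc 0 1) ∧ ∃ ℓ : ℝ → ℝ → ℝ≥0∞,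
      (∀ s ∈ Icc (0 : ℝ) 1, ∀ t ∈ Icc (0 : ℝ) 1, s ≤ t → riemannianDist g (γ s) (γ t) ≤ ℓ s t) ∧
      (∀ t ∈ Icc (0 : ℝ) 1, ℓ 0 t + ℓ t 1 = ℓ 0 1) ∧ ℓ 0 1 < r := by
  let _ : Bundle.RiemannianBundle (fun p : M => TangentSpace I p) := ⟨g.toRiemannianMetric⟩
  have : IsManifold I 1 M := IsManifold.of_le (n := ∞) (by simp)
  obtain ⟨γ, h0, h1, hγ, hl⟩ := Manifold.exists_lt_of_riemannianEDist_lt h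
  refine ⟨γ, h0, h1, hγ.continuousOn, Manifold.pathELength I γ, fun s hs t ht hst => ?_,
    fun t ht => Manifold.pathELength_add ht.1 ht.2, hl⟩
  exact Manifold.riemannianEDist_le_pathELength (hγ.mono (Icc_subset_Icc hs.1 ht.2)) rfl rfl hst

theorem riemannianDist_le_of_path (g : Metric I M) {γ : ℝ → M}
    (hγ : ContMDiffOn 𝓘(ℝ, ℝ) I 1 γ (Icc 0 1)) {B : ℝ}
    (hB : ∀ t ∈ Ioo (0 : ℝ) 1, tangentNorm g (γ t) (mfderiv 𝓘(ℝ, ℝ) I γ t (1 : ℝ)) ≤ B) :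
    riemannianDist g (γ 0) (γ 1) ≤ ENNReal.ofReal B := by
  let _ : Bundle.RiemannianBundle (fun p : M => TangentSpace I p) := ⟨g.toRiemannianMetric⟩
  have : IsManifold I 1 M := IsManifold.of_le (n := ∞) (by simp)
  refine (Manifold.riemannianEDist_le_pathELength hγ rfl rfl zero_le_one).trans ?_
  rw [Manifold.pathELength_eq_lintegral_mfderiv_Ioo]
  refine (setLIntegral_mono' measurableSet_Ioo (g := fun _ => ENNReal.ofReal B)
    fun t ht => ?_).trans ?_
  · rw [← ofReal_norm]
    refine ENNReal.ofReal_le_ofReal ?_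
    rw [norm_eq_sqrt_real_inner]
    exact hB t ht
  · simp

/-- The Riemannian distance between two points of a chart, in terms of the metric along the segment
between them. -/
theorem riemannianDist_le_of_segment (g : Metric I M) (x : M) {S : Set (EuclideanSpace ℝ (Fin n))}
    (hS : Convex ℝ S) (hST : S ⊆ interior (extChartAt I x).target)
    {y z : EuclideanSpace ℝ (Fin n)} (hy : y ∈ S) (hz : z ∈ S) {B : ℝ}
    (hB : ∀ w ∈ S, Real.sqrt (metricForm g x w (z - y) (z - y)) ≤ B) :
    riemannianDist g ((extChartAt I x).symm y) ((extChartAt I x).symm z) ≤ ENNReal.ofReal B := by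
  set c : ℝ → EuclideanSpace ℝ (Fin n) := fun t => y + t • (z - y) with hc
  have hcS : ∀ t ∈ Icc (0 : ℝ) 1, c t ∈ S := fun t ht => hS.add_smul_sub_mem hy hz ht
  have hcs : ContDiff ℝ 1 c := by fun_prop
  have hcd : ∀ t, HasDerivAt c (z - y) t := by
    intro t
    have : HasDerivAt c ((1 : ℝ) • (z - y)) t :=
      ((hasDerivAt_id t).smul_const (z - y)).const_add y
    rwa [one_smul] at this
  have h := riemannianDist_le_of_path g (γ := fun t => (extChartAt I x).symm (c t)) (B := B)
    ((contMDiffOn_extChartAt_symm (n := 1) x).comp hcs.contMDiff.contMDiffOn fun t ht =>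
      show c t ∈ (extChartAt I x).target from interior_subset (hST (hcS t ht))) fun t ht => ?_
  · simpa [hc] using h
  · have h1 : HasMFDerivAt 𝓘(ℝ, ℝ) 𝓘(ℝ, EuclideanSpace ℝ (Fin n)) c t
        (ContinuousLinearMap.toSpanSingleton ℝ (z - y)) :=
      (hcd t).hasFDerivAt.hasMFDerivAt
    have h2 := (hasMFDerivAt_extChartAt_symm (hST (hcS t (Ioo_subset_Icc_self ht)))).comp t h1
    have h3 : mfderiv 𝓘(ℝ, ℝ) I (fun t => (extChartAt I x).symm (c t)) t (1 : ℝ) =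
        frame I x (c t) (z - y) := by
      refine (congrArg (fun L => L (1 : ℝ)) h2.mfderiv).trans ?_
      change frame I x (c t) ((1 : ℝ) • (z - y)) = _
      rw [one_smul]
    rw [h3]
    exact hB _ (hcS t (Ioo_subset_Icc_self ht))

theorem continuous_riemannianDist [T2Space M] (g : Metric I M) (o : M) :
    Continuous (riemannianDist g o) := by
  have hlc : LocallyCompactSpace M := Manifold.locallyCompact_of_finiteDimensional I
  have hreg : RegularSpace M := inferInstance
  let _ : Bundle.RiemannianBundle (fun p : M => TangentSpace I p) := ⟨g.toRiemannianMetric⟩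
  have : IsManifold I 1 M := IsManifold.of_le (n := ∞) (by simp)
  have : IsContinuousRiemannianBundle (EuclideanSpace ℝ (Fin n))
      (fun p : M => TangentSpace I p) := ⟨⟨g.inner, g.contMDiff.continuous, fun _ _ _ => rfl⟩⟩
  let m : PseudoEMetricSpace M := PseudoEMetricSpace.ofRiemannianMetric I M
  have h : @Continuous M ℝ≥0∞ m.toUniformSpace.toTopologicalSpace _ (fun p => edist o p) :=
    continuous_const.edist continuous_id
  exact h

/-- The Riemannian distance is a length distance. -/
theorem exists_riemannianDist_between [T2Space M] (g : Metric I M) (o q : M) {a b : ℝ≥0∞} (hb : 0 < b)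
    (h : riemannianDist g o q < a + b) :
    ∃ m, riemannianDist g o m ≤ a ∧ riemannianDist g m q < b := by
  by_cases hqa : riemannianDist g o q ≤ a
  · exact ⟨q, hqa, by rwa [riemannianDist_self]⟩
  have hcont := continuous_riemannianDist g o
  obtain ⟨γ, h0, h1, hγ, ℓ, hℓ, hadd, hlt⟩ := exists_path_of_riemannianDist_lt g h
  have hivt := intermediate_value_Icc zero_le_one (hcont.comp_continuousOn hγ)
  simp only [Function.comp_apply, h0, h1, riemannianDist_self] at hivt
  obtain ⟨t, ht, hta⟩ := hivt ⟨bot_le, (not_le.1 hqa).le⟩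
  refine ⟨γ t, hta.le, ?_⟩
  have ha : a ≠ ⊤ := fun ha => hqa (ha ▸ le_top)
  have h2 : a ≤ ℓ 0 t := by
    have := hℓ 0 ⟨le_rfl, zero_le_one⟩ t ht ht.1
    rw [h0] at this
    exact hta ▸ this
  have h3 : riemannianDist g (γ t) q ≤ ℓ t 1 := by
    have := hℓ t ht 1 ⟨zero_le_one, le_rfl⟩ ht.2
    rwa [h1] at this
  refine h3.trans_lt ((ENNReal.add_lt_add_iff_left ha).1 ?_)
  calc a + ℓ t 1 ≤ ℓ 0 t + ℓ t 1 := by gcongr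
    _ = ℓ 0 1 := hadd t ht
    _ < a + b := hlt

theorem riemannianDist_lt_top [ConnectedSpace M] (g : Metric I M) (o p : M) :
    riemannianDist g o p < ⊤ := by
  set S := {p | riemannianDist g o p < ⊤} with hS
  have key : ∀ p, ∃ V, IsOpen V ∧ p ∈ V ∧ ∀ q ∈ V, riemannianDist g p q < ⊤ := by
    intro p
    obtain ⟨V, hV, hVo, hpV⟩ := eventually_nhds_iff.1 (eventually_riemannianDist_lt g p
      (c := ⊤) (by simp))
    exact ⟨V, hVo, hpV, hV⟩
  have hopen : IsOpen S := by
    rw [isOpen_iff_forall_mem_open]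
    intro p hp
    obtain ⟨V, hV, hpV, h⟩ := key p
    exact ⟨V, fun q hq => (riemannianDist_triangle g o p q).trans_lt
      (ENNReal.add_lt_top.2 ⟨hp, h q hq⟩), hV, hpV⟩
  have hclosed : IsClosed S := by
    refine isClosed_of_closure_subset fun p hp => ?_
    obtain ⟨V, hV, hpV, h⟩ := key p
    obtain ⟨q, hqV, hqS⟩ := mem_closure_iff.1 hp V hV hpV
    refine (riemannianDist_triangle g o q p).trans_lt (ENNReal.add_lt_top.2 ⟨hqS, ?_⟩)
    rw [riemannianDist_comm]
    exact h q hqV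
  have : S = univ := IsClopen.eq_univ ⟨hclosed, hopen⟩ ⟨o, by
    simp [hS, riemannianDist_self]⟩
  exact (this ▸ mem_univ p : p ∈ S)

/-- Closed balls of a complete Riemannian manifold are compact. -/
theorem isCompact_riemannianDist_le [T2Space M] (g : Metric I M)
    (hg : IsCompleteMetric g) (o : M) {R : ℝ≥0∞} (hR : R ≠ ⊤) :
    IsCompact {p | riemannianDist g o p ≤ R} := by
  have hlc : LocallyCompactSpace M := Manifold.locallyCompact_of_finiteDimensional I
  have hreg : RegularSpace M := inferInstance
  let _ : Bundle.RiemannianBundle (fun p : M => TangentSpace I p) := ⟨g.toRiemannianMetric⟩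
  have : IsManifold I 1 M := IsManifold.of_le (n := ∞) (by simp)
  have : IsContinuousRiemannianBundle (EuclideanSpace ℝ (Fin n))
      (fun p : M => TangentSpace I p) := ⟨⟨g.inner, g.contMDiff.continuous, fun _ _ _ => rfl⟩⟩
  let m : PseudoEMetricSpace M := PseudoEMetricSpace.ofRiemannianMetric I M
  have hcomplete : @CompleteSpace M m.toUniformSpace := by
    refine @EMetric.complete_of_cauchySeq_tendsto M m fun x hx => ?_
    refine hg x fun ε hε => ?_
    obtain ⟨N, hN⟩ := EMetric.cauchySeq_iff.1 hx ε hε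
    exact ⟨N, fun i hi j hj => hN i hi j hj⟩
  have := @isCompact_closedEBall_of_length M m hcomplete hlc o
    (fun q a b hb h => exists_riemannianDist_between g o q hb h) R hR
  have hset : {p | riemannianDist g o p ≤ R} = Metric.closedEBall o R := by
    ext p
    exact iff_of_eq (congrArg (· ≤ R) (riemannianDist_comm g o p))
  rw [hset]
  exact this

end Distance

section LipschitzFunction

variable {n : ℕ} {H : Type*} [TopologicalSpace H]
  {I : ModelWithCorners ℝ (EuclideanSpace ℝ (Fin n)) H}
  {M : Type*} [TopologicalSpace M] [ChartedSpace H M] [IsManifold I ∞ M]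
  {g : Metric I M} {f : M → ℝ} {c : ℝ}

theorem exists_eventually_norm_apply_le {α V W : Type*} [TopologicalSpace α]
    [NormedAddCommGroup V] [NormedSpace ℝ V] [NormedAddCommGroup W] [NormedSpace ℝ W]
    {b : α → V →L[ℝ] W} {y : α} (h : ContinuousAt b y) :
    ∃ C : ℝ, 0 ≤ C ∧ ∀ᶠ w in 𝓝 y, ∀ v, ‖b w v‖ ≤ C * ‖v‖ := by
  refine ⟨‖b y‖ + 1, by positivity, ?_⟩
  filter_upwards [h.norm.eventually_lt_const (lt_add_one ‖b y‖)] with w hw v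
  exact ((b w).le_opNorm v).trans (mul_le_mul_of_nonneg_right hw.le (norm_nonneg v))

theorem exists_eventually_apply_self_le {α V : Type*} [TopologicalSpace α]
    [NormedAddCommGroup V] [NormedSpace ℝ V] {b : α → V →L[ℝ] V →L[ℝ] ℝ} {y : α}
    (h : ContinuousAt b y) : ∃ C : ℝ, 0 ≤ C ∧ ∀ᶠ w in 𝓝 y, ∀ v, b w v v ≤ C * ‖v‖ ^ 2 := by
  obtain ⟨C, hC, hb⟩ := exists_eventually_norm_apply_le h
  refine ⟨C, hC, ?_⟩
  filter_upwards [hb] with w hw v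
  have h1 := (le_abs_self _).trans ((b w v).le_opNorm v)
  have h2 := mul_le_mul_of_nonneg_right (hw v) (norm_nonneg v)
  nlinarith

theorem abs_sub_le_of_segment (hc : 0 ≤ c)
    (hf : ∀ p q, |f p - f q| ≤ c * (riemannianDist g p q).toReal) (x : M)
    {S : Set (EuclideanSpace ℝ (Fin n))} (hS : Convex ℝ S)
    (hST : S ⊆ interior (extChartAt I x).target) {y z : EuclideanSpace ℝ (Fin n)} (hy : y ∈ S)
    (hz : z ∈ S) {B : ℝ} (hB : ∀ w ∈ S, Real.sqrt (metricForm g x w (z - y) (z - y)) ≤ B) :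
    |f ((extChartAt I x).symm y) - f ((extChartAt I x).symm z)| ≤ c * B := by
  refine (hf _ _).trans (mul_le_mul_of_nonneg_left ?_ hc)
  exact ENNReal.toReal_le_of_le_ofReal ((Real.sqrt_nonneg _).trans (hB y hy))
    (riemannianDist_le_of_segment g x hS hST hy hz hB)

theorem mdifferentiableAt_of_comp_extChartAt_symm {x : M} {y : EuclideanSpace ℝ (Fin n)}
    (hy : y ∈ (extChartAt I x).target)
    (h : DifferentiableAt ℝ (fun y => f ((extChartAt I x).symm y)) y) :
    MDifferentiableAt I 𝓘(ℝ, ℝ) f ((extChartAt I x).symm y) := by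
  have : IsManifold I 1 M := IsManifold.of_le (n := ∞) (by simp)
  have hs := (extChartAt I x).map_target hy
  have h1 : MDifferentiableAt I 𝓘(ℝ, EuclideanSpace ℝ (Fin n)) (extChartAt I x)
      ((extChartAt I x).symm y) := mdifferentiableAt_extChartAt (by simpa using hs)
  have h2 : MDifferentiableAt 𝓘(ℝ, EuclideanSpace ℝ (Fin n)) 𝓘(ℝ, ℝ)
      (fun y => f ((extChartAt I x).symm y)) (extChartAt I x ((extChartAt I x).symm y)) := by
    rw [(extChartAt I x).right_inv hy]
    exact h.mdifferentiableAt
  refine (h2.comp _ h1).congr_of_eventuallyEq ?_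
  filter_upwards [(isOpen_extChartAt_source x).mem_nhds hs] with q hq
  simp only [Function.comp_apply, (extChartAt I x).left_inv hq]

/-- A function that is Lipschitz for the Riemannian distance is weakly differentiable. -/
theorem HasWeakDiffOn.of_lipschitz (hc : 0 ≤ c)
    (hf : ∀ p q, |f p - f q| ≤ c * (riemannianDist g p q).toReal) :
    HasWeakDiffOn I univ f (differential I f) := by
  intro x
  rw [chartDomain_univ]
  refine IsWeakDiffOn.of_local fun y hy => ?_
  have hcont : ContinuousAt (metricForm g x) y :=
    ((contDiffOn_metricForm g x).continuousOn).continuousAt (mem_interior_iff_mem_nhds.1 hy)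
  obtain ⟨C, hC, hev⟩ := exists_eventually_apply_self_le hcont
  obtain ⟨r, hr, hball⟩ := Metric.eventually_nhds_iff_ball.1
    (hev.and (isOpen_interior.mem_nhds hy))
  set N := Metric.ball y r with hN
  have hNT : N ⊆ interior (extChartAt I x).target := fun w hw => (hball w hw).2
  have hlip : LipschitzOnWith (c * Real.sqrt C).toNNReal (fun y => f ((extChartAt I x).symm y)) N := by
    refine LipschitzOnWith.of_dist_le_mul fun z hz w hw => ?_
    rw [Real.coe_toNNReal _ (mul_nonneg hc (Real.sqrt_nonneg _)), Real.dist_eq, mul_assoc]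
    refine abs_sub_le_of_segment hc hf x (convex_ball y r) hNT hz hw fun w' hw' => ?_
    calc Real.sqrt (metricForm g x w' (w - z) (w - z))
        ≤ Real.sqrt (C * ‖w - z‖ ^ 2) := Real.sqrt_le_sqrt ((hball w' hw').1 _)
      _ = Real.sqrt C * dist z w := by
        rw [Real.sqrt_mul hC, Real.sqrt_sq (norm_nonneg _), dist_comm, dist_eq_norm]
  obtain ⟨F, hF, hFN⟩ := hlip.extend_real
  refine ⟨N, Metric.isOpen_ball, Metric.mem_ball_self hr,
    (IsWeakDiffOn.of_lipschitzWith hF N).congr hFN.symm ?_⟩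
  filter_upwards [hF.ae_differentiableAt] with z hz hzN
  have heq : F =ᶠ[𝓝 z] fun y => f ((extChartAt I x).symm y) := by
    filter_upwards [Metric.isOpen_ball.mem_nhds hzN] with w hw
    exact (hFN hw).symm
  rw [heq.fderiv_eq]
  exact fderiv_comp_extChartAt_symm (hNT hzN) (mdifferentiableAt_of_comp_extChartAt_symm
    (interior_subset (hNT hzN)) (hz.congr_of_eventuallyEq heq.symm))

theorem abs_fderiv_le_of_lipschitz (hc : 0 ≤ c)
    (hf : ∀ p q, |f p - f q| ≤ c * (riemannianDist g p q).toReal) {x : M}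
    {y : EuclideanSpace ℝ (Fin n)} (hy : y ∈ interior (extChartAt I x).target)
    (hd : DifferentiableAt ℝ (fun y => f ((extChartAt I x).symm y)) y)
    (v : EuclideanSpace ℝ (Fin n)) :
    |fderiv ℝ (fun y => f ((extChartAt I x).symm y)) y v| ≤
      c * Real.sqrt (metricForm g x y v v) := by
  refine le_of_forall_pos_le_add fun ε hε => ?_
  set δ := ε / (c + 1) with hδ
  have hc1 : 0 < c + 1 := by linarith
  have hδ0 : 0 < δ := div_pos hε hc1
  set s := Real.sqrt (metricForm g x y v v) + δ with hs
  have hs0 : 0 ≤ s := add_nonneg (Real.sqrt_nonneg _) hδ0.le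
  have hcont : ContinuousAt (fun w => Real.sqrt (metricForm g x w v v)) y :=
    (((contDiffOn_metricForm_apply g x v v).continuousOn).continuousAt
      (mem_interior_iff_mem_nhds.1 hy)).sqrt
  obtain ⟨r, hr, hball⟩ := Metric.eventually_nhds_iff_ball.1
    ((hcont.eventually_lt_const (show Real.sqrt (metricForm g x y v v) < s by linarith)).and
      (isOpen_interior.mem_nhds hy))
  have hline : HasDerivAt (fun t : ℝ => f ((extChartAt I x).symm (y + t • v)))
      (fderiv ℝ (fun y => f ((extChartAt I x).symm y)) y v) 0 :=
    (hd.hasFDerivAt.hasLineDerivAt v)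
  have hev : ∀ᶠ t : ℝ in 𝓝 0, y + t • v ∈ Metric.ball y r := by
    have hct : ContinuousAt (fun t : ℝ => y + t • v) 0 := by fun_prop
    refine hct.eventually_mem ?_
    simpa using Metric.ball_mem_nhds y hr
  have hle : ‖fderiv ℝ (fun y => f ((extChartAt I x).symm y)) y v‖ ≤ c * s := by
    refine hline.le_of_lip' (mul_nonneg hc hs0) ?_
    filter_upwards [hev] with t ht
    have h1 := abs_sub_le_of_segment hc hf x (convex_ball y r) (fun w hw => (hball w hw).2) ht
      (Metric.mem_ball_self hr) (B := |t| * s) fun w hw => by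
        have h2 : y - (y + t • v) = (-t) • v := by rw [neg_smul]; abel
        rw [h2, map_smul, smul_eq_mul, map_smul, smul_apply, smul_eq_mul, ← mul_assoc,
          Real.sqrt_mul (mul_self_nonneg _), Real.sqrt_mul_self_eq_abs, abs_neg]
        exact mul_le_mul_of_nonneg_left (hball w hw).1.le (abs_nonneg t)
    simp only [zero_smul, add_zero, sub_zero, Real.norm_eq_abs]
    linarith
  rw [Real.norm_eq_abs] at hle
  refine hle.trans ?_
  have : c * δ ≤ ε := by
    rw [hδ, mul_div_assoc', div_le_iff₀ hc1]
    nlinarith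
  rw [hs, mul_add]
  linarith

theorem abs_differential_le_of_lipschitz (hc : 0 ≤ c)
    (hf : ∀ p q, |f p - f q| ≤ c * (riemannianDist g p q).toReal) {p : M}
    (hp : p ∈ I.interior M) (v : TangentSpace I p) :
    |differential I f p v| ≤ c * Real.sqrt (g.inner p v v) := by
  by_cases hd : MDifferentiableAt I 𝓘(ℝ, ℝ) f p
  swap
  · have h0 : differential I f p = 0 := mfderiv_zero_of_not_mdifferentiableAt hd
    rw [h0, zero_apply, abs_zero]
    exact mul_nonneg hc (Real.sqrt_nonneg _)
  have key : ∀ q : M, q = p → (∀ v : TangentSpace I q,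
      |differential I f q v| ≤ c * Real.sqrt (g.inner q v v)) →
      |differential I f p v| ≤ c * Real.sqrt (g.inner p v v) := by
    rintro _ rfl h
    exact h v
  have hp' := (mem_interior_iff_extChartAt (mem_extChartAt_source (I := I) p)).1 hp
  refine key _ (extChartAt_to_inv (I := I) p) fun v => ?_
  have hd' : MDifferentiableAt I 𝓘(ℝ, ℝ) f ((extChartAt I p).symm (extChartAt I p p)) := by
    rwa [extChartAt_to_inv]
  obtain ⟨w, rfl⟩ := (frame_bijective (interior_subset hp')).2 v
  have h1 := fderiv_comp_extChartAt_symm hp' hd'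
  have hdiff : DifferentiableAt ℝ (fun y => f ((extChartAt I p).symm y)) (extChartAt I p p) := by
    have hh : ∀ L : EuclideanSpace ℝ (Fin n) →L[ℝ] ℝ, HasFDerivAt (fun y =>
        f ((extChartAt I p).symm y)) L (extChartAt I p p) → DifferentiableAt ℝ
        (fun y => f ((extChartAt I p).symm y)) (extChartAt I p p) :=
      fun L hL => hL.differentiableAt
    exact hh _ (hasFDerivAt_comp_extChartAt_symm hp' hd')
  have h2 := abs_fderiv_le_of_lipschitz hc hf hp' hdiff w
  rw [h1] at h2
  exact h2

/-- Cutoff functions with small gradient on a complete manifold. -/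
theorem exists_cutoff_of_complete [T2Space M] [ConnectedSpace M] (hg : IsCompleteMetric g)
    (hint : I.interior M = univ) :
    ∃ (ρ : ℕ → M → ℝ) (C : ℕ → Set M), ∀ k, IsCompact (C k) ∧
      HasWeakDiffOn I univ (ρ k) (differential I (ρ k)) ∧ (∀ p, 0 ≤ ρ k p) ∧
      (∀ p ∉ C k, ρ k p = 0) ∧
      (∀ p v, |differential I (ρ k) p v| ≤ 1 / ((k : ℝ) + 1) * Real.sqrt (g.inner p v v)) ∧
      ∀ p, Tendsto (fun k => ρ k p) atTop (𝓝 1) := by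
  obtain ⟨o⟩ : Nonempty M := inferInstance
  set d : M → ℝ := fun p => (riemannianDist g o p).toReal with hd
  have hfin := riemannianDist_lt_top g
  have hdle : ∀ p q, d p - d q ≤ (riemannianDist g p q).toReal := by
    intro p q
    have h1 := riemannianDist_triangle g o q p
    have h2 := ENNReal.toReal_mono (ENNReal.add_lt_top.2 ⟨hfin o q, hfin q p⟩).ne h1
    rw [ENNReal.toReal_add (hfin o q).ne (hfin q p).ne, riemannianDist_comm g q p] at h2
    simp only [hd]
    linarith
  have hdabs : ∀ p q, |d p - d q| ≤ (riemannianDist g p q).toReal := by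
    intro p q
    rw [abs_sub_le_iff]
    refine ⟨hdle p q, ?_⟩
    rw [riemannianDist_comm]
    exact hdle q p
  refine ⟨fun k p => max (1 - d p / ((k : ℝ) + 1)) 0,
    fun k => {p | riemannianDist g o p ≤ ENNReal.ofReal ((k : ℝ) + 1)}, fun k => ?_⟩
  have hk : 0 < (k : ℝ) + 1 := by positivity
  have hCc := isCompact_riemannianDist_le g hg o (R := ENNReal.ofReal ((k : ℝ) + 1))
    ENNReal.ofReal_ne_top
  have hlip : ∀ p q, |max (1 - d p / ((k : ℝ) + 1)) 0 - max (1 - d q / ((k : ℝ) + 1)) 0| ≤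
      1 / ((k : ℝ) + 1) * (riemannianDist g p q).toReal := by
    intro p q
    refine (abs_max_sub_max_le_abs _ _ _).trans ?_
    have h1 : 1 - d p / ((k : ℝ) + 1) - (1 - d q / ((k : ℝ) + 1)) =
        1 / ((k : ℝ) + 1) * (d q - d p) := by ring
    rw [h1, abs_mul, abs_of_pos (one_div_pos.2 hk), abs_sub_comm]
    exact mul_le_mul_of_nonneg_left (hdabs p q) (one_div_pos.2 hk).le
  have hzero : ∀ p ∉ {p | riemannianDist g o p ≤ ENNReal.ofReal ((k : ℝ) + 1)},
      max (1 - d p / ((k : ℝ) + 1)) 0 = 0 := by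
    intro p hp
    refine max_eq_right (sub_nonpos.2 ((one_le_div hk).2 ?_))
    exact ((ENNReal.ofReal_lt_iff_lt_toReal hk.le (hfin o p).ne).1 (not_le.1 hp)).le
  refine ⟨hCc, HasWeakDiffOn.of_lipschitz (one_div_pos.2 hk).le hlip, fun p => le_max_right _ _,
    hzero, fun p v => ?_, fun p => ?_⟩
  · exact abs_differential_le_of_lipschitz (one_div_pos.2 hk).le hlip (hint ▸ mem_univ p) v
  · have h1 : Tendsto (fun k : ℕ => d p / ((k : ℝ) + 1)) atTop (𝓝 0) :=
      tendsto_const_nhds.div_atTop (tendsto_natCast_atTop_atTop.atTop_add tendsto_const_nhds)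
    have h2 : Tendsto (fun k : ℕ => max (1 - d p / ((k : ℝ) + 1)) 0) atTop (𝓝 (max (1 - 0) 0)) :=
      (tendsto_const_nhds.sub h1).max tendsto_const_nhds
    simpa using h2

end LipschitzFunction

section Parabolicity

variable {n : ℕ} {H : Type*} [TopologicalSpace H]
  {I : ModelWithCorners ℝ (EuclideanSpace ℝ (Fin n)) H}
  {M : Type*} [TopologicalSpace M] [ChartedSpace H M] [IsManifold I ∞ M]
  [T2Space M] [SecondCountableTopology M] [ConnectedSpace M] [MeasurableSpace M] [BorelSpace M]
  {g : Metric I M} {u : M → ℝ} {X : ∀ p : M, TangentSpace I p}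

theorem inner_self_nonneg (g : Metric I M) (p : M) (v : TangentSpace I p) :
    0 ≤ g.inner p v v := by
  by_cases hv : v = 0
  · rw [hv, map_zero]
  · exact (g.pos p v hv).le

theorem weighted_cauchy {e r c s t : ℝ} (he0 : 0 ≤ e) (he1 : e ≤ 1) (hr : 0 ≤ r)
    (ht : |t| ≤ c * s) :
    e * (r * t + r * t) - r * r * e * s ^ 2 ≤ 2 * c ^ 2 - r * r * e * s ^ 2 / 2 := by
  have h1 : e * r * t ≤ e * r * (c * s) :=
    mul_le_mul_of_nonneg_left ((le_abs_self t).trans ht) (mul_nonneg he0 hr)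
  have h2 := mul_nonneg he0 (sq_nonneg (r * s - 2 * c))
  have h3 := mul_nonneg (sub_nonneg.2 he1) (sq_nonneg c)
  nlinarith

/-- The energy estimate for the logarithm-type transform `exp (-u)` of a nonnegative supersolution
tested with a cutoff function. -/
theorem IsSupersolution.integral_energy_le (hX : IsSupersolution g X)
    (hint : I.interior M = univ) (hvol : volumeMeasure g univ < ⊤)
    (huc : Continuous u) (hu0 : ∀ p, 0 ≤ u p) (hu : HasWeakDiffOn I univ u (flat g X))
    {ρ : M → ℝ} {θ : ∀ p : M, TangentSpace I p →L[ℝ] ℝ} {C : Set M} {c : ℝ}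
    (hρ : HasWeakDiffOn I univ ρ θ) (hC : IsCompact C) (hρ0 : ∀ p, 0 ≤ ρ p)
    (hρC : ∀ p ∉ C, ρ p = 0)
    (hθ : ∀ p v, |θ p v| ≤ c * Real.sqrt (g.inner p v v)) :
    Integrable (fun p => ρ p * ρ p * Real.exp (-u p) * g.inner p (X p) (X p)) (volumeMeasure g) ∧
      ∫ p, ρ p * ρ p * Real.exp (-u p) * g.inner p (X p) (X p) ∂(volumeMeasure g) ≤
        4 * c ^ 2 * (volumeMeasure g).real univ := by
  have hfin : IsFiniteMeasure (volumeMeasure g) := ⟨hvol⟩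
  have hΦ : ContDiff ℝ ∞ fun t : ℝ => Real.exp (-t) := by fun_prop
  have hΦ' : ∀ t : ℝ, deriv (fun t : ℝ => Real.exp (-t)) t = -Real.exp (-t) := fun t => by
    simpa using ((hasDerivAt_neg t).exp).deriv
  have hρ2 := hρ.mul isOpen_univ hρ
  have hw := hρ2.mul isOpen_univ (hu.comp isOpen_univ hΦ)
  obtain ⟨hi2, -⟩ := hX.integral_nonneg hu hρ2 (fun p => mul_nonneg (hρ0 p) (hρ0 p)) hC
    (hint ▸ subset_univ C) (fun p hp => by rw [hρC p hp, zero_mul])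
    (fun p hp => by rw [hρC p hp, zero_smul, add_zero])
  obtain ⟨hiw, hnw⟩ := hX.integral_nonneg hu hw
    (fun p => mul_nonneg (mul_nonneg (hρ0 p) (hρ0 p)) (Real.exp_nonneg _)) hC
    (hint ▸ subset_univ C) (fun p hp => by rw [hρC p hp, zero_mul, zero_mul])
    (fun p hp => by
      rw [hρC p hp, zero_smul, zero_mul, zero_smul, add_zero, add_zero, smul_zero])
  have he1 : ∀ p, Real.exp (-u p) ≤ 1 := fun p => Real.exp_le_one_iff.2 (neg_nonpos.2 (hu0 p))
  have hform : ∀ p, (Real.exp (-u p) • (ρ p • θ p + ρ p • θ p) + (ρ p * ρ p) •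
      (deriv (fun t : ℝ => Real.exp (-t)) (u p) • flat g X p)) (X p) =
      Real.exp (-u p) * (ρ p * θ p (X p) + ρ p * θ p (X p)) -
        ρ p * ρ p * Real.exp (-u p) * g.inner p (X p) (X p) := by
    intro p
    rw [hΦ', add_apply, smul_apply, add_apply, smul_apply, smul_apply, smul_apply, flat]
    simp only [smul_eq_mul]
    ring
  have hi2' : Integrable (fun p => Real.exp (-u p) * (ρ p * θ p (X p) + ρ p * θ p (X p)))
      (volumeMeasure g) := by
    refine (hi2.bdd_mul (c := 1) (hΦ.continuous.comp huc).aestronglyMeasurable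
      (Eventually.of_forall fun p => ?_)).congr (Eventually.of_forall fun p => ?_)
    · rw [Function.comp_apply, Real.norm_of_nonneg (Real.exp_nonneg _)]
      exact he1 p
    · simp only [Function.comp_apply]
      rfl
  have hiw' : Integrable (fun p => Real.exp (-u p) * (ρ p * θ p (X p) + ρ p * θ p (X p)) -
      ρ p * ρ p * Real.exp (-u p) * g.inner p (X p) (X p)) (volumeMeasure g) :=
    hiw.congr (Eventually.of_forall hform)
  have hif : Integrable (fun p => ρ p * ρ p * Real.exp (-u p) * g.inner p (X p) (X p))
      (volumeMeasure g) := by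
    refine (hi2'.sub hiw').congr (Eventually.of_forall fun p => ?_)
    simp only [Pi.sub_apply]
    ring
  refine ⟨hif, ?_⟩
  have h0 : 0 ≤ ∫ p, (Real.exp (-u p) * (ρ p * θ p (X p) + ρ p * θ p (X p)) -
      ρ p * ρ p * Real.exp (-u p) * g.inner p (X p) (X p)) ∂(volumeMeasure g) :=
    hnw.trans_eq (integral_congr_ae (Eventually.of_forall hform))
  have h1 : ∫ p, (Real.exp (-u p) * (ρ p * θ p (X p) + ρ p * θ p (X p)) -
      ρ p * ρ p * Real.exp (-u p) * g.inner p (X p) (X p)) ∂(volumeMeasure g) ≤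
      ∫ p, (2 * c ^ 2 - ρ p * ρ p * Real.exp (-u p) * g.inner p (X p) (X p) / 2)
        ∂(volumeMeasure g) := by
    refine integral_mono hiw' ((integrable_const _).sub (hif.div_const 2)) fun p => ?_
    have h2 := weighted_cauchy (Real.exp_nonneg (-u p)) (he1 p) (hρ0 p) (hθ p (X p))
    rwa [Real.sq_sqrt (inner_self_nonneg g p (X p))] at h2
  rw [integral_sub (integrable_const _) (hif.div_const 2), integral_div, integral_const,
    smul_eq_mul] at h1
  linarith

/-- On a complete manifold of finite volume, a nonnegative superharmonic function has vanishing
weak gradient. -/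
theorem ae_eq_zero_of_isSupersolution (hg : IsCompleteMetric g) (hint : I.interior M = univ)
    (hvol : volumeMeasure g univ < ⊤) (huc : Continuous u) (hu0 : ∀ p, 0 ≤ u p)
    (hu : HasWeakDiffOn I univ u (flat g X)) (hX : IsSupersolution g X) :
    ∀ᵐ p ∂(volumeMeasure g), X p = 0 := by
  obtain ⟨ρ, C, h⟩ := exists_cutoff_of_complete hg hint
  set f : ℕ → M → ℝ≥0∞ := fun k p =>
    ENNReal.ofReal (ρ k p * ρ k p * Real.exp (-u p) * g.inner p (X p) (X p)) with hf
  have hE : ∀ k, Integrable (fun p => ρ k p * ρ k p * Real.exp (-u p) * g.inner p (X p) (X p))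
      (volumeMeasure g) ∧
      ∫ p, ρ k p * ρ k p * Real.exp (-u p) * g.inner p (X p) (X p) ∂(volumeMeasure g) ≤
        4 * (1 / ((k : ℝ) + 1)) ^ 2 * (volumeMeasure g).real univ := fun k =>
    hX.integral_energy_le hint hvol huc hu0 hu (h k).2.1 (h k).1 (h k).2.2.1
      (h k).2.2.2.1 (h k).2.2.2.2.1
  have hfm : ∀ k, AEMeasurable (f k) (volumeMeasure g) := fun k =>
    (hE k).1.aestronglyMeasurable.aemeasurable.ennreal_ofReal
  have hfle : ∀ k, ∫⁻ p, f k p ∂(volumeMeasure g) ≤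
      ENNReal.ofReal (4 * (1 / ((k : ℝ) + 1)) ^ 2 * (volumeMeasure g).real univ) := by
    intro k
    rw [← ofReal_integral_eq_lintegral_ofReal (hE k).1 (Eventually.of_forall fun p =>
      mul_nonneg (mul_nonneg (mul_self_nonneg _) (Real.exp_nonneg _)) (inner_self_nonneg g p _))]
    exact ENNReal.ofReal_le_ofReal (hE k).2
  have hlim : ∀ p, Tendsto (fun k => f k p) atTop
      (𝓝 (ENNReal.ofReal (Real.exp (-u p) * g.inner p (X p) (X p)))) := by
    intro p
    have h1 := (h 0).2.2.2.2.2 p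
    have h2 : Tendsto (fun k => ρ k p * ρ k p * Real.exp (-u p) * g.inner p (X p) (X p)) atTop
        (𝓝 (1 * 1 * Real.exp (-u p) * g.inner p (X p) (X p))) :=
      ((h1.mul h1).mul_const _).mul_const _
    rw [one_mul, one_mul] at h2
    exact ENNReal.tendsto_ofReal h2
  have hzero : Tendsto (fun k : ℕ => ENNReal.ofReal (4 * (1 / ((k : ℝ) + 1)) ^ 2 *
      (volumeMeasure g).real univ)) atTop (𝓝 0) := by
    have h1 : Tendsto (fun k : ℕ => 4 * (1 / ((k : ℝ) + 1)) ^ 2 * (volumeMeasure g).real univ)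
        atTop (𝓝 (4 * 0 ^ 2 * (volumeMeasure g).real univ)) :=
      ((tendsto_one_div_add_atTop_nhds_zero_nat.pow 2).const_mul 4).mul_const _
    have h2 := ENNReal.tendsto_ofReal h1
    simpa using h2
  have hF : ∫⁻ p, ENNReal.ofReal (Real.exp (-u p) * g.inner p (X p) (X p)) ∂(volumeMeasure g) =
      0 := by
    refine le_antisymm ?_ zero_le
    calc ∫⁻ p, ENNReal.ofReal (Real.exp (-u p) * g.inner p (X p) (X p)) ∂(volumeMeasure g)
        = ∫⁻ p, liminf (fun k => f k p) atTop ∂(volumeMeasure g) :=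
          lintegral_congr fun p => (hlim p).liminf_eq.symm
      _ ≤ liminf (fun k => ∫⁻ p, f k p ∂(volumeMeasure g)) atTop := lintegral_liminf_le' hfm
      _ ≤ 0 := by
        rw [← hzero.liminf_eq]
        exact liminf_le_liminf (Eventually.of_forall hfle)
  rw [lintegral_eq_zero_iff' (aemeasurable_of_tendsto_metrizable_ae' hfm
    (Eventually.of_forall hlim))] at hF
  filter_upwards [hF] with p hp
  rw [Pi.zero_apply, ENNReal.ofReal_eq_zero] at hp
  by_contra hne
  exact absurd hp (not_le.2 (mul_pos (Real.exp_pos _) (g.pos p (X p) hne)))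

/-- Complete manifolds of finite volume are parabolic. -/
theorem eq_of_isSuperharmonic_of_finite_volume (hg : IsCompleteMetric g)
    (hint : I.interior M = univ) (hvol : volumeMeasure g univ < ⊤) (hu : IsSuperharmonic g u)
    (hu0 : ∀ p, 0 ≤ u p) (p q : M) : u p = u q := by
  obtain ⟨huc, X, huX, hX⟩ := (isSuperharmonic_iff g u).1 hu
  have hX0 := ae_eq_zero_of_isSupersolution hg hint hvol huc hu0 huX hX
  have key : ∀ p q, u q ≤ u p := by
    intro p q
    by_contra! hlt
    set F : ℝ → ℝ := fun t => expNegInvGlue (t - u p) with hF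
    have hFs : ContDiff ℝ ∞ F := expNegInvGlue.contDiff.comp (contDiff_id.sub contDiff_const)
    have hsup : IsSuperharmonic g fun z => F (u z) := by
      refine (isSuperharmonic_iff g _).2 ⟨hFs.continuous.comp huc,
        fun z => deriv F (u z) • X z, (huX.comp isOpen_univ hFs).congr (fun _ _ => rfl)
        fun z _ => ?_, fun ρ _ _ _ _ => ?_⟩
      · simp only [flat]
        rw [map_smul]
      · refine ge_of_eq (integral_eq_zero_of_ae ?_)
        filter_upwards [hX0] with z hz
        rw [hz, smul_zero, map_zero]
        rfl
    have hpos := pos_of_isSuperharmonic hsup (fun z => expNegInvGlue.nonneg _) (p₀ := q)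
      (expNegInvGlue.pos_of_pos (sub_pos.2 hlt)) p (hint ▸ mem_univ p)
    simp only [hF, sub_self, expNegInvGlue.zero, lt_self_iff_false] at hpos
  exact le_antisymm (key q p) (key p q)

end Parabolicity

section Dimension

variable {n₁ n₂ : ℕ} {H₁ H₂ : Type*} [TopologicalSpace H₁] [TopologicalSpace H₂]
  {I₁ : ModelWithCorners ℝ (EuclideanSpace ℝ (Fin n₁)) H₁}
  {I₂ : ModelWithCorners ℝ (EuclideanSpace ℝ (Fin n₂)) H₂}
  {M₁ M₂ : Type*} [TopologicalSpace M₁] [ChartedSpace H₁ M₁] [IsManifold I₁ ∞ M₁]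
  [TopologicalSpace M₂] [ChartedSpace H₂ M₂] [IsManifold I₂ ∞ M₂]
  {g₁ : Metric I₁ M₁} {g₂ : Metric I₂ M₂} {K₁ : Set M₁} {K₂ : Set M₂}

theorem AreIsometricOutside.dim_eq (h : AreIsometricOutside g₁ g₂ K₁ K₂)
    (hne : K₁ᶜ.Nonempty) : n₁ = n₂ := by
  obtain ⟨φ, hs, ht, h1, h2, -⟩ := h
  obtain ⟨p, hp⟩ := hne
  rw [← hs] at h1 hp
  rw [← ht] at h2
  have hmd : φ.MDifferentiable I₁ I₂ :=
    ⟨h1.mdifferentiableOn (by simp), h2.mdifferentiableOn (by simp)⟩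
  have hbij := hmd.mfderiv_bijective hp
  have key : ∀ L : EuclideanSpace ℝ (Fin n₁) →L[ℝ] EuclideanSpace ℝ (Fin n₂),
      Function.Bijective L → n₁ = n₂ := by
    intro L hL
    simpa using (LinearEquiv.ofBijective (L : EuclideanSpace ℝ (Fin n₁) →ₗ[ℝ]
      EuclideanSpace ℝ (Fin n₂)) hL).finrank_eq
  exact key _ hbij

end Dimension

section Finite

variable {n : ℕ} {H : Type*} [TopologicalSpace H]
  {I : ModelWithCorners ℝ (EuclideanSpace ℝ (Fin n)) H}
  {M : Type*} [TopologicalSpace M] [ChartedSpace H M] [IsManifold I ∞ M]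
  [T2Space M] [SecondCountableTopology M] [ConnectedSpace M] [MeasurableSpace M] [BorelSpace M]
  {g : Metric I M}

theorem isL1Liouville_of_finite_volume (hg : IsCompleteMetric g) (hint : I.interior M = univ)
    (hvol : volumeMeasure g univ < ⊤) : IsL1Liouville g := by
  intro u hu hu0 _
  obtain ⟨o⟩ : Nonempty M := inferInstance
  exact ⟨u o, fun p => eq_of_isSuperharmonic_of_finite_volume hg hint hvol hu hu0 p o⟩

end Finite

section Transfer

variable {n : ℕ} {H₁ H₂ : Type*} [TopologicalSpace H₁] [TopologicalSpace H₂]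
  {I₁ : ModelWithCorners ℝ (EuclideanSpace ℝ (Fin n)) H₁}
  {I₂ : ModelWithCorners ℝ (EuclideanSpace ℝ (Fin n)) H₂}
  {M₁ M₂ : Type*} [TopologicalSpace M₁] [ChartedSpace H₁ M₁] [IsManifold I₁ ∞ M₁]
  [TopologicalSpace M₂] [ChartedSpace H₂ M₂] [IsManifold I₂ ∞ M₂]
  [T2Space M₁] [T2Space M₂] [SecondCountableTopology M₁] [SecondCountableTopology M₂]
  [MeasurableSpace M₁] [BorelSpace M₁] [MeasurableSpace M₂] [BorelSpace M₂]
  {g₁ : Metric I₁ M₁} {g₂ : Metric I₂ M₂} {φ : OpenPartialHomeomorph M₁ M₂}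
  {K₁ : Set M₁} {K₂ : Set M₂}

theorem AreIsometricOutside.exists_isLocalIsometry (h : AreIsometricOutside g₁ g₂ K₁ K₂) :
    ∃ φ : OpenPartialHomeomorph M₁ M₂, IsLocalIsometry g₁ g₂ φ ∧ φ.source = K₁ᶜ ∧
      φ.target = K₂ᶜ := by
  obtain ⟨φ, hs, ht, h1, h2, h3⟩ := h
  refine ⟨φ, ⟨?_, ?_, ?_⟩, hs, ht⟩
  · rwa [hs]
  · rwa [ht]
  · rwa [hs]

theorem IsLocalIsometry.isDirichletL1Liouville [Nonempty M₁] [ConnectedSpace M₂]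
    (h : IsLocalIsometry g₁ g₂ φ) (hK₁ : IsCompact K₁) (hKi : K₁ ⊆ I₁.interior M₁)
    (hs : φ.source = K₁ᶜ) (hL : IsDirichletL1Liouville g₁) : IsDirichletL1Liouville g₂ := by
  intro u hu hub hu0 huint
  by_contra! hne
  obtain ⟨q, hq⟩ := hne
  have hpos := pos_of_isSuperharmonic hu hu0 (lt_of_le_of_ne (hu0 q) hq.symm)
  obtain ⟨L, U, d, ε, -, hKL, ⟨z, hz⟩, hLi, -, hε, hU, hU0, hUint, hUL, hUle, -⟩ :=
    h.exists_transplant hK₁ hKi hs hu hu0 hpos huint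
  have hUz := hL U hU (fun p hp => ?_) hU0 hUint z
  · rw [hUL z hz] at hUz
    exact hε.ne' hUz
  · have hpi : p ∉ I₁.interior M₁ := by
      rw [← I₁.compl_boundary]
      exact fun h => h hp
    have hpL : p ∉ L := fun h => hpi (hLi h)
    have hps : p ∈ φ.source := hs ▸ fun hpK => hpL (hKL hpK)
    have hφ : φ p ∈ I₂.boundary M₂ := by
      rw [← I₂.compl_interior]
      exact fun h' => hpi ((h.mem_interior_iff hps).1 h')
    exact le_antisymm ((hUle p hpL).trans_eq (hub _ hφ)) (hU0 p)

theorem IsLocalIsometry.isL1Liouville [Nonempty M₁] [ConnectedSpace M₂]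
    (h : IsLocalIsometry g₁ g₂ φ) (hI₁ : I₁.interior M₁ = univ) (hI₂ : I₂.interior M₂ = univ)
    (hg₂ : IsCompleteMetric g₂) (hK₁ : IsCompact K₁) (hK₂ : IsCompact K₂)
    (hs : φ.source = K₁ᶜ) (ht : φ.target = K₂ᶜ) (hL : IsL1Liouville g₁) : IsL1Liouville g₂ := by
  intro u hu hu0 huint
  by_cases hzero : ∀ q, u q = 0
  · exact ⟨0, hzero⟩
  push Not at hzero
  obtain ⟨q, hq⟩ := hzero
  have hpos := pos_of_isSuperharmonic hu hu0 (lt_of_le_of_ne (hu0 q) hq.symm)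
  obtain ⟨L, U, d, ε, hLc, hKL, ⟨z, hz⟩, -, hd, hε, hU, hU0, hUint, hUL, -, hUd⟩ :=
    h.exists_transplant hK₁ (hI₁ ▸ subset_univ K₁) hs hu hu0 hpos huint
  obtain ⟨c, hc⟩ := hL U hU hU0 hUint
  have hUε : ∀ p, U p = ε := fun p => by rw [hc p, ← hc z, hUL z hz]
  have hf₁ := isLocallyFiniteMeasure_volumeMeasure g₁
  have hf₂ := isLocallyFiniteMeasure_volumeMeasure g₂
  have huc : Continuous u := hu.1
  have hA : MeasurableSet {q | u q < d} := (isOpen_lt huc continuous_const).measurableSet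
  have hsmall : volumeMeasure g₂ (φ.target ∩ {q | u q < d}) < ⊤ := by
    rw [h.isMeasureIso.measure_eq _ (φ.open_target.measurableSet.inter hA) inter_subset_left]
    refine (measure_mono ?_).trans_lt hLc.measure_lt_top
    rintro p ⟨-, -, hp⟩
    by_contra hpL
    exact absurd hp (not_lt.2 (hUd p hpL (hUε p)))
  have hbig : volumeMeasure g₂ {q | d ≤ u q} < ⊤ := by
    simpa only [Real.norm_eq_abs, abs_of_nonneg (hu0 _)] using huint.measure_norm_ge_lt_top hd
  have hvol : volumeMeasure g₂ univ < ⊤ := by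
    have hcover : (univ : Set M₂) ⊆ K₂ ∪ (φ.target ∩ {q | u q < d}) ∪ {q | d ≤ u q} := by
      intro q _
      by_cases hqd : d ≤ u q
      · exact Or.inr hqd
      · by_cases hqK : q ∈ K₂
        · exact Or.inl (Or.inl hqK)
        · exact Or.inl (Or.inr ⟨ht ▸ hqK, not_le.1 hqd⟩)
    exact (measure_mono hcover).trans_lt (measure_union_lt_top
      (measure_union_lt_top hK₂.measure_lt_top hsmall) hbig)
  exact isL1Liouville_of_finite_volume hg₂ hI₂ hvol u hu hu0 huint

end Transfer

section Main

variable {n₁ n₂ : ℕ} {H₁ H₂ : Type*} [TopologicalSpace H₁] [TopologicalSpace H₂]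
  {I₁ : ModelWithCorners ℝ (EuclideanSpace ℝ (Fin n₁)) H₁}
  {I₂ : ModelWithCorners ℝ (EuclideanSpace ℝ (Fin n₂)) H₂}
  {M₁ M₂ : Type*} [TopologicalSpace M₁] [ChartedSpace H₁ M₁] [IsManifold I₁ ∞ M₁]
  [TopologicalSpace M₂] [ChartedSpace H₂ M₂] [IsManifold I₂ ∞ M₂]
  [T2Space M₁] [T2Space M₂] [SecondCountableTopology M₁] [SecondCountableTopology M₂]
  [ConnectedSpace M₁] [ConnectedSpace M₂]
  [MeasurableSpace M₁] [BorelSpace M₁] [MeasurableSpace M₂] [BorelSpace M₂]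
  {g₁ : Metric I₁ M₁} {g₂ : Metric I₂ M₂} {K₁ : Set M₁} {K₂ : Set M₂}

theorem AreIsometricOutside.isDirichletL1Liouville_iff (h : AreIsometricOutside g₁ g₂ K₁ K₂)
    (hb : (I₁.boundary M₁).Nonempty) (hK₁ : IsCompact K₁) (hKi₁ : K₁ ⊆ I₁.interior M₁)
    (hK₂ : IsCompact K₂) (hKi₂ : K₂ ⊆ I₂.interior M₂) :
    IsDirichletL1Liouville g₁ ↔ IsDirichletL1Liouville g₂ := by
  obtain ⟨p, hp⟩ := hb
  have hpK : p ∈ K₁ᶜ := fun hpK => by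
    have := hKi₁ hpK
    rw [← I₁.compl_boundary] at this
    exact this hp
  obtain rfl := h.dim_eq ⟨p, hpK⟩
  obtain ⟨φ, hφ, hs, ht⟩ := h.exists_isLocalIsometry
  exact ⟨hφ.isDirichletL1Liouville hK₁ hKi₁ hs,
    hφ.symm.isDirichletL1Liouville hK₂ hKi₂ (by rw [φ.symm_source, ht])⟩

theorem AreIsometricOutside.isL1Liouville_iff (h : AreIsometricOutside g₁ g₂ K₁ K₂)
    (hI₁ : I₁.interior M₁ = univ) (hI₂ : I₂.interior M₂ = univ) (hg₁ : IsCompleteMetric g₁)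
    (hg₂ : IsCompleteMetric g₂) (hK₁ : IsCompact K₁) (hK₂ : IsCompact K₂) :
    IsL1Liouville g₁ ↔ IsL1Liouville g₂ := by
  rcases K₁ᶜ.eq_empty_or_nonempty with hemp | hne
  · obtain ⟨φ, hs, ht, -⟩ := h
    have hK₁u : K₁ = univ := compl_empty_iff.1 hemp
    have hK₂u : K₂ = univ := by
      rw [← compl_empty_iff, ← ht, ← φ.image_source_eq_target, hs, hemp, image_empty]
    have := isLocallyFiniteMeasure_volumeMeasure g₁
    have := isLocallyFiniteMeasure_volumeMeasure g₂
    exact iff_of_true (isL1Liouville_of_finite_volume hg₁ hI₁ (hK₁u ▸ hK₁).measure_lt_top)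
      (isL1Liouville_of_finite_volume hg₂ hI₂ (hK₂u ▸ hK₂).measure_lt_top)
  · obtain rfl := h.dim_eq hne
    obtain ⟨φ, hφ, hs, ht⟩ := h.exists_isLocalIsometry
    exact ⟨hφ.isL1Liouville hI₁ hI₂ hg₂ hK₁ hK₂ hs ht,
      hφ.symm.isL1Liouville hI₂ hI₁ hg₁ hK₂ hK₁ (by rw [φ.symm_source, ht])
        (by rw [φ.symm_target, hs])⟩

end Main

end L1Liouville

theorem mainTheorem9 :
    -- manifolds with nonempty boundary
    (∀ (m₁ m₂ : ℕ) [NeZero m₁] [NeZero m₂]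
      (M₁ : Type*) [TopologicalSpace M₁] [T2Space M₁] [SecondCountableTopology M₁]
      [ConnectedSpace M₁] [ChartedSpace (EuclideanHalfSpace m₁) M₁] [IsManifold (𝓡∂ m₁) ∞ M₁]
      [MeasurableSpace M₁] [BorelSpace M₁]
      (M₂ : Type*) [TopologicalSpace M₂] [T2Space M₂] [SecondCountableTopology M₂]
      [ConnectedSpace M₂] [ChartedSpace (EuclideanHalfSpace m₂) M₂] [IsManifold (𝓡∂ m₂) ∞ M₂]
      [MeasurableSpace M₂] [BorelSpace M₂]
      (g₁ : L1Liouville.Metric (𝓡∂ m₁) M₁) (g₂ : L1Liouville.Metric (𝓡∂ m₂) M₂)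
      (K₁ : Set M₁) (K₂ : Set M₂),
      ((𝓡∂ m₁).boundary M₁).Nonempty → ((𝓡∂ m₂).boundary M₂).Nonempty →
      IsCompact K₁ → K₁ ⊆ (𝓡∂ m₁).interior M₁ →
      IsCompact K₂ → K₂ ⊆ (𝓡∂ m₂).interior M₂ →
      L1Liouville.AreIsometricOutside g₁ g₂ K₁ K₂ →
      (L1Liouville.IsDirichletL1Liouville g₁ ↔ L1Liouville.IsDirichletL1Liouville g₂)) ∧
    -- complete manifolds without boundary
    (∀ (m₁ m₂ : ℕ)
      (M₁ : Type*) [TopologicalSpace M₁] [T2Space M₁] [SecondCountableTopology M₁]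
      [ConnectedSpace M₁] [ChartedSpace (EuclideanSpace ℝ (Fin m₁)) M₁] [IsManifold (𝓡 m₁) ∞ M₁]
      [MeasurableSpace M₁] [BorelSpace M₁]
      (M₂ : Type*) [TopologicalSpace M₂] [T2Space M₂] [SecondCountableTopology M₂]
      [ConnectedSpace M₂] [ChartedSpace (EuclideanSpace ℝ (Fin m₂)) M₂] [IsManifold (𝓡 m₂) ∞ M₂]
      [MeasurableSpace M₂] [BorelSpace M₂]
      (g₁ : L1Liouville.Metric (𝓡 m₁) M₁) (g₂ : L1Liouville.Metric (𝓡 m₂) M₂)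
      (K₁ : Set M₁) (K₂ : Set M₂),
      L1Liouville.IsCompleteMetric g₁ → L1Liouville.IsCompleteMetric g₂ →
      IsCompact K₁ → IsCompact K₂ →
      L1Liouville.AreIsometricOutside g₁ g₂ K₁ K₂ →
      (L1Liouville.IsL1Liouville g₁ ↔ L1Liouville.IsL1Liouville g₂)) :=

  ⟨fun _ _ _ _ _ _ _ _ _ _ _ _ _ _ _ _ _ _ _ _ _ _ _ _ _ _ hb _ hK₁ hKi₁ hK₂ hKi₂ h =>
      h.isDirichletL1Liouville_iff hb hK₁ hKi₁ hK₂ hKi₂,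
    fun _ _ _ _ _ _ _ _ _ _ _ _ _ _ _ _ _ _ _ _ _ _ _ _ hg₁ hg₂ hK₁ hK₂ h =>
      h.isL1Liouville_iff ModelWithCorners.interior_eq_univ
        ModelWithCorners.interior_eq_univ hg₁ hg₂ hK₁ hK₂⟩
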